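/- Let $n\ge 1$ and $\mathbb K=\mathbb Q(q,t)$. Let $x^{(i)}=(x^{(i)}_1,x^{(i)}_2,\dots)$, $1\le i\le n$, be $n$ infinite alphabets, and let $\Lambda_n$ be the $\mathbb K$-algebra of multi-symmetric functions, i.e. of formal power series of bounded degree over $\mathbb K$ in all these variables that are invariant under permuting the variables of each alphabet separately. A multi-partition is an $n$-tuple $\boldsymbol\lambda=(\lambda^{(1)},\dots,\lambda^{(n)})$ of partitions (of arbitrary degrees); write $|\boldsymbol\lambda|=\sum_i|\lambda^{(i)}|$. Put $$m_{\boldsymbol\lambda}=m_{\lambda^{(1)}}(x^{(1)})\cdots m_{\lambda^{(n)}}(x^{(n)}),\qquad p_{\boldsymbol\lambda}=p_{\lambda^{(1)}}(x^{(1)})\,p_{\lambda^{(2)}}(x^{(1)},x^{(2)})\cdots p_{\lambda^{(n)}}(x^{(1)},\dots,x^{(n)}),$$ where $m_\lambda$ and $p_\lambda$ are the usual monomial and power-sum symmetric functions and $p_\lambda(x^{(1)},\dots,x^{(i)})$ is taken in the union of the alphabets $x^{(1)},\dots,x^{(i)}$. The dominance ordering on multi-partitions is: $\boldsymbol\mu\le\boldsymbol\lambda$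 iff $$\sum_{i<k}|\mu^{(i)}|+\mu^{(k)}_1+\cdots+\mu^{(k)}_j\ \le\ \sum_{i<k}|\lambda^{(i)}|+\lambda^{(k)}_1+\cdots+\lambda^{(k)}_j\quad\text{for all } j\ge 0 \text{ and } 1\le k\le n.$$ There is a unique $\mathbb K$-bilinear form on $\Lambda_n$ such that $$\langle\!\langle p_{\boldsymbol\lambda},p_{\boldsymbol\mu}\rangle\!\rangle_{q,t,n}=\delta_{\boldsymbol\lambda\boldsymbol\mu}\,z_{\boldsymbol\lambda}(q,t),\qquad z_{\boldsymbol\lambda}(q,t)=q^{(n-1)|\boldsymbol\lambda|-\sum_i(i-1)|\lambda^{(i)}|}\,z_{\lambda^{(1)}}\cdots z_{\lambda^{(n)}}\prod_{i=1}^{\ell(\lambda^{(n)})}\frac{1-q^{\lambda^{(n)}_i}}{1-t^{\lambda^{(n)}_i}},$$ where $z_\lambda=\prod_{i\ge1}i^{m_i(\lambda)}m_i(\lambda)!$ and $m_i(\lambda)$ is the number of parts of $\lambda$ equal to $i$. There exists a unique $\mathbb K$-basis $\{P^{(q,t)}_{\boldsymbol\lambda}\}_{\boldsymbol\lambda}$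 of $\Lambda_n$, indexed by the multi-partitions, such that 1) for every $\boldsymbol\lambda$, $P^{(q,t)}_{\boldsymbol\lambda}=m_{\boldsymbol\lambda}+{}$a $\mathbb K$-linear combination of the $m_{\boldsymbol\mu}$ with $\boldsymbol\mu\le\boldsymbol\lambda$, $\boldsymbol\mu\ne\boldsymbol\lambda$; 2) $\langle\!\langle P^{(q,t)}_{\boldsymbol\lambda},P^{(q,t)}_{\boldsymbol\mu}\rangle\!\rangle_{q,t,n}=0$ whenever $\boldsymbol\lambda\neq\boldsymbol\mu$. Moreover, $P^{(q,t)}_{\boldsymbol\lambda}$ is homogeneous of degree $|\boldsymbol\lambda|$, so only $\boldsymbol\mu$ with $|\boldsymbol\mu|=|\boldsymbol\lambda|$ occur in 1). -/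

import Mathlib

noncomputable section

namespace MultiMac

/-- The field `ℚ(q,t)` of rational functions in two indeterminates. -/
abbrev Qqt : Type := FractionRing (MvPolynomial (Fin 2) ℚ)

/-- The indeterminate `q` of `ℚ(q,t)`. -/
def qVar : Qqt := algebraMap (MvPolynomial (Fin 2) ℚ) Qqt (MvPolynomial.X 0)

/-- The indeterminate `t` of `ℚ(q,t)`. -/
def tVar : Qqt := algebraMap (MvPolynomial (Fin 2) ℚ) Qqt (MvPolynomial.X 1)

/-! ### Partitions and multi-partitions -/

/-- A partition of an arbitrary natural number: the first component is its degree, the second the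
partition itself, given by the multiset of its nonzero parts. -/
abbrev Ptn : Type := Σ d : ℕ, Nat.Partition d

/-- The degree `|λ|`. -/
def Ptn.size (lam : Ptn) : ℕ := lam.1

/-- The multiset of (nonzero) parts of `λ`. -/
def Ptn.parts (lam : Ptn) : Multiset ℕ := lam.2.parts

/-- `λ₁ + ⋯ + λ_j`, the sum of the `j` largest parts (padding by zeros). -/
def Ptn.partialSum (lam : Ptn) (j : ℕ) : ℕ :=
  ((lam.parts.sort (fun a b => b ≤ a)).take j).sum

/-- `z_λ = ∏_i i ^ {m_i(λ)} m_i(λ)!`. -/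
def Ptn.z (lam : Ptn) : ℕ :=
  ∏ i ∈ lam.parts.toFinset, i ^ lam.parts.count i * (lam.parts.count i).factorial

/-- Multi-partitions: `n`-tuples of partitions. The entry at `i : Fin n` is `λ^{(i+1)}`. -/
abbrev MultiPtn (n : ℕ) : Type := Fin n → Ptn

/-- The total degree of a multi-partition. -/
def MultiPtn.size {n : ℕ} (lam : MultiPtn n) : ℕ := ∑ i, (lam i).size

/-- The dominance ordering `μ ≤ λ` on multi-partitions. -/
def Dominated {n : ℕ} (mu lam : MultiPtn n) : Prop :=
  ∀ (k : Fin n) (j : ℕ),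
    (∑ i ∈ Finset.univ.filter (· < k), (mu i).size) + (mu k).partialSum j ≤
      (∑ i ∈ Finset.univ.filter (· < k), (lam i).size) + (lam k).partialSum j

/-! ### Multi-symmetric functions -/

/-- The variables: `(i, r)` stands for the variable of index `r+1` of the alphabet `x^{(i+1)}`. -/
abbrev Var (n : ℕ) : Type := Fin n × ℕ

/-- The alphabet `x^{(i+1)}`. -/
def alphabet {n : ℕ} (i : Fin n) : Set (Var n) := {v | v.1 = i}

/-- The union of the alphabets `x^{(1)}, …, x^{(i+1)}`. -/
def nestedAlphabet {n : ℕ} (i : Fin n) : Set (Var n) := ⋃ j ≤ i, alphabet j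

/-- The permutation of the variables that permutes each alphabet `x^{(i+1)}` by `σ i`. -/
def permVars {n : ℕ} (σ : Fin n → Equiv.Perm ℕ) : Var n ≃ Var n :=
  Equiv.prodShear (Equiv.refl (Fin n)) σ

variable (K : Type*) [Field K]

/-- The multi-symmetric functions: the formal power series of bounded degree in the variables
`x^{(i)}_r` that are invariant under permuting the variables of each alphabet separately. -/
def MultiSym (n : ℕ) : Subalgebra K (MvPowerSeries (Var n) K) where
  carrier := {f | (∀ σ : Fin n → Equiv.Perm ℕ, MvPowerSeries.renameEquiv K (permVars σ) f = f) ∧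
    ∃ N : ℕ, ∀ d : Var n →₀ ℕ, N < d.degree → MvPowerSeries.coeff d f = 0}
  mul_mem' := by
    rintro f g ⟨hf, N, hN⟩ ⟨hg, M, hM⟩
    refine ⟨fun σ => by rw [map_mul, hf, hg], N + M, fun d hd => ?_⟩
    classical
    rw [MvPowerSeries.coeff_mul]
    refine Finset.sum_eq_zero fun p hp => ?_
    rw [Finset.HasAntidiagonal.mem_antidiagonal] at hp
    rw [← hp, map_add] at hd
    by_cases h : N < p.1.degree
    · rw [hN _ h, zero_mul]
    · rw [hM _ (by omega), mul_zero]
  add_mem' := by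
    rintro f g ⟨hf, N, hN⟩ ⟨hg, M, hM⟩
    refine ⟨fun σ => by rw [map_add, hf, hg], N + M, fun d hd => ?_⟩
    rw [map_add, hN _ (by omega), hM _ (by omega), add_zero]
  algebraMap_mem' := by
    intro r
    refine ⟨fun σ => AlgEquiv.commutes _ r, 0, fun d hd => ?_⟩
    classical
    rw [MvPowerSeries.algebraMap_apply, MvPowerSeries.coeff_C, if_neg]
    rintro rfl
    simp at hd

open scoped Classical in
/-- The monomial symmetric function `m_λ` in the variables of the alphabet `A`: the sum of all
monomials in these variables whose nonzero exponents are, up to order, the parts of `λ`. -/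
def monomialSeries {n : ℕ} (A : Set (Var n)) (lam : Ptn) : MvPowerSeries (Var n) K :=
  fun d => if (d.support : Set (Var n)) ⊆ A ∧ d.support.val.map d = lam.parts then 1 else 0

open scoped Classical in
/-- The power sum `p_k`, `k ≥ 1`, in the variables of the alphabet `A`: the sum of the `k`-th powers
of these variables. -/
def powerSumSeries {n : ℕ} (A : Set (Var n)) (k : ℕ) : MvPowerSeries (Var n) K :=
  fun d => if ∃ v ∈ A, d = Finsupp.single v k then 1 else 0

/-- `p_λ = p_{λ₁} p_{λ₂} ⋯` in the variables of the alphabet `A`. -/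
def powerSumProd {n : ℕ} (A : Set (Var n)) (lam : Ptn) : MvPowerSeries (Var n) K :=
  (lam.parts.map (powerSumSeries K A)).prod

variable {K}

/-- A set of variables stable under all the permutations `permVars σ`. -/
def StableAlphabet {n : ℕ} (A : Set (Var n)) : Prop :=
  ∀ (σ : Fin n → Equiv.Perm ℕ) (v : Var n), permVars σ v ∈ A ↔ v ∈ A

theorem stable_alphabet {n : ℕ} (i : Fin n) : StableAlphabet (alphabet i) :=
  fun _ _ => Iff.rfl

theorem stable_nestedAlphabet {n : ℕ} (i : Fin n) : StableAlphabet (nestedAlphabet i) := by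
  intro σ v
  simp only [nestedAlphabet, Set.mem_iUnion]
  exact Iff.rfl

theorem rename_eq_of_coeff {n : ℕ} (f : MvPowerSeries (Var n) K) (e : Var n ≃ Var n)
    (h : ∀ d, MvPowerSeries.coeff (d.equivMapDomain e) f = MvPowerSeries.coeff d f) :
    MvPowerSeries.renameEquiv K e f = f := by
  ext x
  obtain ⟨d, rfl⟩ : ∃ d : Var n →₀ ℕ, d.equivMapDomain e = x :=
    ⟨x.equivMapDomain e.symm, by ext; simp⟩
  rw [h]
  have := MvPowerSeries.coeff_embDomain_rename (R := K) e.toEmbedding f d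
  rw [Finsupp.embDomain_eq_mapDomain] at this
  rw [Finsupp.equivMapDomain_eq_mapDomain]
  exact this

theorem monomialSeries_mem {n : ℕ} {A : Set (Var n)} (hA : StableAlphabet A) (lam : Ptn) :
    monomialSeries K A lam ∈ MultiSym K n := by
  classical
  refine ⟨fun σ => rename_eq_of_coeff _ _ fun d => ?_, lam.size, fun d hd => ?_⟩
  · have h1 : (d.equivMapDomain (permVars σ)).support = d.support.map (permVars σ).toEmbedding := by
      rfl
    have h2 : ((((d.equivMapDomain (permVars σ)).support : Set (Var n)) ⊆ A) ↔
        (d.support : Set (Var n)) ⊆ A) := by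
      rw [h1, Finset.coe_map, Set.image_subset_iff]
      have : (permVars σ).toEmbedding ⁻¹' A = A := Set.ext fun v => hA σ v
      rw [this]
    have h3 : (d.equivMapDomain (permVars σ)).support.val.map (d.equivMapDomain (permVars σ)) =
        d.support.val.map d := by
      rw [h1, Finset.map_val, Multiset.map_map]
      refine Multiset.map_congr rfl fun v _ => ?_
      simp
    change (if _ then (1 : K) else 0) = if _ then 1 else 0
    rw [h2, h3]
  · change (if _ then (1 : K) else 0) = 0
    rw [if_neg]
    rintro ⟨-, h⟩
    have h4 : (d.support.val.map d).sum = lam.size := by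
      rw [h]; exact lam.2.parts_sum
    have h5 : d.degree = (d.support.val.map d).sum := rfl
    omega

theorem powerSumSeries_mem {n : ℕ} {A : Set (Var n)} (hA : StableAlphabet A) (k : ℕ) :
    powerSumSeries K A k ∈ MultiSym K n := by
  classical
  refine ⟨fun σ => rename_eq_of_coeff _ _ fun d => ?_, k, fun d hd => ?_⟩
  · have h : (∃ v ∈ A, d.equivMapDomain (permVars σ) = Finsupp.single v k) ↔
        ∃ v ∈ A, d = Finsupp.single v k := by
      constructor
      · rintro ⟨v, hv, h⟩
        refine ⟨(permVars σ).symm v, by rw [← hA σ]; simpa using hv, ?_⟩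
        rw [← Finsupp.equivMapDomain_single, ← h]
        ext; simp
      · rintro ⟨v, hv, rfl⟩
        exact ⟨permVars σ v, (hA σ v).2 hv, Finsupp.equivMapDomain_single _ _ _⟩
    change (if _ then (1 : K) else 0) = if _ then 1 else 0
    rw [h]
  · change (if _ then (1 : K) else 0) = 0
    rw [if_neg]
    rintro ⟨v, -, rfl⟩
    simp at hd

theorem powerSumProd_mem {n : ℕ} {A : Set (Var n)} (hA : StableAlphabet A) (lam : Ptn) :
    powerSumProd K A lam ∈ MultiSym K n := by
  refine Subalgebra.multiset_prod_mem _ fun f hf => ?_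
  obtain ⟨k, -, rfl⟩ := Multiset.mem_map.1 hf
  exact powerSumSeries_mem hA k

variable (K)

/-- The multi-monomial symmetric function
`m_λ(x^{(1)},…,x^{(n)}) = m_{λ^{(1)}}(x^{(1)}) ⋯ m_{λ^{(n)}}(x^{(n)})`. -/
def multiMonomial {n : ℕ} (lam : MultiPtn n) : MultiSym K n :=
  ⟨∏ i, monomialSeries K (alphabet i) (lam i),
    Subalgebra.prod_mem _ fun i _ => monomialSeries_mem (stable_alphabet i) (lam i)⟩

/-- The multi-power sum symmetric function
`p_λ = p_{λ^{(1)}}(x^{(1)}) p_{λ^{(2)}}(x^{(1)},x^{(2)}) ⋯ p_{λ^{(n)}}(x^{(1)},…,x^{(n)})`. -/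
def multiPowerSum {n : ℕ} (lam : MultiPtn n) : MultiSym K n :=
  ⟨∏ i, powerSumProd K (nestedAlphabet i) (lam i),
    Subalgebra.prod_mem _ fun i _ => powerSumProd_mem (stable_nestedAlphabet i) (lam i)⟩

variable {K}

/-- `z_λ(q,t) = q^{(n-1)|λ| - ∑_i (i-1)|λ^{(i)}|} z_{λ^{(1)}} ⋯ z_{λ^{(n)}}
∏_j (1 - q^{λ^{(n)}_j}) / (1 - t^{λ^{(n)}_j})`; the last product runs over the parts of the last
partition `λ^{(n)}` only. -/
def zWeight (q t : K) {n : ℕ} (lam : MultiPtn n) : K :=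
  q ^ (((n : ℤ) - 1) * (MultiPtn.size lam : ℤ) - ∑ i : Fin n, (i.val : ℤ) * ((lam i).size : ℤ)) *
    (∏ i, ((lam i).z : K)) *
    ∏ i : Fin n, if i.val + 1 = n then
      ((lam i).parts.map fun k => (1 - q ^ k) / (1 - t ^ k)).prod else 1

open scoped Classical in
/-- `B` is the scalar product `⟨⟨·,·⟩⟩_{q,t,n}`: the bilinear form with
`⟨⟨p_λ, p_μ⟩⟩ = δ_{λμ} z_λ(q,t)`. -/
def IsScalarProduct (q t : K) {n : ℕ} (B : LinearMap.BilinForm K (MultiSym K n)) : Prop :=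
  ∀ lam mu : MultiPtn n,
    B (multiPowerSum K lam) (multiPowerSum K mu) = if lam = mu then zWeight q t lam else 0

/-- `P_λ = m_λ + lower terms` for all `λ`: the difference `P_λ - m_λ` is a linear combination of
the `m_μ` with `μ < λ` in the dominance ordering. -/
def IsUnitriangular {n : ℕ} (P : MultiPtn n → MultiSym K n) : Prop :=
  ∀ lam : MultiPtn n, P lam - multiMonomial K lam ∈
    Submodule.span K (multiMonomial K '' {mu | Dominated mu lam ∧ mu ≠ lam})

/-- The `P_λ` are pairwise orthogonal for `B`. -/
def IsOrthogonal {n : ℕ} (B : LinearMap.BilinForm K (MultiSym K n))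
    (P : MultiPtn n → MultiSym K n) : Prop :=
  ∀ lam mu : MultiPtn n, lam ≠ mu → B (P lam) (P mu) = 0

end MultiMac

end

/-!
The multi-symmetric functions are polynomials in the power sums `p_k(x^{(i)})`, and for fixed `k`
the power sums of the `n` alphabets span an `n`-dimensional space on which the scalar product is
known: the nested power sums `P_i = p_k(x^{(1)}, …, x^{(i)})` are orthogonal. The proof rests on
another orthogonal basis of this space. Put `Y_n = x_n` and `Y_i = x_i + β_i Y_{i+1}` with
`x_i = p_k(x^{(i)})`; for suitable scalars `β_i` (`flagBeta`, depending on `k`), the `Y_i` are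
orthogonal, and their norms `flagNorm` are, up to a factor `s^k`, those of the power sums of one
alphabet for Macdonald's scalar product with parameters `(q^{n-i+1} t, q^{n-i} t)` (for `i > 1`) or
`(q, q^{n-1} t)` (for `i = 1`); see `sum_nestedCoeff_mul_nestedCoeff`. So the scalar product is a
tensor product of `n` Macdonald scalar products, and the functions `P_λ` are the products
`∏_i f_{λ^{(i)}}[Y_i]` of Macdonald polynomials with these parameters, evaluated at the `Y_i`
(`exists_orthogonal_basis`).

The Macdonald polynomials `f_λ` of one alphabet are constructed by `exists_macdonald` as polynomials
in power sums. Macdonald's operator `∑_k (s/t)^k γ_k γ_k^⊥` is self-adjoint (`macOp_selfAdjoint`)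
and triangular on the basis of the products `g_λ` (`macOp_gPtn_sub_mem`), with distinct eigenvalues
(`macEig_injective`) as `q` and `t` are algebraically independent. Its eigenvectors are orthogonal,
and `g_l` is dual to the extraction of the coefficient of `x_1^{l_1} x_2^{l_2} ⋯`
(`polyForm_gList_mul`), so triangularity in the `g_λ` turns into triangularity of the duals in the
monomial symmetric functions.

Since `Y_i` is `x_i` plus a combination of the later alphabets, a monomial in `f_{λ^{(i)}}[Y_i]` has
degree `|λ^{(i)}|`, involves no earlier alphabet, and satisfies the dominance bounds of `λ^{(i)}` in
the alphabet `x^{(i)}` (`hasLeading_flagHom`). The sums compared in the dominance ordering of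
multi-partitions are additive in the exponents, so these bounds add up to the unitriangularity of
the product (`HasLeading.sub_mem`). As the `m_λ` form a basis (`exists_multiMonomial_basis`), so do
the `P_λ`; hence the power sums are algebraically independent generators, the scalar product exists
and is unique, and the `P_λ` are orthogonal with nonzero norms. A unitriangular orthogonal basis
without isotropic members is unique (`Unitri.eq_of_orthogonal`).
-/

noncomputable section

namespace MultiMac

/-! ### Unitriangular families -/

section Triangular

variable {K V ι : Type*} [Field K] [AddCommGroup V] [Module K V]

/-- `v` is unitriangular with respect to `b` and the relation `r`: each `v i` is `b i` plus a
linear combination of the `b j` with `r j i`. -/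
def Unitri (K : Type*) {V ι : Type*} [Field K] [AddCommGroup V] [Module K V] (r : ι → ι → Prop)
    (b v : ι → V) : Prop :=
  ∀ i, v i - b i ∈ Submodule.span K (b '' {j | r j i})

theorem span_image_mono_of_trans {r : ι → ι → Prop} (htr : ∀ i j k, r i j → r j k → r i k)
    (b : ι → V) {i j : ι} (h : r i j) :
    Submodule.span K (b '' {k | r k i}) ≤ Submodule.span K (b '' {k | r k j}) :=
  Submodule.span_mono (Set.image_mono fun k hk => htr k i j hk h)

theorem Unitri.span_le {r : ι → ι → Prop} {b v : ι → V} (h : Unitri K r b v)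
    (htr : ∀ i j k, r i j → r j k → r i k) (i : ι) :
    Submodule.span K (v '' {j | r j i}) ≤ Submodule.span K (b '' {j | r j i}) := by
  rw [Submodule.span_le]
  rintro _ ⟨j, hj, rfl⟩
  have h1 := span_image_mono_of_trans htr b hj (h j)
  have h2 : b j ∈ Submodule.span K (b '' {j | r j i}) := Submodule.subset_span ⟨j, hj, rfl⟩
  simpa using add_mem h1 h2

theorem Unitri.symm {r : ι → ι → Prop} {b v : ι → V} (h : Unitri K r b v) (hwf : WellFounded r)
    (htr : ∀ i j k, r i j → r j k → r i k) : Unitri K r v b := by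
  intro i
  induction i using hwf.induction with
  | _ i ih =>
    have hle : Submodule.span K (b '' {j | r j i}) ≤ Submodule.span K (v '' {j | r j i}) := by
      rw [Submodule.span_le]
      rintro _ ⟨j, hj, rfl⟩
      have h1 := span_image_mono_of_trans htr v hj (ih j hj)
      have h2 : v j ∈ Submodule.span K (v '' {j | r j i}) := Submodule.subset_span ⟨j, hj, rfl⟩
      simpa using add_mem h1 h2
    have := neg_mem (hle (h i))
    simpa using this

theorem Unitri.top_le_span {r : ι → ι → Prop} {b v : ι → V} (h : Unitri K r b v)
    (hwf : WellFounded r) (htr : ∀ i j k, r i j → r j k → r i k)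
    (hb : ⊤ ≤ Submodule.span K (Set.range b)) : ⊤ ≤ Submodule.span K (Set.range v) := by
  refine hb.trans ?_
  rw [Submodule.span_le]
  rintro _ ⟨i, rfl⟩
  have h1 := Submodule.span_mono (Set.image_subset_range v _) (h.symm hwf htr i)
  have h2 : v i ∈ Submodule.span K (Set.range v) := Submodule.subset_span ⟨i, rfl⟩
  simpa using add_mem h1 h2

/-- In a dependency, the coefficient of a basis vector with `r`-maximal index comes from a single
member of the family. -/
theorem Unitri.linearIndependent {r : ι → ι → Prop} {v : ι → V} (b : Module.Basis ι K V)
    (h : Unitri K r b v) (hirr : ∀ i, ¬ r i i) (htr : ∀ i j k, r i j → r j k → r i k) :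
    LinearIndependent K v := by
  classical
  rw [linearIndependent_iff]
  intro l hl
  by_contra hne
  have hso : IsStrictOrder ι (Function.swap r) :=
    { irrefl := hirr, trans := fun a b c h1 h2 => htr _ _ _ h2 h1 }
  have hwf : (l.support : Set ι).WellFoundedOn (Function.swap r) :=
    Set.Finite.wellFoundedOn l.support.finite_toSet
  -- an element of the support that is maximal for `r`
  obtain ⟨i, hi, hmax⟩ : ∃ i ∈ l.support, ∀ j ∈ l.support, ¬ r i j := by
    obtain ⟨⟨i, hi⟩, -, hm⟩ := WellFounded.has_min hwf Set.univ
      (by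
        obtain ⟨i, hi⟩ := Finsupp.support_nonempty_iff.2 hne
        exact ⟨⟨i, hi⟩, trivial⟩)
    exact ⟨i, hi, fun j hj hij => hm ⟨j, hj⟩ trivial hij⟩
  have hrep : ∀ j k, b.repr (v j - b j) k ≠ 0 → r k j := by
    intro j k h0
    have hsub : ((b.repr (v j - b j)).support : Set ι) ⊆ {k | r k j} := b.mem_span_image.1 (h j)
    exact hsub (Finsupp.mem_support_iff.2 h0)
  have hrv : ∀ j, b.repr (v j) = b.repr (v j - b j) + Finsupp.single j 1 := by
    intro j
    rw [← b.repr_self, ← map_add, sub_add_cancel]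
  have hcoef : ∀ j ∈ l.support, j ≠ i → b.repr (v j) i = 0 := by
    intro j hj hji
    rw [hrv, Finsupp.add_apply, Finsupp.single_eq_of_ne (Ne.symm hji), add_zero]
    by_contra h0
    exact hmax j hj (hrep j i h0)
  have hii : b.repr (v i) i = 1 := by
    have h0 : b.repr (v i - b i) i = 0 := by
      by_contra h0
      exact hirr i (hrep i i h0)
    rw [hrv, Finsupp.add_apply, Finsupp.single_eq_same, h0, zero_add]
  have hz : b.repr (Finsupp.linearCombination K v l) i = l i := by
    rw [Finsupp.linearCombination_apply, Finsupp.sum, map_sum, Finsupp.finsetSum_apply,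
      Finset.sum_eq_single i]
    · simp [hii]
    · intro j hj hji
      simp [hcoef j hj hji]
    · intro h0
      exact absurd hi h0
  rw [hl] at hz
  exact Finsupp.mem_support_iff.1 hi (by simpa using hz.symm)

/-- An endomorphism that is triangular with pairwise distinct diagonal entries has an eigenbasis
that is unitriangular. -/
theorem exists_unitri_eigenvectors {r : ι → ι → Prop} (hwf : WellFounded r)
    (htr : ∀ i j k, r i j → r j k → r i k) (b : ι → V) (E : V →ₗ[K] V) (e : ι → K)
    (he : ∀ i j, r j i → e j ≠ e i)
    (hE : ∀ i, E (b i) - e i • b i ∈ Submodule.span K (b '' {j | r j i})) :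
    ∃ v : ι → V, Unitri K r b v ∧ ∀ i, E (v i) = e i • v i := by
  -- `E - e i` maps the span of the `b k`, `k = j` or `r k j`, onto a space containing `b j`
  have key : ∀ i j, r j i → ∃ x ∈ Submodule.span K (b '' {k | r k i}), E x - e i • x = b j := by
    intro i j
    induction j using hwf.induction with
    | _ j ih =>
      intro hji
      have hsub : ∀ y ∈ Submodule.span K (b '' {k | r k j}),
          ∃ x ∈ Submodule.span K (b '' {k | r k i}), E x - e i • x = y := by
        intro y hy
        induction hy using Submodule.span_induction with
        | mem y hy =>
          obtain ⟨k, hk, rfl⟩ := hy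
          exact ih k hk (htr _ _ _ hk hji)
        | zero => exact ⟨0, zero_mem _, by simp⟩
        | add y z _ _ h1 h2 =>
          obtain ⟨x1, hx1, rfl⟩ := h1
          obtain ⟨x2, hx2, rfl⟩ := h2
          exact ⟨x1 + x2, add_mem hx1 hx2, by rw [map_add, smul_add]; abel⟩
        | smul a y _ h1 =>
          obtain ⟨x1, hx1, rfl⟩ := h1
          exact ⟨a • x1, Submodule.smul_mem _ _ hx1, by
            rw [map_smul, smul_sub, smul_comm]⟩
      obtain ⟨x, hx, hxe⟩ := hsub _ (hE j)
      have hne : e j - e i ≠ 0 := sub_ne_zero.2 (he i j hji)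
      refine ⟨(e j - e i)⁻¹ • (b j - x), Submodule.smul_mem _ _
        (sub_mem (Submodule.subset_span ⟨j, hji, rfl⟩) hx), ?_⟩
      have : E (b j - x) - e i • (b j - x) = (e j - e i) • b j := by
        rw [map_sub, smul_sub, sub_smul]
        have : E x = (E (b j) - e j • b j) + e i • x := by rw [← hxe]; abel
        rw [this]
        abel
      rw [map_smul, smul_comm, ← smul_sub, this, smul_smul, inv_mul_cancel₀ hne, one_smul]
  have key2 : ∀ i, ∀ y ∈ Submodule.span K (b '' {k | r k i}),
      ∃ x ∈ Submodule.span K (b '' {k | r k i}), E x - e i • x = y := by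
    intro i y hy
    induction hy using Submodule.span_induction with
    | mem y hy =>
      obtain ⟨k, hk, rfl⟩ := hy
      exact key i k hk
    | zero => exact ⟨0, zero_mem _, by simp⟩
    | add y z _ _ h1 h2 =>
      obtain ⟨x1, hx1, rfl⟩ := h1
      obtain ⟨x2, hx2, rfl⟩ := h2
      exact ⟨x1 + x2, add_mem hx1 hx2, by rw [map_add, smul_add]; abel⟩
    | smul a y _ h1 =>
      obtain ⟨x1, hx1, rfl⟩ := h1
      exact ⟨a • x1, Submodule.smul_mem _ _ hx1, by rw [map_smul, smul_sub, smul_comm]⟩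
  choose x hx hxe using fun i => key2 i _ (hE i)
  refine ⟨fun i => b i - x i, fun i => ?_, fun i => ?_⟩
  · have := neg_mem (hx i)
    simpa using this
  · have : E (x i) = (E (b i) - e i • b i) + e i • x i := by rw [← hxe]; abel
    rw [map_sub, this, smul_sub]
    abel

/-- A unitriangular orthogonal family for a form without isotropic members is unique. -/
theorem Unitri.eq_of_orthogonal {r : ι → ι → Prop} (hwf : WellFounded r)
    (htr : ∀ i j k, r i j → r j k → r i k) (hirr : ∀ i, ¬ r i i) {b v w : ι → V}
    (B : LinearMap.BilinForm K V) (hv : Unitri K r b v) (hw : Unitri K r b w)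
    (hvo : ∀ i j, i ≠ j → B (v i) (v j) = 0) (hwo : ∀ i j, i ≠ j → B (w i) (w j) = 0)
    (hn : ∀ i, B (v i) (v i) ≠ 0) : w = v := by
  classical
  funext i
  induction i using hwf.induction with
  | _ i ih =>
    have hmem : w i - v i ∈ Submodule.span K (v '' {j | r j i}) := by
      have h1 : w i - v i ∈ Submodule.span K (b '' {j | r j i}) := by
        simpa using sub_mem (hw i) (hv i)
      exact (hv.symm hwf htr).span_le htr i h1
    have hperp : ∀ j, r j i → B (w i - v i) (v j) = 0 := by
      intro j hj
      have hne : i ≠ j := by rintro rfl; exact hirr _ hj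
      rw [map_sub, LinearMap.sub_apply, hvo i j hne, ← ih j hj, hwo i j hne, sub_zero]
    obtain ⟨l, hl, hle⟩ := (Finsupp.mem_span_image_iff_linearCombination K).1 hmem
    have hl0 : l = 0 := by
      ext j
      by_contra hj
      have hjs : j ∈ l.support := by simpa using hj
      have hrj : r j i := hl hjs
      have := hperp j hrj
      rw [← hle, Finsupp.linearCombination_apply, Finsupp.sum, map_sum, LinearMap.sum_apply,
        Finset.sum_eq_single j] at this
      · rw [map_smul, LinearMap.smul_apply, smul_eq_mul] at this
        exact (mul_ne_zero hj (hn j)) this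
      · intro k _ hkj
        rw [map_smul, LinearMap.smul_apply, hvo k j hkj, smul_zero]
      · intro h
        exact absurd hjs h
    rw [hl0, map_zero] at hle
    exact (sub_eq_zero.1 hle.symm)

end Triangular

/-! ### Partitions, their dominance order, and raisings of sequences -/

theorem wellFounded_of_finite {ι : Type*} {r : ι → ι → Prop} (hirr : ∀ i, ¬ r i i)
    (htr : ∀ i j k, r i j → r j k → r i k) (hfin : ∀ i, {j | r j i}.Finite) : WellFounded r := by
  refine Subrelation.wf (r := InvImage (· < ·) fun i => {j | r j i}.ncard) ?_
    (InvImage.wf _ wellFounded_lt)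
  intro i j hij
  refine Set.ncard_lt_ncard ?_ (hfin j)
  exact ⟨fun k hk => htr _ _ _ hk hij, fun h => hirr i (h hij)⟩

theorem Ptn.size_eq_sum (lam : Ptn) : lam.size = lam.parts.sum := lam.2.parts_sum.symm

theorem Ptn.ext_parts {lam mu : Ptn} (h : lam.parts = mu.parts) : lam = mu := by
  have h1 : lam.size = mu.size := by rw [size_eq_sum, size_eq_sum, h]
  obtain ⟨d, lam⟩ := lam
  obtain ⟨e, mu⟩ := mu
  change d = e at h1
  subst h1
  congr 1
  exact Nat.Partition.ext h

theorem Ptn.pos_of_mem {lam : Ptn} {k : ℕ} (h : k ∈ lam.parts) : 0 < k := lam.2.parts_pos h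

/-- The parts of `λ` in weakly decreasing order. -/
def Ptn.descList (lam : Ptn) : List ℕ := lam.parts.sort (fun a b => b ≤ a)

theorem Ptn.coe_descList (lam : Ptn) : (lam.descList : Multiset ℕ) = lam.parts :=
  Multiset.sort_eq _ _

theorem Ptn.pairwise_descList (lam : Ptn) : lam.descList.Pairwise (fun a b => b ≤ a) :=
  Multiset.pairwise_sort _ _

theorem Ptn.partialSum_eq (lam : Ptn) (j : ℕ) : lam.partialSum j = (lam.descList.take j).sum := rfl

theorem Ptn.sum_descList (lam : Ptn) : lam.descList.sum = lam.size := by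
  rw [size_eq_sum, ← coe_descList, Multiset.sum_coe]

theorem Ptn.partialSum_zero (lam : Ptn) : lam.partialSum 0 = 0 := by
  simp [partialSum_eq]

theorem Ptn.partialSum_of_length_le (lam : Ptn) {j : ℕ} (h : lam.descList.length ≤ j) :
    lam.partialSum j = lam.size := by
  rw [partialSum_eq, List.take_of_length_le h, sum_descList]

theorem Ptn.partialSum_le_size (lam : Ptn) (j : ℕ) : lam.partialSum j ≤ lam.size := by
  rw [partialSum_eq, ← sum_descList]
  conv_rhs => rw [← List.take_append_drop j lam.descList, List.sum_append]
  exact Nat.le_add_right _ _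

theorem sum_le_sum_take_of_pairwise {L : List ℕ} (hL : L.Pairwise (fun a b => b ≤ a)) :
    ∀ (j : ℕ) (t : Multiset ℕ), t ≤ (L : Multiset ℕ) → t.card ≤ j → t.sum ≤ (L.take j).sum := by
  induction L with
  | nil =>
    intro j t ht _
    have : t = 0 := by simpa using ht
    simp [this]
  | cons a L ih =>
    intro j t ht hc
    rw [List.pairwise_cons] at hL
    rw [← Multiset.cons_coe] at ht
    rcases Nat.eq_zero_or_pos j with rfl | hj
    · have : t = 0 := by simpa using hc
      simp [this]
    obtain ⟨j, rfl⟩ : ∃ i, j = i + 1 := ⟨j - 1, by omega⟩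
    rw [List.take_succ_cons, List.sum_cons]
    by_cases ha : a ∈ t
    · obtain ⟨t, rfl⟩ := Multiset.exists_cons_of_mem ha
      rw [Multiset.cons_le_cons_iff] at ht
      rw [Multiset.card_cons] at hc
      rw [Multiset.sum_cons]
      have := ih hL.2 j t ht (by omega)
      omega
    · rw [Multiset.le_cons_of_notMem ha] at ht
      rcases t.empty_or_exists_mem with rfl | ⟨b, hb⟩
      · simp
      obtain ⟨t, rfl⟩ := Multiset.exists_cons_of_mem hb
      rw [Multiset.card_cons] at hc
      rw [Multiset.sum_cons]
      have h1 := ih hL.2 j t ((Multiset.le_cons_self t b).trans ht) (by omega)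
      have h2 : b ≤ a := hL.1 b (by
        have := Multiset.mem_of_le ht hb
        simpa using this)
      omega

/-- `λ₁ + ⋯ + λ_j` is the largest sum of at most `j` parts of `λ`. -/
theorem Ptn.sum_le_partialSum (lam : Ptn) {j : ℕ} {t : Multiset ℕ} (ht : t ≤ lam.parts)
    (hc : t.card ≤ j) : t.sum ≤ lam.partialSum j :=
  sum_le_sum_take_of_pairwise lam.pairwise_descList j t (by rwa [coe_descList]) hc

theorem list_eq_of_take_sum_eq : ∀ {L M : List ℕ}, (∀ a ∈ L, 0 < a) → (∀ a ∈ M, 0 < a) →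
    (∀ j, (L.take j).sum = (M.take j).sum) → L = M
  | [], [], _, _, _ => rfl
  | [], a :: M, _, hM, h => by
    have := h 1
    have := hM a (by simp)
    simp_all
  | a :: L, [], hL, _, h => by
    have := h 1
    have := hL a (by simp)
    simp_all
  | a :: L, b :: M, hL, hM, h => by
    have hab : a = b := by simpa using h 1
    subst hab
    rw [list_eq_of_take_sum_eq (L := L) (M := M) (fun x hx => hL x (by simp [hx]))
      (fun x hx => hM x (by simp [hx])) fun j => by simpa using h (j + 1)]

theorem Ptn.eq_of_partialSum_eq {lam mu : Ptn} (h : ∀ j, lam.partialSum j = mu.partialSum j) :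
    lam = mu := by
  have h1 : lam.descList = mu.descList := by
    refine list_eq_of_take_sum_eq (fun a ha => ?_) (fun a ha => ?_) h
    · exact pos_of_mem (lam := lam) (by rw [← coe_descList]; simpa using ha)
    · exact pos_of_mem (lam := mu) (by rw [← coe_descList]; simpa using ha)
  exact ext_parts (by rw [← coe_descList, ← coe_descList, h1])

theorem Ptn.finite_size_le (N : ℕ) : {lam : Ptn | lam.size ≤ N}.Finite := by
  have : {lam : Ptn | lam.size ≤ N} ⊆ Set.range
      (fun x : Σ d : Fin (N + 1), Nat.Partition d => (⟨x.1, x.2⟩ : Ptn)) := by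
    rintro ⟨d, lam⟩ h
    exact ⟨⟨⟨d, Nat.lt_succ_of_le h⟩, lam⟩, rfl⟩
  exact (Set.finite_range _).subset this

/-- `ν` lies strictly above `λ` in the dominance order of the partitions of the same degree. -/
def Ptn.Higher (nu lam : Ptn) : Prop :=
  nu.size = lam.size ∧ (∀ j, lam.partialSum j ≤ nu.partialSum j) ∧ nu ≠ lam

theorem Ptn.Higher.irrefl (lam : Ptn) : ¬ lam.Higher lam := fun h => h.2.2 rfl

theorem Ptn.Higher.trans (a b c : Ptn) (h1 : a.Higher b) (h2 : b.Higher c) : a.Higher c := by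
  refine ⟨h1.1.trans h2.1, fun j => (h2.2.1 j).trans (h1.2.1 j), ?_⟩
  rintro rfl
  exact h1.2.2 (eq_of_partialSum_eq fun j => le_antisymm (h2.2.1 j) (h1.2.1 j))

theorem Ptn.Higher.wf : WellFounded Ptn.Higher :=
  wellFounded_of_finite Higher.irrefl Higher.trans fun lam =>
    (finite_size_le lam.size).subset fun _ h => h.1.le

/-- The partition whose parts are the nonzero members of a multiset. -/
def Ptn.ofMultiset (s : Multiset ℕ) : Ptn := ⟨s.sum, Nat.Partition.ofSums _ s rfl⟩

theorem Ptn.parts_ofMultiset (s : Multiset ℕ) : (ofMultiset s).parts = s.filter (· ≠ 0) := rfl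

theorem Ptn.size_ofMultiset (s : Multiset ℕ) : (ofMultiset s).size = s.sum := rfl

theorem Ptn.ofMultiset_parts (lam : Ptn) : ofMultiset lam.parts = lam :=
  ext_parts (by
    rw [parts_ofMultiset, Multiset.filter_eq_self]
    intro a ha
    exact (pos_of_mem ha).ne')

theorem sum_filter_ne_zero (t : Multiset ℕ) : (t.filter (· ≠ 0)).sum = t.sum := by
  induction t using Multiset.induction with
  | empty => simp
  | cons a t ih =>
    by_cases ha : a = 0
    · simpa [Multiset.filter_cons, ha] using ih
    · simpa [Multiset.filter_cons, ha] using ih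

theorem Ptn.sum_le_partialSum_ofMultiset {s t : Multiset ℕ} (h : t ≤ s) {j : ℕ}
    (hc : t.card ≤ j) : t.sum ≤ (ofMultiset s).partialSum j := by
  rw [← sum_filter_ne_zero]
  refine sum_le_partialSum _ ?_ ((Multiset.card_le_card (Multiset.filter_le _ _)).trans hc)
  rw [parts_ofMultiset]
  exact Multiset.filter_le_filter _ h

/-- `ν` arises from the sequence `l` by moving weight towards the end: all the sums over final
segments weakly increase, and the total is kept. -/
def Raise (l nu : List ℕ) : Prop :=
  l.length = nu.length ∧ l.sum = nu.sum ∧ ∀ i, (l.drop i).sum ≤ (nu.drop i).sum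

theorem Raise.refl (l : List ℕ) : Raise l l := ⟨rfl, rfl, fun _ => le_rfl⟩

theorem Raise.cons {l nu : List ℕ} (h : Raise l nu) (r : ℕ) : Raise (r :: l) (r :: nu) := by
  refine ⟨by simp [h.1], by simp [h.2.1], fun i => ?_⟩
  cases i with
  | zero => simp [h.2.1]
  | succ i => simpa using h.2.2 i

theorem drop_sum_le_of_update (l1 l2 : List ℕ) (x p i : ℕ) :
    ((l1 ++ x :: l2).drop i).sum ≤ ((l1 ++ (x + p) :: l2).drop i).sum := by
  induction l1 generalizing i with
  | nil =>
    cases i with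
    | zero => simp
    | succ i => simp
  | cons a l1 ih =>
    cases i with
    | zero => simp
    | succ i => simpa using ih i

theorem Raise.cons_move {l l1 l2 : List ℕ} {x r p : ℕ} (h : Raise l (l1 ++ x :: l2))
    (hp : p ≤ r) : Raise (r :: l) ((r - p) :: (l1 ++ (x + p) :: l2)) := by
  obtain ⟨h1, h2, h3⟩ := h
  have hs : (r :: l).sum = ((r - p) :: (l1 ++ (x + p) :: l2)).sum := by
    simp only [List.sum_cons, List.sum_append] at h2 ⊢
    omega
  refine ⟨by simpa using h1, hs, fun i => ?_⟩
  cases i with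
  | zero => exact hs.le
  | succ i =>
    rw [List.drop_succ_cons, List.drop_succ_cons]
    exact (h3 i).trans (drop_sum_le_of_update _ _ _ _ _)

theorem list_eq_of_drop_sum_eq : ∀ {l m : List ℕ}, l.length = m.length →
    (∀ i, (l.drop i).sum = (m.drop i).sum) → l = m
  | [], [], _, _ => rfl
  | [], _ :: _, h, _ => by simp at h
  | _ :: _, [], h, _ => by simp at h
  | a :: l, b :: m, hl, h => by
    have h1 := list_eq_of_drop_sum_eq (l := l) (m := m) (by simpa using hl)
      fun i => by simpa using h (i + 1)
    subst h1
    have := h 0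
    simp at this
    rw [this]

theorem Ptn.partialSum_eq_drop (lam : Ptn) (j : ℕ) :
    lam.partialSum j = (lam.descList.reverse.drop (lam.descList.length - j)).sum := by
  rw [List.drop_reverse, List.sum_reverse, partialSum_eq]
  congr 1
  rcases le_total j lam.descList.length with h | h
  · rw [Nat.sub_sub_self h]
  · rw [Nat.sub_eq_zero_of_le h, Nat.sub_zero, List.take_of_length_le h, List.take_length]

/-- A nontrivial raising of the increasing sequence of the parts of `λ` has, after sorting, a
strictly larger partition. -/
theorem Raise.higher {lam : Ptn} {nu : List ℕ} (h : Raise lam.descList.reverse nu)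
    (hne : nu ≠ lam.descList.reverse) : (Ptn.ofMultiset (nu : Multiset ℕ)).Higher lam := by
  obtain ⟨h1, h2, h3⟩ := h
  have hlen : lam.descList.length = nu.length := by simpa using h1
  have hdrop : ∀ i, ((nu.drop i : List ℕ) : Multiset ℕ) ≤ (nu : Multiset ℕ) := fun i =>
    Multiset.coe_le.2 (List.drop_sublist i nu).subperm
  refine ⟨?_, fun j => ?_, ?_⟩
  · rw [Ptn.size_ofMultiset, Multiset.sum_coe, ← h2, List.sum_reverse, Ptn.sum_descList]
  · rw [Ptn.partialSum_eq_drop]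
    refine (h3 _).trans ?_
    rw [← Multiset.sum_coe]
    refine Ptn.sum_le_partialSum_ofMultiset (hdrop _) ?_
    simp only [Multiset.coe_card, List.length_drop]
    omega
  · intro heq
    apply hne
    refine list_eq_of_drop_sum_eq h1.symm fun i => le_antisymm ?_ (h3 i)
    rcases le_total i nu.length with hi | hi
    · have := Ptn.sum_le_partialSum_ofMultiset (hdrop i) (j := nu.length - i) (by simp)
      rw [heq, Ptn.partialSum_eq_drop, hlen, Nat.sub_sub_self hi] at this
      simpa using this
    · rw [List.drop_of_length_le hi]
      simp

/-! ### Power series with prescribed logarithmic derivative -/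

section Newton

variable {A : Type*} [CommRing A]

/-- `h` is the exponential of the primitive of `p`: it has constant term `1` and logarithmic
derivative `p`. For the coefficients this is a recursion of Newton's type. -/
def IsNewton (p h : PowerSeries A) : Prop :=
  PowerSeries.constantCoeff h = 1 ∧ PowerSeries.derivative A h = p * h

theorem IsNewton.mul {p p' h h' : PowerSeries A} (H : IsNewton p h) (H' : IsNewton p' h') :
    IsNewton (p + p') (h * h') := by
  refine ⟨by rw [map_mul, H.1, H'.1, one_mul], ?_⟩
  rw [Derivation.leibniz, H.2, H'.2, smul_eq_mul, smul_eq_mul]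
  ring

theorem IsNewton.map {B : Type*} [CommRing B] (φ : A →+* B) {p h : PowerSeries A}
    (H : IsNewton p h) : IsNewton (p.map φ) (h.map φ) := by
  refine ⟨by rw [← PowerSeries.coeff_zero_eq_constantCoeff_apply, PowerSeries.coeff_map,
    PowerSeries.coeff_zero_eq_constantCoeff_apply, H.1, map_one], ?_⟩
  rw [← map_mul, ← H.2]
  ext n
  simp [PowerSeries.coeff_derivative]

theorem IsNewton.rec_formula {p h : PowerSeries A} (H : IsNewton p h) (n : ℕ) :
    ((n : A) + 1) * PowerSeries.coeff (n + 1) h =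
      ∑ i ∈ Finset.range (n + 1), PowerSeries.coeff i p * PowerSeries.coeff (n - i) h := by
  have := congrArg (PowerSeries.coeff n) H.2
  rw [PowerSeries.coeff_derivative, PowerSeries.coeff_mul,
    Finset.Nat.sum_antidiagonal_eq_sum_range_succ
      (fun i j => PowerSeries.coeff i p * PowerSeries.coeff j h)] at this
  rw [← this, mul_comm]

theorem IsNewton.unique [IsDomain A] [CharZero A] {p h h' : PowerSeries A} (H : IsNewton p h)
    (H' : IsNewton p h') : h = h' := by
  ext n
  induction n using Nat.strong_induction_on with
  | _ n ih =>
    cases n with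
    | zero =>
      rw [PowerSeries.coeff_zero_eq_constantCoeff_apply, H.1,
        PowerSeries.coeff_zero_eq_constantCoeff_apply, H'.1]
    | succ n =>
      have hn : (n : A) + 1 ≠ 0 := by exact_mod_cast Nat.succ_ne_zero n
      apply mul_left_cancel₀ hn
      rw [H.rec_formula, H'.rec_formula]
      refine Finset.sum_congr rfl fun i _ => ?_
      rw [ih (n - i) (by omega)]

theorem IsNewton.linear (x : A) :
    IsNewton (-PowerSeries.mk fun k => x ^ (k + 1)) (1 - PowerSeries.C x * PowerSeries.X) := by
  refine ⟨by simp, ?_⟩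
  have h1 : PowerSeries.derivative A (1 - PowerSeries.C x * PowerSeries.X) = -PowerSeries.C x := by
    rw [map_sub, PowerSeries.derivative_one, Derivation.leibniz, PowerSeries.derivative_X,
      PowerSeries.derivative_C]
    simp
  rw [h1]
  ext n
  cases n with
  | zero => simp [mul_comm]
  | succ n =>
    rw [neg_mul, mul_sub, mul_one, mul_left_comm, map_neg, map_neg, map_sub,
      PowerSeries.coeff_C_mul, PowerSeries.coeff_succ_mul_X, PowerSeries.coeff_mk,
      PowerSeries.coeff_mk, PowerSeries.coeff_C, if_neg (Nat.succ_ne_zero n)]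
    ring

theorem IsNewton.rescale {p h : PowerSeries A} (H : IsNewton p h) (x : A) :
    IsNewton (PowerSeries.C x * PowerSeries.rescale x p) (PowerSeries.rescale x h) := by
  refine ⟨?_, ?_⟩
  · rw [← PowerSeries.coeff_zero_eq_constantCoeff_apply, PowerSeries.coeff_rescale,
      PowerSeries.coeff_zero_eq_constantCoeff_apply, H.1, pow_zero, one_mul]
  · rw [mul_assoc, ← map_mul, ← H.2]
    ext n
    rw [PowerSeries.coeff_derivative, PowerSeries.coeff_C_mul, PowerSeries.coeff_rescale,
      PowerSeries.coeff_rescale, PowerSeries.coeff_derivative]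
    ring

/-- If the logarithmic derivatives differ as indicated, then
`(1 - x y) h(y) = (1 - x' y) h'(y)`. -/
theorem IsNewton.coeff_succ_eq [IsDomain A] [CharZero A] {p p' h h' : PowerSeries A} {x x' : A}
    (H : IsNewton p h) (H' : IsNewton p' h')
    (hp : ∀ k, PowerSeries.coeff k p - x ^ (k + 1) = PowerSeries.coeff k p' - x' ^ (k + 1))
    (r : ℕ) : PowerSeries.coeff (r + 1) h = x * PowerSeries.coeff r h +
      (PowerSeries.coeff (r + 1) h' - x' * PowerSeries.coeff r h') := by
  have H1 := (IsNewton.linear x).mul H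
  have H2 := (IsNewton.linear x').mul H'
  have hpp : -PowerSeries.mk (fun k => x ^ (k + 1)) + p =
      -PowerSeries.mk (fun k => x' ^ (k + 1)) + p' := by
    ext1 k
    simp only [map_add, map_neg, PowerSeries.coeff_mk]
    linear_combination hp k
  rw [hpp] at H1
  have := congrArg (PowerSeries.coeff (r + 1)) (IsNewton.unique H1 H2)
  simp only [sub_mul, one_mul, map_sub, mul_assoc, PowerSeries.coeff_C_mul,
    PowerSeries.coeff_succ_X_mul] at this
  linear_combination this

variable (K : Type*) [Field K] [Algebra K A]

/-- The coefficients of the power series with logarithmic derivative `p`. -/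
def newtonCoeff (p : PowerSeries A) : ℕ → A
  | 0 => 1
  | n + 1 => ((n : K) + 1)⁻¹ • ∑ i : Fin (n + 1), PowerSeries.coeff (n - i) p * newtonCoeff p i

/-- The power series with logarithmic derivative `p` and constant term `1`. -/
def newton (p : PowerSeries A) : PowerSeries A := PowerSeries.mk (newtonCoeff K p)

theorem isNewton_newton [CharZero K] (p : PowerSeries A) : IsNewton p (newton K p) := by
  refine ⟨by
    rw [← PowerSeries.coeff_zero_eq_constantCoeff_apply, newton, PowerSeries.coeff_mk,
      newtonCoeff], ?_⟩
  ext n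
  have hn : (n : K) + 1 ≠ 0 := by exact_mod_cast Nat.succ_ne_zero n
  rw [PowerSeries.coeff_derivative, newton, PowerSeries.coeff_mk, newtonCoeff,
    PowerSeries.coeff_mul, Finset.Nat.sum_antidiagonal_eq_sum_range_succ
      (fun i j => PowerSeries.coeff i p * PowerSeries.coeff j (PowerSeries.mk (newtonCoeff K p)))]
  have h1 : ((n : A) + 1) = algebraMap K A ((n : K) + 1) := by simp
  rw [h1, mul_comm, ← Algebra.smul_def, smul_smul, mul_inv_cancel₀ hn, one_smul,
    Finset.sum_fin_eq_sum_range, ← Finset.sum_range_reflect]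
  refine Finset.sum_congr rfl fun i hi => ?_
  have hi' := Finset.mem_range.1 hi
  rw [dif_pos (by omega), PowerSeries.coeff_mk]
  dsimp only
  rw [show n - (n + 1 - 1 - i) = i by omega, show n + 1 - 1 - i = n - i by omega]

end Newton

/-! ### The scalar products of power sums -/

section Form

variable {K : Type*} [Field K] {σ : Type*}

/-- The squared norm of the monomial with exponent `α`, for generators with squared norms `c`. -/
def monomialWeight (c : σ → K) (α : σ →₀ ℕ) : K := α.prod fun s k => (k.factorial : K) * c s ^ k

open MvPolynomial in
/-- The bilinear form on a polynomial ring for which the monomials are orthogonal and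
multiplication by the generator `s` is adjoint to `c s` times the partial derivative by `s`. -/
def polyForm (c : σ → K) : LinearMap.BilinForm K (MvPolynomial σ K) :=
  (basisMonomials σ K).constr K fun α => monomialWeight c α • lcoeff K α

open MvPolynomial

theorem polyForm_monomial (c : σ → K) (α : σ →₀ ℕ) (a : K) (f : MvPolynomial σ K) :
    polyForm c (monomial α a) f = a * monomialWeight c α * coeff α f := by
  have h1 : monomial α a = a • basisMonomials σ K α := by
    rw [coe_basisMonomials, smul_monomial, smul_eq_mul, mul_one]
  rw [h1, map_smul, polyForm, Module.Basis.constr_basis, LinearMap.smul_apply, LinearMap.smul_apply,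
    lcoeff_apply, smul_eq_mul, smul_eq_mul, mul_assoc]

theorem polyForm_symm (c : σ → K) (f h : MvPolynomial σ K) : polyForm c f h = polyForm c h f := by
  classical
  induction f using MvPolynomial.induction_on' with
  | add f g hf hg => rw [map_add, LinearMap.add_apply, hf, hg, map_add]
  | monomial α a =>
    induction h using MvPolynomial.induction_on' with
    | add f g hf hg => rw [map_add, hf, hg, map_add, LinearMap.add_apply]
    | monomial β b =>
      rw [polyForm_monomial, polyForm_monomial, coeff_monomial, coeff_monomial]
      by_cases h : α = β
      · subst h; simp; ring
      · rw [if_neg h, if_neg (Ne.symm h), mul_zero, mul_zero]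

theorem polyForm_one (c : σ → K) (f : MvPolynomial σ K) : polyForm c 1 f = coeff 0 f := by
  rw [← MvPolynomial.C_1, C_apply, polyForm_monomial, monomialWeight]
  simp

theorem monomialWeight_add_single (c : σ → K) (α : σ →₀ ℕ) (s : σ) :
    monomialWeight c (α + Finsupp.single s 1) =
      ((α s : K) + 1) * c s * monomialWeight c α := by
  classical
  have key : ∀ β : σ →₀ ℕ, monomialWeight c β =
      ((β s).factorial * c s ^ β s) * (β.erase s).prod fun s k => (k.factorial : K) * c s ^ k := by
    intro β
    rw [monomialWeight, Finsupp.mul_prod_erase' β s (fun s k => (k.factorial : K) * c s ^ k)]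
    intro i; simp
  rw [key, key α]
  have : (α + Finsupp.single s 1).erase s = α.erase s := by
    ext i
    by_cases h : i = s
    · simp [h]
    · simp [Finsupp.erase_ne h]
  rw [this, Finsupp.add_apply, Finsupp.single_eq_same, Nat.factorial_succ]
  push_cast
  ring

theorem polyForm_X_mul (c : σ → K) (s : σ) (f h : MvPolynomial σ K) :
    polyForm c (X s * f) h = c s * polyForm c f (pderiv s h) := by
  classical
  induction f using MvPolynomial.induction_on' with
  | add f g hf hg =>
    rw [mul_add, map_add, LinearMap.add_apply, hf, hg, map_add, LinearMap.add_apply, mul_add]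
  | monomial α a =>
    have h1 : X s * monomial α a = monomial (α + Finsupp.single s 1) a := by
      rw [X, monomial_mul, one_mul, add_comm]
    rw [h1, polyForm_monomial, polyForm_monomial, monomialWeight_add_single, coeff_pderiv]
    ring

theorem monomialWeight_ne_zero [CharZero K] {c : σ → K} (hc : ∀ s, c s ≠ 0) (α : σ →₀ ℕ) :
    monomialWeight c α ≠ 0 :=
  Finsupp.prod_ne_zero_iff.2 fun s _ =>
    mul_ne_zero (by exact_mod_cast Nat.factorial_ne_zero _) (pow_ne_zero _ (hc s))

theorem polyForm_nondegenerate [CharZero K] {c : σ → K} (hc : ∀ s, c s ≠ 0)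
    {f : MvPolynomial σ K} (h : ∀ g, polyForm c g f = 0) : f = 0 := by
  ext α
  have := h (monomial α 1)
  rw [polyForm_monomial, one_mul] at this
  rw [coeff_zero]
  exact (mul_eq_zero.1 this).resolve_left (monomialWeight_ne_zero hc α)

end Form

/-! ### Translations and their adjoints -/

section Translation

variable {K : Type*} [Field K]

open MvPolynomial

/-- The translation of the power sums `p_k ↦ p_k + a_k u^k`. The variable `X k` stands for
`p_{k+1}`. -/
def translate (a : ℕ → K) : MvPolynomial ℕ K →ₐ[K] Polynomial (MvPolynomial ℕ K) :=
  aeval fun k => Polynomial.C (X k) + Polynomial.C (C (a k)) * Polynomial.X ^ (k + 1)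

theorem translate_X (a : ℕ → K) (k : ℕ) : translate a (X k) =
    Polynomial.C (X k) + Polynomial.C (C (a k)) * Polynomial.X ^ (k + 1) := by
  rw [translate, aeval_X]

theorem translate_C (a : ℕ → K) (x : K) : translate a (C x) = Polynomial.C (C x) := by
  rw [translate, MvPolynomial.algHom_C]
  rfl

theorem coeff_zero_translate (a : ℕ → K) (f : MvPolynomial ℕ K) : (translate a f).coeff 0 = f := by
  have : ((Polynomial.aeval (0 : MvPolynomial ℕ K)).restrictScalars K).comp (translate a) =
      AlgHom.id K (MvPolynomial ℕ K) := by
    apply MvPolynomial.algHom_ext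
    intro k
    simp [translate_X]
  have h := DFunLike.congr_fun this f
  simp only [AlgHom.comp_apply, AlgHom.restrictScalars_apply, AlgHom.id_apply] at h
  rw [Polynomial.coeff_zero_eq_eval_zero]
  simpa [Polynomial.coe_aeval_eq_eval] using h

/-- The chain rule for the derivative of a translation in the direction of `u`. -/
theorem derivative_translate (a : ℕ → K) (f : MvPolynomial ℕ K) : ∃ N0 : ℕ, ∀ N ≥ N0,
    Polynomial.derivative (translate a f) = ∑ m ∈ Finset.range N,
      Polynomial.C (C (((m : K) + 1) * a m)) * Polynomial.X ^ m * translate a (pderiv m f) := by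
  induction f using MvPolynomial.induction_on with
  | C x => exact ⟨0, fun N _ => by simp [Polynomial.derivative_C]⟩
  | add f g hf hg =>
    obtain ⟨N, hN⟩ := hf
    obtain ⟨M, hM⟩ := hg
    refine ⟨max N M, fun L hL => ?_⟩
    rw [map_add, map_add, hN L (le_of_max_le_left hL), hM L (le_of_max_le_right hL),
      ← Finset.sum_add_distrib]
    refine Finset.sum_congr rfl fun m _ => ?_
    rw [map_add, map_add, mul_add]
  | mul_X f k hf =>
    obtain ⟨N, hN⟩ := hf
    refine ⟨max N (k + 1), fun L hL => ?_⟩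
    have hk : k ∈ Finset.range L := Finset.mem_range.2 (le_of_max_le_right hL)
    have h1 : ∀ m : ℕ, Polynomial.C (C (((m : K) + 1) * a m)) * Polynomial.X ^ m *
        translate a (pderiv m (f * X k)) = (Polynomial.C (C (((m : K) + 1) * a m)) *
          Polynomial.X ^ m * translate a (pderiv m f)) * translate a (X k) +
          if m = k then Polynomial.C (C (((m : K) + 1) * a m)) *
            Polynomial.X ^ m * translate a f else 0 := by
      intro m
      rw [pderiv_mul, map_add, map_mul, map_mul, pderiv_X]
      by_cases h : m = k
      · subst h; simp; ring
      · rw [if_neg h, Pi.single_eq_of_ne (Ne.symm h)]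
        simp; ring
    rw [Finset.sum_congr rfl fun m _ => h1 m, Finset.sum_add_distrib, ← Finset.sum_mul,
      Finset.sum_ite_eq' , if_pos hk, ← hN L (le_of_max_le_left hL), map_mul,
      Polynomial.derivative_mul, translate_X]
    simp
    ring

theorem coeff_succ_translate (a : ℕ → K) (f : MvPolynomial ℕ K) (r : ℕ) :
    ((r : K) + 1) • (translate a f).coeff (r + 1) = ∑ m ∈ Finset.range (r + 1),
      (((m : K) + 1) * a m) • (translate a (pderiv m f)).coeff (r - m) := by
  obtain ⟨N0, hN⟩ := derivative_translate a f
  have h := congrArg (fun F => F.coeff r) (hN (max N0 (r + 1)) (le_max_left _ _))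
  simp only [Polynomial.coeff_derivative, Polynomial.finsetSum_coeff] at h
  have h1 : ((r : K) + 1) • (translate a f).coeff (r + 1) =
      (translate a f).coeff (r + 1) * ((r : MvPolynomial ℕ K) + 1) := by
    rw [MvPolynomial.smul_eq_C_mul, mul_comm]
    simp
  rw [h1, h]
  have hsub : Finset.range (r + 1) ⊆ Finset.range (max N0 (r + 1)) :=
    Finset.range_subset_range.2 (le_max_right _ _)
  rw [← Finset.sum_subset hsub]
  · refine Finset.sum_congr rfl fun m hm => ?_
    have hm' := Finset.mem_range.1 hm
    rw [mul_assoc, Polynomial.coeff_C_mul, Polynomial.coeff_X_pow_mul', if_pos (by omega),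
      MvPolynomial.smul_eq_C_mul]
  · intro m _ hm
    have hm' : ¬ m < r + 1 := fun h => hm (Finset.mem_range.2 h)
    rw [mul_assoc, Polynomial.coeff_C_mul, Polynomial.coeff_X_pow_mul', if_neg (by omega), mul_zero]

/-- The power series `∑_k e_k p_k y^{k-1}`. -/
def linSeries (e : ℕ → K) : PowerSeries (MvPolynomial ℕ K) := PowerSeries.mk fun k => C (e k) * X k

/-- Multiplication by the coefficient of `y^r` in `exp (∑_k e_k p_k y^k / k)` is adjoint to taking
the coefficient of `u^r` in a translation. -/
theorem polyForm_newton_mul [CharZero K] {c e a : ℕ → K}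
    (hec : ∀ k, e k * c k = ((k : K) + 1) * a k)
    {h : PowerSeries (MvPolynomial ℕ K)} (H : IsNewton (linSeries e) h) (r : ℕ)
    (f f' : MvPolynomial ℕ K) :
    polyForm c (PowerSeries.coeff r h * f) f' = polyForm c f ((translate a f').coeff r) := by
  induction r using Nat.strong_induction_on generalizing f f' with
  | _ r ih =>
    cases r with
    | zero =>
      rw [PowerSeries.coeff_zero_eq_constantCoeff_apply, H.1, one_mul, coeff_zero_translate]
    | succ r =>
      have hr : (r : K) + 1 ≠ 0 := by exact_mod_cast Nat.succ_ne_zero r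
      apply mul_left_cancel₀ hr
      have h0 : ((r : K) + 1) * polyForm c (PowerSeries.coeff (r + 1) h * f) f' =
          polyForm c (((r : K) + 1) • (PowerSeries.coeff (r + 1) h * f)) f' := by
        rw [map_smul, LinearMap.smul_apply, smul_eq_mul]
      have h2 : ((r : K) + 1) * polyForm c f ((translate a f').coeff (r + 1)) =
          polyForm c f (((r : K) + 1) • (translate a f').coeff (r + 1)) := by
        rw [map_smul, smul_eq_mul]
      rw [h0, h2, coeff_succ_translate]
      have h1 : ((r : K) + 1) • (PowerSeries.coeff (r + 1) h * f) =
          ∑ m ∈ Finset.range (r + 1), e m • (X m * (PowerSeries.coeff (r - m) h * f)) := by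
        have := H.rec_formula r
        rw [← smul_mul_assoc, MvPolynomial.smul_eq_C_mul]
        simp only [map_add, map_natCast, map_one]
        rw [this, Finset.sum_mul]
        refine Finset.sum_congr rfl fun m _ => ?_
        rw [linSeries, PowerSeries.coeff_mk, MvPolynomial.smul_eq_C_mul]
        ring
      rw [h1, map_sum, LinearMap.sum_apply, map_sum]
      refine Finset.sum_congr rfl fun m hm => ?_
      rw [map_smul, LinearMap.smul_apply, polyForm_X_mul, ih (r - m) (by omega), map_smul,
        smul_eq_mul, smul_eq_mul, ← mul_assoc, hec]

end Translation

/-! ### The Macdonald operator -/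

section Operator

open MvPolynomial

variable {K : Type*} [Field K]

/-- The squared norm of `p_{k+1}` for the scalar product of Macdonald with parameters `q`, `t`,
rescaled by `s` to the degree. -/
def macNorm (q t s : K) (k : ℕ) : K :=
  ((k : K) + 1) * s ^ (k + 1) * (1 - q ^ (k + 1)) / (1 - t ^ (k + 1))

/-- `g_r`, the coefficient of `y^r` in `exp (∑_k p_k y^k / ‖p_k‖²)`. -/
def gFun (q t s : K) (r : ℕ) : MvPolynomial ℕ K :=
  PowerSeries.coeff r
    (newton K (linSeries fun k => (1 - t ^ (k + 1)) / (s ^ (k + 1) * (1 - q ^ (k + 1)))))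

/-- The coefficient of `y^r` in `g(qy) / g(y)`. -/
def gammaFun (t s : K) (r : ℕ) : MvPolynomial ℕ K :=
  PowerSeries.coeff r (newton K (linSeries fun k => -(1 - t ^ (k + 1)) / s ^ (k + 1)))

/-- The linear map over the ring of symmetric functions with
`u^k ↦ (s/t)^k γ_{N+k}`. -/
def gammaEval (t s : K) (N : ℕ) : Polynomial (MvPolynomial ℕ K) →ₗ[MvPolynomial ℕ K]
    MvPolynomial ℕ K :=
  Polynomial.lsum fun k => LinearMap.mulLeft _ (C ((s / t) ^ k) * gammaFun t s (N + k))

/-- Macdonald's operator, in infinitely many variables: `∑_k (s/t)^k γ_k γ_k^⊥`, where `γ_k^⊥`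
is the adjoint of the multiplication by `γ_k`, i.e. the coefficient of `u^k` in the translation
`p_k ↦ p_k + (q^k - 1) u^k`. -/
def macOp (q t s : K) : MvPolynomial ℕ K →ₗ[K] MvPolynomial ℕ K :=
  ((gammaEval t s 0).restrictScalars K).comp (translate fun k => q ^ (k + 1) - 1).toLinearMap

theorem gammaEval_monomial (t s : K) (N k : ℕ) (a : MvPolynomial ℕ K) :
    gammaEval t s N (Polynomial.monomial k a) = C ((s / t) ^ k) * gammaFun t s (N + k) * a := by
  rw [gammaEval, Polynomial.lsum_apply, Polynomial.sum_monomial_index]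
  · rfl
  · exact map_zero _

theorem gammaEval_eq_sum (t s : K) (N : ℕ) (F : Polynomial (MvPolynomial ℕ K)) {M : ℕ}
    (hM : F.natDegree < M) : gammaEval t s N F =
      ∑ k ∈ Finset.range M, C ((s / t) ^ k) * gammaFun t s (N + k) * F.coeff k := by
  rw [gammaEval, Polynomial.lsum_apply, Polynomial.sum_over_range' _ _ _ hM]
  · rfl
  · intro k; exact map_zero _

theorem gammaEval_X_pow_mul (t s : K) (N k : ℕ) (F : Polynomial (MvPolynomial ℕ K)) :
    gammaEval t s N (Polynomial.X ^ k * F) = C ((s / t) ^ k) * gammaEval t s (N + k) F := by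
  induction F using Polynomial.induction_on' with
  | add F G hF hG => rw [mul_add, map_add, hF, hG, map_add, mul_add]
  | monomial j a =>
    rw [Polynomial.X_pow_mul_monomial, gammaEval_monomial, gammaEval_monomial, pow_add, C_mul,
      add_comm j k, add_assoc]
    ring

variable [CharZero K]

theorem gFun_zero (q t s : K) : gFun q t s 0 = 1 := by
  rw [gFun, PowerSeries.coeff_zero_eq_constantCoeff_apply]
  exact (isNewton_newton K _).1

theorem polyForm_gammaFun_mul {q t s : K} (hs : s ≠ 0) (ht : ∀ k, t ^ (k + 1) ≠ 1) (r : ℕ)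
    (f f' : MvPolynomial ℕ K) : polyForm (macNorm q t s) (gammaFun t s r * f) f' =
      polyForm (macNorm q t s) f ((translate (fun k => q ^ (k + 1) - 1) f').coeff r) := by
  refine polyForm_newton_mul (fun k => ?_) (isNewton_newton K _) r f f'
  have h1 : 1 - t ^ (k + 1) ≠ 0 := sub_ne_zero.2 (ht k).symm
  rw [macNorm]
  field_simp
  ring

theorem polyForm_gFun_mul {q t s : K} (hs : s ≠ 0) (hq : ∀ k, q ^ (k + 1) ≠ 1)
    (ht : ∀ k, t ^ (k + 1) ≠ 1) (r : ℕ) (f f' : MvPolynomial ℕ K) :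
    polyForm (macNorm q t s) (gFun q t s r * f) f' =
      polyForm (macNorm q t s) f ((translate (fun _ => 1) f').coeff r) := by
  refine polyForm_newton_mul (fun k => ?_) (isNewton_newton K _) r f f'
  have h1 : 1 - t ^ (k + 1) ≠ 0 := sub_ne_zero.2 (ht k).symm
  have h2 : 1 - q ^ (k + 1) ≠ 0 := sub_ne_zero.2 (hq k).symm
  rw [macNorm]
  field_simp

/-- Both sides are `∑_k (s/t)^k ⟨γ_k^⊥ f, γ_k^⊥ f'⟩`. -/
theorem macOp_selfAdjoint {q t s : K} (hs : s ≠ 0) (ht : ∀ k, t ^ (k + 1) ≠ 1)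
    (f f' : MvPolynomial ℕ K) : polyForm (macNorm q t s) (macOp q t s f) f' =
      polyForm (macNorm q t s) f (macOp q t s f') := by
  set T := translate fun k => q ^ (k + 1) - 1 with hT
  -- both sides are the same sum over the coefficients of the two translates
  have key : ∀ (f f' : MvPolynomial ℕ K) (M : ℕ), (T f).natDegree < M →
      polyForm (macNorm q t s) (macOp q t s f) f' = ∑ k ∈ Finset.range M, (s / t) ^ k *
        polyForm (macNorm q t s) ((T f).coeff k) ((T f').coeff k) := by
    intro f f' M hM
    have h1 : macOp q t s f = gammaEval t s 0 (T f) := rfl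
    rw [h1, gammaEval_eq_sum t s 0 _ hM, map_sum, LinearMap.sum_apply]
    refine Finset.sum_congr rfl fun k _ => ?_
    rw [mul_assoc, ← MvPolynomial.smul_eq_C_mul, map_smul, LinearMap.smul_apply, zero_add,
      polyForm_gammaFun_mul hs ht, smul_eq_mul]
  have hM1 : (T f).natDegree < max (T f).natDegree (T f').natDegree + 1 :=
    Nat.lt_succ_of_le (le_max_left _ _)
  have hM2 : (T f').natDegree < max (T f).natDegree (T f').natDegree + 1 :=
    Nat.lt_succ_of_le (le_max_right _ _)
  rw [polyForm_symm _ f, key f f' _ hM1, key f' f _ hM2]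
  refine Finset.sum_congr rfl fun k _ => ?_
  rw [polyForm_symm]

/-- The coefficients of `(1 - x) / (1 - t x)`. -/
def ratioCoeff (t : K) (k : ℕ) : K := if k = 0 then 1 else t ^ k - t ^ (k - 1)

/-- A translation multiplies the generating function of the `g_r` by `(1 - uy/s) / (1 - tuy/s)`. -/
theorem translate_gFun_succ {q t s : K} (hs : s ≠ 0) (hq : ∀ k, q ^ (k + 1) ≠ 1) (r : ℕ) :
    translate (fun k => q ^ (k + 1) - 1) (gFun q t s (r + 1)) =
      Polynomial.C (C (t / s)) * Polynomial.X *
        translate (fun k => q ^ (k + 1) - 1) (gFun q t s r) +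
      (Polynomial.C (gFun q t s (r + 1)) -
        Polynomial.C (C (1 / s)) * Polynomial.X * Polynomial.C (gFun q t s r)) := by
  set T := translate fun k => q ^ (k + 1) - 1 with hT
  set e : ℕ → K := fun k => (1 - t ^ (k + 1)) / (s ^ (k + 1) * (1 - q ^ (k + 1))) with he
  have H := isNewton_newton K (linSeries e)
  have hg : ∀ r, PowerSeries.coeff r (newton K (linSeries e)) = gFun q t s r := fun _ => rfl
  have hTX : ∀ k, (T : MvPolynomial ℕ K →+* Polynomial (MvPolynomial ℕ K)) (X k) =
    Polynomial.C (X k) + Polynomial.C (C (q ^ (k + 1) - 1)) * Polynomial.X ^ (k + 1) :=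
      translate_X _
  have hTC : ∀ k, (T : MvPolynomial ℕ K →+* Polynomial (MvPolynomial ℕ K)) (C (e k)) =
    Polynomial.C (C (e k)) := fun _ => translate_C _ _
  have h := IsNewton.coeff_succ_eq (x := Polynomial.C (C (t / s)) * Polynomial.X)
    (x' := Polynomial.C (C (1 / s)) * Polynomial.X)
    (H.map (T : MvPolynomial ℕ K →+* Polynomial (MvPolynomial ℕ K)))
    (H.map (Polynomial.C : MvPolynomial ℕ K →+* Polynomial (MvPolynomial ℕ K))) (fun k => by
      rw [PowerSeries.coeff_map, PowerSeries.coeff_map, linSeries, PowerSeries.coeff_mk, map_mul,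
        hTX, hTC]
      have h3 : e k * (q ^ (k + 1) - 1) = (t / s) ^ (k + 1) - (1 / s) ^ (k + 1) := by
        have h2 : 1 - q ^ (k + 1) ≠ 0 := sub_ne_zero.2 (hq k).symm
        rw [he, div_pow, div_pow]
        field_simp
        ring
      have h4 := congrArg (fun x => Polynomial.C (C x) * (Polynomial.X : Polynomial
        (MvPolynomial ℕ K)) ^ (k + 1)) h3
      simp only [map_mul, map_sub, map_pow, map_one, mul_pow] at h4 ⊢
      linear_combination h4) r
  rw [PowerSeries.coeff_map, PowerSeries.coeff_map, PowerSeries.coeff_map, PowerSeries.coeff_map,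
    hg, hg] at h
  exact h

theorem translate_gFun {q t s : K} (hs : s ≠ 0) (hq : ∀ k, q ^ (k + 1) ≠ 1) (r : ℕ) :
    translate (fun k => q ^ (k + 1) - 1) (gFun q t s r) = ∑ k ∈ Finset.range (r + 1),
      Polynomial.C (C (ratioCoeff t k / s ^ k) * gFun q t s (r - k)) * Polynomial.X ^ k := by
  induction r with
  | zero => simp [gFun_zero, ratioCoeff]
  | succ r ih =>
    rw [translate_gFun_succ hs hq, ih, Finset.sum_range_succ' _ (r + 1), Finset.sum_range_succ' _ r,
      Finset.sum_range_succ' _ r]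
    have h : ∀ k, ratioCoeff t (k + 1 + 1) / s ^ (k + 1 + 1) =
        t / s * (ratioCoeff t (k + 1) / s ^ (k + 1)) := by
      intro k
      simp only [ratioCoeff, Nat.succ_ne_zero, if_false, Nat.add_sub_cancel]
      rw [div_mul_div_comm]
      congr 1 <;> ring
    have h1 : ratioCoeff t (0 + 1) / s ^ (0 + 1) = t / s - 1 / s := by
      simp [ratioCoeff, sub_div]
    have h0 : ratioCoeff t 0 = 1 := by simp [ratioCoeff]
    simp only [h, h1, h0, Nat.add_sub_add_right, mul_add, Finset.mul_sum, map_mul, map_sub,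
      Nat.sub_zero, pow_zero, div_one, map_one, zero_add, Nat.add_sub_cancel, one_mul, mul_one]
    have h5 : ∀ k ∈ Finset.range r, (Polynomial.C (C (t / s)) * Polynomial.X *
        (Polynomial.C (C (ratioCoeff t (k + 1) / s ^ (k + 1))) *
          Polynomial.C (gFun q t s (r - (k + 1))) * Polynomial.X ^ (k + 1)) :
          Polynomial (MvPolynomial ℕ K)) = Polynomial.C (C (t / s)) *
        Polynomial.C (C (ratioCoeff t (k + 1) / s ^ (k + 1))) *
          Polynomial.C (gFun q t s (r - (k + 1))) * Polynomial.X ^ (k + 1 + 1) := by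
      intro k _
      ring
    rw [Finset.sum_congr rfl h5]
    ring

/-- `∑_k γ_k g_{x-k} = q^x g_x`, since `γ(y) g(y) = g(qy)`. -/
theorem sum_gammaFun_mul_gFun {q t s : K} (hq : ∀ k, q ^ (k + 1) ≠ 1) (x : ℕ) :
    ∑ k ∈ Finset.range (x + 1), gammaFun t s k * gFun q t s (x - k) =
      C (q ^ x) * gFun q t s x := by
  set e : ℕ → K := fun k => (1 - t ^ (k + 1)) / (s ^ (k + 1) * (1 - q ^ (k + 1))) with he
  have H1 := (isNewton_newton K (linSeries fun k => -(1 - t ^ (k + 1)) / s ^ (k + 1))).mul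
    (isNewton_newton K (linSeries e))
  have H2 := (isNewton_newton K (linSeries e)).rescale (C q)
  have hp : (linSeries fun k => -(1 - t ^ (k + 1)) / s ^ (k + 1)) + linSeries e =
      PowerSeries.C (C q) * PowerSeries.rescale (C q) (linSeries e) := by
    ext1 k
    rw [map_add, PowerSeries.coeff_C_mul, PowerSeries.coeff_rescale]
    simp only [linSeries, PowerSeries.coeff_mk]
    have h3 : -(1 - t ^ (k + 1)) / s ^ (k + 1) + e k = q * q ^ k * e k := by
      have h2 : 1 - q ^ (k + 1) ≠ 0 := sub_ne_zero.2 (hq k).symm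
      simp only [he]
      rw [← pow_succ', ← div_div]
      field_simp
      ring
    have h4 := congrArg (fun x => C x * (X k : MvPolynomial ℕ K)) h3
    simp only [map_mul, map_add, map_pow] at h4
    linear_combination h4
  have h := congrArg (PowerSeries.coeff x) (IsNewton.unique H1 (hp ▸ H2))
  rw [PowerSeries.coeff_mul, PowerSeries.coeff_rescale,
    Finset.Nat.sum_antidiagonal_eq_sum_range_succ (fun i j => PowerSeries.coeff i
      (newton K (linSeries fun k => -(1 - t ^ (k + 1)) / s ^ (k + 1))) *
        PowerSeries.coeff j (newton K (linSeries e)))] at h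
  rw [map_pow]
  exact h

end Operator

/-! ### Triangularity of the Macdonald operator -/

section Raising

open MvPolynomial

variable {K : Type*} [Field K]

/-- `g_{l₁} g_{l₂} ⋯`. -/
def gList (q t s : K) (l : List ℕ) : MvPolynomial ℕ K := (l.map (gFun q t s)).prod

/-- `∑_k γ_{N+k} g_{x-k}`, as a function of `N`. -/
def gammaConv (q t s : K) (x : ℕ) : ℕ → MvPolynomial ℕ K := fun N =>
  ∑ k ∈ Finset.range (x + 1), gammaFun t s (N + k) * gFun q t s (x - k)

/-- The coefficients of `(1 - x/t) / (1 - x)`. -/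
def poleCoeff (t : K) (k : ℕ) : K := if k = 0 then 1 else 1 - 1 / t

/-- The operator that passes from the sequence `N ↦ gammaEval N (F)` to the sequence
`N ↦ gammaEval N (translate g_r * F)`. -/
def appendOp (q t s : K) (r : ℕ) : (ℕ → MvPolynomial ℕ K) →ₗ[MvPolynomial ℕ K]
    (ℕ → MvPolynomial ℕ K) where
  toFun F N := ∑ k ∈ Finset.range (r + 1), C (poleCoeff t k) * gFun q t s (r - k) * F (N + k)
  map_add' F G := by
    funext N
    simp only [Pi.add_apply, mul_add, Finset.sum_add_distrib]
  map_smul' a F := by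
    funext N
    simp only [Pi.smul_apply, smul_eq_mul, RingHom.id_apply, Finset.mul_sum]
    exact Finset.sum_congr rfl fun k _ => by ring

theorem appendOp_apply (q t s : K) (r : ℕ) (F : ℕ → MvPolynomial ℕ K) (N : ℕ) :
    appendOp q t s r F N =
      ∑ k ∈ Finset.range (r + 1), C (poleCoeff t k) * gFun q t s (r - k) * F (N + k) := rfl

/-- `N ↦ gammaEval N (∏_{r ∈ l} translate g_r)`. Its value at `0` is `macOp (g_l)`. -/
def opSeq (q t s : K) (l : List ℕ) : ℕ → MvPolynomial ℕ K := fun N =>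
  gammaEval t s N (translate (fun k => q ^ (k + 1) - 1) (gList q t s l))

theorem gList_cons (q t s : K) (r : ℕ) (l : List ℕ) :
    gList q t s (r :: l) = gFun q t s r * gList q t s l := by
  simp [gList]

theorem gList_append_cons (q t s : K) (x : ℕ) (l1 l2 : List ℕ) :
    gList q t s (l1 ++ x :: l2) = gFun q t s x * gList q t s (l1 ++ l2) := by
  simp [gList]
  ring

theorem appendOp_split (q t s : K) (r : ℕ) (F : ℕ → MvPolynomial ℕ K) (N : ℕ) :
    appendOp q t s r F N = gFun q t s r * F N + C (1 - 1 / t) *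
      ∑ k ∈ Finset.range r, gFun q t s (r - (k + 1)) * F (N + (k + 1)) := by
  rw [appendOp_apply, Finset.sum_range_succ', Finset.mul_sum, add_comm]
  congr 1
  · simp [poleCoeff]
  · refine Finset.sum_congr rfl fun k _ => ?_
    rw [poleCoeff, if_neg (Nat.succ_ne_zero k), mul_assoc]

variable {q t s : K}

/-- Multiplication by `g_r` under the Macdonald operator amounts to applying `appendOp`: the extra
generating function `(1 - uy/s) / (1 - tuy/s)` produced by the translation of `g_r` shifts `N`. -/
theorem opSeq_cons [CharZero K] (hs : s ≠ 0) (ht0 : t ≠ 0) (hq : ∀ k, q ^ (k + 1) ≠ 1)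
    (r : ℕ) (l : List ℕ) :
    opSeq q t s (r :: l) = appendOp q t s r (opSeq q t s l) := by
  funext N
  rw [opSeq, gList_cons, map_mul, translate_gFun hs hq, Finset.sum_mul, map_sum, appendOp_apply]
  refine Finset.sum_congr rfl fun k _ => ?_
  rw [mul_assoc, ← Polynomial.smul_eq_C_mul, map_smul, gammaEval_X_pow_mul, smul_eq_mul]
  have h : poleCoeff t k = ratioCoeff t k / s ^ k * (s / t) ^ k := by
    rw [poleCoeff, ratioCoeff]
    split_ifs with h
    · simp [h]
    · obtain ⟨k, rfl⟩ := Nat.exists_eq_succ_of_ne_zero h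
      rw [Nat.succ_sub_one, Nat.succ_eq_add_one, div_pow]
      field_simp
      ring
  rw [h, C_mul]
  simp only [opSeq]
  ring

theorem appendOp_gammaFun (r : ℕ) (N : ℕ) :
    appendOp q t s r (gammaFun t s) N =
      C (1 / t) * gammaFun t s N * gFun q t s r + C (1 - 1 / t) * gammaConv q t s r N := by
  rw [appendOp_split, gammaConv, Finset.sum_range_succ' _ r]
  have h : ∀ k ∈ Finset.range r, gFun q t s (r - (k + 1)) * gammaFun t s (N + (k + 1)) =
    gammaFun t s (N + (k + 1)) * gFun q t s (r - (k + 1)) := fun k _ => mul_comm _ _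
  rw [Finset.sum_congr rfl h, mul_add, map_sub, map_one]
  simp only [Nat.sub_zero, add_zero]
  ring

/-- The partial fraction decomposition of a product of two simple poles, one of them expanded
in the direction of raising operators. -/
theorem sum_gFun_mul_gammaConv (r x N : ℕ) :
    ∑ k ∈ Finset.range r, gFun q t s (r - (k + 1)) * gammaConv q t s x (N + (k + 1)) =
      ∑ p ∈ Finset.range r, (gammaConv q t s (x + (p + 1)) N * gFun q t s (r - (p + 1)) -
        gFun q t s (x + (p + 1)) * gammaConv q t s (r - (p + 1)) N) := by
  have h1 : ∀ p, gammaConv q t s (x + (p + 1)) N = ∑ k ∈ Finset.range (p + 1),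
      gammaFun t s (N + k) * gFun q t s (x + (p + 1) - k) +
        gammaConv q t s x (N + (p + 1)) := by
    intro p
    rw [gammaConv, show x + (p + 1) + 1 = (p + 1) + (x + 1) by omega, Finset.sum_range_add]
    congr 1
    refine Finset.sum_congr rfl fun k _ => ?_
    rw [show N + (p + 1 + k) = N + (p + 1) + k by omega,
      show x + (p + 1) - (p + 1 + k) = x - k by omega]
  have h2 : ∑ p ∈ Finset.range r, (∑ k ∈ Finset.range (p + 1),
      gammaFun t s (N + k) * gFun q t s (x + (p + 1) - k)) * gFun q t s (r - (p + 1)) =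
      ∑ p ∈ Finset.range r, gFun q t s (x + (p + 1)) * gammaConv q t s (r - (p + 1)) N := by
    simp only [gammaConv, Finset.sum_mul, Finset.mul_sum]
    rw [Finset.sum_sigma', Finset.sum_sigma']
    refine Finset.sum_bij' (fun a _ => ⟨a.1 - a.2, a.2⟩) (fun a _ => ⟨a.1 + a.2, a.2⟩)
      ?_ ?_ ?_ ?_ ?_
    · rintro ⟨p, k⟩ h
      simp only [Finset.mem_sigma, Finset.mem_range] at h ⊢
      omega
    · rintro ⟨p, k⟩ h
      simp only [Finset.mem_sigma, Finset.mem_range] at h ⊢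
      omega
    · rintro ⟨p, k⟩ h
      simp only [Finset.mem_sigma, Finset.mem_range] at h
      simp only [Sigma.mk.injEq, heq_eq_eq, and_true]
      omega
    · rintro ⟨p, k⟩ h
      simp
    · rintro ⟨p, k⟩ h
      simp only [Finset.mem_sigma, Finset.mem_range] at h
      dsimp only
      rw [show x + (p - k + 1) = x + (p + 1) - k by omega,
        show r - (p - k + 1) - k = r - (p + 1) by omega]
      ring
  rw [Finset.sum_sub_distrib, ← h2, ← Finset.sum_sub_distrib]
  refine Finset.sum_congr rfl fun p _ => ?_
  rw [h1]
  ring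

/-- The sequences `γ`-convolved at one entry `x` of `ν`, where `ν` runs over the nontrivial
raisings of `l`. -/
def raisedSeqs (q t s : K) (l : List ℕ) : Set (ℕ → MvPolynomial ℕ K) :=
  {F | ∃ l1 x l2, Raise l (l1 ++ x :: l2) ∧ l1 ++ x :: l2 ≠ l ∧
    F = gList q t s (l1 ++ l2) • gammaConv q t s x}

/-- The diagonal part of `opSeq l`. -/
def diagSeq (q t s : K) : List ℕ → ℕ → MvPolynomial ℕ K
  | [] => 0
  | r :: l => gFun q t s r • diagSeq q t s l +
      (C ((1 - 1 / t) * (1 / t) ^ l.length) * gList q t s l) • gammaConv q t s r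

theorem diagSeq_mem (l : List ℕ) : diagSeq q t s l ∈ Submodule.span K
    {F | ∃ l1 x l2, l1 ++ x :: l2 = l ∧ F = gList q t s (l1 ++ l2) • gammaConv q t s x} := by
  induction l with
  | nil => exact zero_mem _
  | cons r l ih =>
    rw [diagSeq]
    refine add_mem ?_ ?_
    · generalize diagSeq q t s l = D at ih
      induction ih using Submodule.span_induction with
      | mem F hF =>
        obtain ⟨l1, x, l2, rfl, rfl⟩ := hF
        refine Submodule.subset_span ⟨r :: l1, x, l2, rfl, ?_⟩
        rw [List.cons_append, gList_cons, mul_smul]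
      | zero => rw [smul_zero]; exact zero_mem _
      | add F G _ _ h1 h2 => rw [smul_add]; exact add_mem h1 h2
      | smul a F _ h => rw [smul_comm]; exact Submodule.smul_mem _ _ h
    · rw [mul_smul, ← MvPolynomial.algebraMap_eq, algebraMap_smul]
      exact Submodule.smul_mem _ _ (Submodule.subset_span ⟨[], r, l, rfl, rfl⟩)

/-- The off-diagonal part of `appendOp` on a convolved sequence: moving `p` from the new smallest
entry `r` to the entry `x`, or making `r - p` the convolved entry, are both raisings. -/
theorem appendOp_gammaConv_sub_mem {l l1 l2 : List ℕ} {x : ℕ} (h : Raise l (l1 ++ x :: l2))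
    (r : ℕ) : appendOp q t s r (gList q t s (l1 ++ l2) • gammaConv q t s x) -
      gFun q t s r • (gList q t s (l1 ++ l2) • gammaConv q t s x) ∈
        Submodule.span K (raisedSeqs q t s (r :: l)) := by
  have h1 : appendOp q t s r (gList q t s (l1 ++ l2) • gammaConv q t s x) -
      gFun q t s r • (gList q t s (l1 ++ l2) • gammaConv q t s x) =
      (1 - 1 / t) • ∑ p ∈ Finset.range r,
        (gList q t s (((r - (p + 1)) :: l1) ++ l2) • gammaConv q t s (x + (p + 1)) -
          gList q t s ([] ++ (l1 ++ (x + (p + 1)) :: l2)) • gammaConv q t s (r - (p + 1))) := by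
    funext N
    rw [map_smul, Pi.sub_apply, Pi.smul_apply, appendOp_split, sum_gFun_mul_gammaConv]
    simp only [Pi.smul_apply, Finset.sum_apply, Pi.sub_apply, smul_eq_mul, List.cons_append,
      List.nil_append, gList_cons, gList_append_cons, MvPolynomial.smul_eq_C_mul]
    rw [mul_add, Finset.mul_sum, Finset.mul_sum, Finset.mul_sum]
    have h2 : ∀ a b c : MvPolynomial ℕ K, a + b - c = (a - c) + b := fun a b c => by ring
    rw [h2]
    have h3 : gList q t s (l1 ++ l2) * (gFun q t s r * gammaConv q t s x N) -
      gFun q t s r * (gList q t s (l1 ++ l2) * gammaConv q t s x N) = 0 := by ring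
    rw [h3, zero_add]
    exact Finset.sum_congr rfl fun p _ => by ring
  rw [h1]
  refine Submodule.smul_mem _ _ (Submodule.sum_mem _ fun p hp => ?_)
  have hp' : p + 1 ≤ r := Finset.mem_range.1 hp
  have hR := h.cons_move hp'
  refine sub_mem (Submodule.subset_span ⟨(r - (p + 1)) :: l1, x + (p + 1), l2, hR, ?_, rfl⟩)
    (Submodule.subset_span ⟨[], r - (p + 1), l1 ++ (x + (p + 1)) :: l2, hR, ?_, rfl⟩)
  · intro heq
    simp only [List.cons_append, List.cons.injEq] at heq
    omega
  · intro heq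
    simp only [List.nil_append, List.cons.injEq] at heq
    omega

/-- Modulo strict raisings of `l`, the sequence `opSeq l` is a multiple of `γ` plus the diagonal
part; by induction on `l`, the entries being appended from the largest to the smallest. -/
theorem opSeq_sub_mem [CharZero K] (hs : s ≠ 0) (ht0 : t ≠ 0) (hq : ∀ k, q ^ (k + 1) ≠ 1)
    (l : List ℕ) :
    opSeq q t s l - ((C ((1 / t) ^ l.length) * gList q t s l) • gammaFun t s + diagSeq q t s l) ∈
      Submodule.span K (raisedSeqs q t s l) := by
  induction l with
  | nil =>
    have : opSeq q t s [] - ((C ((1 / t) ^ ([] : List ℕ).length) * gList q t s []) •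
        gammaFun t s + diagSeq q t s []) = 0 := by
      funext N
      have h1 : (1 : Polynomial (MvPolynomial ℕ K)) = Polynomial.monomial 0 1 := rfl
      simp [opSeq, gList, diagSeq]
      rw [h1, gammaEval_monomial]
      simp
    rw [this]
    exact zero_mem _
  | cons r l ih =>
    set Z := opSeq q t s l - ((C ((1 / t) ^ l.length) * gList q t s l) • gammaFun t s +
      diagSeq q t s l) with hZ
    have hop : opSeq q t s l = (C ((1 / t) ^ l.length) * gList q t s l) • gammaFun t s +
      diagSeq q t s l + Z := by rw [hZ]; abel
    have h1 : opSeq q t s (r :: l) - ((C ((1 / t) ^ (r :: l).length) * gList q t s (r :: l)) •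
        gammaFun t s + diagSeq q t s (r :: l)) =
        (appendOp q t s r (diagSeq q t s l) - gFun q t s r • diagSeq q t s l) +
          appendOp q t s r Z := by
      rw [opSeq_cons hs ht0 hq, hop, map_add, map_add, map_smul, diagSeq]
      funext N
      simp only [Pi.add_apply, Pi.sub_apply, Pi.smul_apply, smul_eq_mul, appendOp_gammaFun,
        gList_cons, List.length_cons, pow_succ, C_mul]
      ring
    rw [h1]
    refine add_mem ?_ ?_
    · have hd := diagSeq_mem (q := q) (t := t) (s := s) l
      generalize diagSeq q t s l = D at hd
      induction hd using Submodule.span_induction with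
      | mem F hF =>
        obtain ⟨l1, x, l2, rfl, rfl⟩ := hF
        exact appendOp_gammaConv_sub_mem (Raise.refl _) r
      | zero => simp
      | add F G _ _ h1 h2 =>
        have : appendOp q t s r (F + G) - gFun q t s r • (F + G) =
          (appendOp q t s r F - gFun q t s r • F) + (appendOp q t s r G - gFun q t s r • G) := by
          rw [map_add, smul_add]; abel
        rw [this]
        exact add_mem h1 h2
      | smul a F _ h =>
        have : appendOp q t s r (a • F) - gFun q t s r • (a • F) =
          a • (appendOp q t s r F - gFun q t s r • F) := by
          rw [← algebraMap_smul (MvPolynomial ℕ K) a F, map_smul, algebraMap_smul, smul_sub,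
            algebraMap_smul, smul_comm]
        rw [this]
        exact Submodule.smul_mem _ _ h
    · clear_value Z
      clear hZ hop h1
      induction ih using Submodule.span_induction with
      | mem F hF =>
        obtain ⟨l1, x, l2, hR, hne, rfl⟩ := hF
        have h2 := appendOp_gammaConv_sub_mem (q := q) (t := t) (s := s) hR r
        have h3 : gFun q t s r • (gList q t s (l1 ++ l2) • gammaConv q t s x) ∈
            Submodule.span K (raisedSeqs q t s (r :: l)) := by
          refine Submodule.subset_span ⟨r :: l1, x, l2, hR.cons r, ?_, ?_⟩
          · intro heq
            simp only [List.cons_append, List.cons.injEq, true_and] at heq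
            exact hne heq
          · rw [List.cons_append, gList_cons, mul_smul]
        simpa using add_mem h2 h3
      | zero => rw [map_zero]; exact zero_mem _
      | add F G _ _ h1 h2 => rw [map_add]; exact add_mem h1 h2
      | smul a F _ h =>
        rw [← algebraMap_smul (MvPolynomial ℕ K) a F, map_smul, algebraMap_smul]
        exact Submodule.smul_mem _ _ h

/-- The diagonal entries of the Macdonald operator; the head of the list is the smallest part. -/
def eigSum (q t : K) : List ℕ → K
  | [] => 0
  | r :: l => eigSum q t l + (1 - 1 / t) * (1 / t) ^ l.length * q ^ r

/-- The Macdonald operator is triangular on the products `g_l`, with respect to raisings of `l`. -/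
theorem macOp_gList_sub_mem [CharZero K] (hs : s ≠ 0) (ht0 : t ≠ 0) (hq : ∀ k, q ^ (k + 1) ≠ 1)
    (l : List ℕ) :
    macOp q t s (gList q t s l) - ((1 / t) ^ l.length + eigSum q t l) • gList q t s l ∈
      Submodule.span K (gList q t s '' {nu | Raise l nu ∧ nu ≠ l}) := by
  have hconv : ∀ x, gammaConv q t s x 0 = C (q ^ x) * gFun q t s x := by
    intro x
    rw [← sum_gammaFun_mul_gFun (t := t) (s := s) hq x, gammaConv]
    simp
  have hdiag : diagSeq q t s l 0 = eigSum q t l • gList q t s l := by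
    induction l with
    | nil => simp [diagSeq, eigSum]
    | cons r l ih =>
      rw [diagSeq, Pi.add_apply, Pi.smul_apply, Pi.smul_apply, ih, hconv, eigSum, gList_cons]
      simp only [smul_eq_mul, MvPolynomial.smul_eq_C_mul, C_mul, C_add]
      ring
  have hγ : gammaFun t s 0 = 1 := by
    rw [gammaFun, PowerSeries.coeff_zero_eq_constantCoeff_apply]
    exact (isNewton_newton K _).1
  have h := opSeq_sub_mem (q := q) (t := t) (s := s) hs ht0 hq l
  have h0 := Submodule.mem_map_of_mem (f := (LinearMap.proj 0 :
    (ℕ → MvPolynomial ℕ K) →ₗ[K] MvPolynomial ℕ K)) h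
  rw [Submodule.map_span] at h0
  have h1 : (LinearMap.proj 0 : (ℕ → MvPolynomial ℕ K) →ₗ[K] MvPolynomial ℕ K)
      (opSeq q t s l - ((C ((1 / t) ^ l.length) * gList q t s l) • gammaFun t s +
        diagSeq q t s l)) =
      macOp q t s (gList q t s l) - ((1 / t) ^ l.length + eigSum q t l) • gList q t s l := by
    rw [LinearMap.proj_apply, Pi.sub_apply, Pi.add_apply, Pi.smul_apply, hdiag, hγ, add_smul,
      smul_eq_mul, mul_one, ← MvPolynomial.smul_eq_C_mul]
    rfl
  rw [← h1]
  refine Submodule.span_le.2 ?_ h0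
  rintro _ ⟨F, ⟨l1, x, l2, hR, hne, rfl⟩, rfl⟩
  rw [LinearMap.proj_apply, Pi.smul_apply, hconv, smul_eq_mul, mul_left_comm,
    ← MvPolynomial.smul_eq_C_mul]
  refine Submodule.smul_mem _ _ (Submodule.subset_span ⟨l1 ++ x :: l2, ⟨hR, hne⟩, ?_⟩)
  rw [gList_append_cons, mul_comm]

end Raising

/-! ### Macdonald polynomials in one alphabet -/

/-- Partitions as exponent vectors of monomials in the power sums. -/
def ptnEquiv : Ptn ≃ (ℕ →₀ ℕ) where
  toFun lam := Multiset.toFinsupp (lam.parts.map (· - 1))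
  invFun α := Ptn.ofMultiset ((Finsupp.toMultiset α).map (· + 1))
  left_inv lam := by
    have h : ((Finsupp.toMultiset (Multiset.toFinsupp (lam.parts.map (· - 1)))).map (· + 1)) =
        lam.parts := by
      rw [Multiset.toFinsupp_toMultiset, Multiset.map_map]
      conv_rhs => rw [← Multiset.map_id lam.parts]
      refine Multiset.map_congr rfl fun k hk => ?_
      have := Ptn.pos_of_mem hk
      simp only [Function.comp_apply, id]
      omega
    dsimp only
    rw [h, Ptn.ofMultiset_parts]
  right_inv α := by
    have h : (Multiset.filter (· ≠ 0) ((Finsupp.toMultiset α).map (· + 1))) =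
        (Finsupp.toMultiset α).map (· + 1) := by
      rw [Multiset.filter_eq_self]
      intro a ha
      obtain ⟨b, -, rfl⟩ := Multiset.mem_map.1 ha
      exact Nat.succ_ne_zero b
    dsimp only
    rw [Ptn.parts_ofMultiset, h, Multiset.map_map]
    have h2 : ((fun x => x - 1) ∘ fun x : ℕ => x + 1) = id := by
      funext x
      simp
    rw [h2, Multiset.map_id, Finsupp.toMultiset_toFinsupp]

section Distinct

variable {K : Type*} [Field K]

theorem sum_take_eq_sum_getD (L : List ℕ) (j : ℕ) :
    (L.take j).sum = ∑ i ∈ Finset.range j, L.getD i 0 := by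
  induction L generalizing j with
  | nil => simp
  | cons a L ih =>
    cases j with
    | zero => simp
    | succ j =>
      rw [List.take_succ_cons, List.sum_cons, ih, Finset.sum_range_succ']
      simp [add_comm]

theorem eigSum_reverse (q t : K) (L : List ℕ) : eigSum q t L.reverse =
    (1 - 1 / t) * ∑ j ∈ Finset.range L.length, (1 / t) ^ j * q ^ L.getD j 0 := by
  induction L using List.reverseRecOn with
  | nil => simp [eigSum]
  | append_singleton L r ih =>
    have h : ∑ j ∈ Finset.range L.length, (1 / t) ^ j * q ^ (L ++ [r]).getD j 0 =
        ∑ j ∈ Finset.range L.length, (1 / t) ^ j * q ^ L.getD j 0 :=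
      Finset.sum_congr rfl fun j hj => by rw [List.getD_append _ _ _ _ (Finset.mem_range.1 hj)]
    rw [List.reverse_append, List.reverse_singleton, List.singleton_append, eigSum, ih,
      List.length_append, List.length_singleton, Finset.sum_range_succ, h, List.length_reverse,
      List.getD_append_right _ _ _ _ le_rfl]
    simp
    ring

theorem pow_add_eigSum_reverse {q t : K} (L : List ℕ) {N : ℕ} (hN : L.length ≤ N) :
    (1 / t) ^ L.length + eigSum q t L.reverse =
      (1 / t) ^ N + (1 - 1 / t) * ∑ j ∈ Finset.range N, (1 / t) ^ j * q ^ L.getD j 0 := by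
  induction N, hN using Nat.le_induction with
  | base => rw [eigSum_reverse]
  | succ N hN ih =>
    rw [ih, Finset.sum_range_succ, List.getD_eq_default _ _ hN, pow_zero, pow_succ]
    ring

open MvPolynomial in
/-- Generic polynomial expressions in `q`, `t` of this shape determine the exponents of `q`; this
separates the eigenvalues of the Macdonald operator. -/
theorem sum_pow_injective {q t : K} (hqt : AlgebraicIndependent ℤ ![q, t]) {N : ℕ} {a b : ℕ → ℕ}
    (h : ∑ j ∈ Finset.range N, t ^ (N - j) * q ^ a j =
      ∑ j ∈ Finset.range N, t ^ (N - j) * q ^ b j) :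
    ∀ j < N, a j = b j := by
  classical
  let m : ℕ → ℕ → (Fin 2 →₀ ℕ) := fun i j => Finsupp.single 0 i + Finsupp.single 1 j
  have hm : ∀ i j i' j', m i j = m i' j' → i = i' ∧ j = j' := by
    intro i j i' j' h
    exact ⟨by simpa [m] using DFunLike.congr_fun h 0, by simpa [m] using DFunLike.congr_fun h 1⟩
  let F : (ℕ → ℕ) → MvPolynomial (Fin 2) ℤ := fun a =>
    ∑ j ∈ Finset.range N, monomial (m (a j) (N - j)) 1
  have hF : ∀ a, aeval ![q, t] (F a) = ∑ j ∈ Finset.range N, t ^ (N - j) * q ^ a j := by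
    intro a
    rw [map_sum]
    refine Finset.sum_congr rfl fun j _ => ?_
    rw [aeval_monomial, Finsupp.prod_add_index' (by simp) (by intros; rw [pow_add]),
      Finsupp.prod_single_index (by simp), Finsupp.prod_single_index (by simp)]
    simp [mul_comm]
  have hab : F a = F b := hqt (by rw [hF, hF, h])
  intro j hj
  have hc := congrArg (coeff (m (b j) (N - j))) hab
  simp only [F, coeff_sum, coeff_monomial] at hc
  by_contra hne
  rw [Finset.sum_eq_zero, Finset.sum_eq_single j, if_pos rfl] at hc
  · exact zero_ne_one hc
  · intro i hi hij
    rw [if_neg]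
    intro h'
    have h1 := (hm _ _ _ _ h').2
    have h2 := Finset.mem_range.1 hi
    omega
  · intro h'
    exact absurd (Finset.mem_range.2 hj) h'
  · intro i hi
    rw [if_neg]
    intro h'
    obtain ⟨h0, h1⟩ := hm _ _ _ _ h'
    have h2 := Finset.mem_range.1 hi
    have : i = j := by omega
    subst this
    exact hne h0

theorem pow_ne_one_left {q t : K} (hqt : AlgebraicIndependent ℤ ![q, t]) (k : ℕ) :
    q ^ (k + 1) ≠ 1 := by
  intro h
  have := sum_pow_injective hqt (N := 1) (a := fun _ => k + 1) (b := fun _ => 0) (by simp [h]) 0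
    (by simp)
  omega

open MvPolynomial in
theorem AlgebraicIndependent.swap {q t : K} (hqt : AlgebraicIndependent ℤ ![q, t]) :
    AlgebraicIndependent ℤ ![t, q] := by
  have h := hqt.comp (Equiv.swap (0 : Fin 2) 1) (Equiv.injective _)
  have h2 : (![q, t] ∘ Equiv.swap (0 : Fin 2) 1) = ![t, q] := by
    funext i
    fin_cases i <;> simp
  rwa [h2] at h

/-- The eigenvalue of the Macdonald operator that belongs to `λ`. -/
def macEig (q t : K) (lam : Ptn) : K :=
  (1 / t) ^ lam.descList.length + eigSum q t lam.descList.reverse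

theorem macEig_injective {q t : K} (ht0 : t ≠ 0) (hqt : AlgebraicIndependent ℤ ![q, t]) :
    Function.Injective (macEig q t) := by
  intro lam mu h
  set N := max lam.descList.length mu.descList.length with hN
  rw [macEig, macEig, pow_add_eigSum_reverse _ (le_max_left _ _ : _ ≤ N),
    pow_add_eigSum_reverse _ (le_max_right _ _ : _ ≤ N)] at h
  have ht1 : t ≠ 1 := by simpa using pow_ne_one_left (AlgebraicIndependent.swap hqt) 0
  have h1 : (1 - 1 / t) ≠ 0 := by
    rw [sub_ne_zero]
    intro h'
    rw [eq_comm, div_eq_one_iff_eq ht0] at h'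
    exact ht1 h'.symm
  have h2 := mul_left_cancel₀ h1 (add_left_cancel h)
  have h3 : ∀ L : List ℕ, t ^ N * ∑ j ∈ Finset.range N, (1 / t) ^ j * q ^ L.getD j 0 =
      ∑ j ∈ Finset.range N, t ^ (N - j) * q ^ L.getD j 0 := by
    intro L
    rw [Finset.mul_sum]
    refine Finset.sum_congr rfl fun j hj => ?_
    have hj' := Finset.mem_range.1 hj
    rw [← mul_assoc]
    congr 1
    rw [pow_sub₀ _ ht0 hj'.le, one_div, inv_pow]
  have h4 := sum_pow_injective hqt (N := N) (a := fun j => lam.descList.getD j 0)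
    (b := fun j => mu.descList.getD j 0) (by rw [← h3, ← h3, h2])
  refine Ptn.eq_of_partialSum_eq fun j => ?_
  rw [Ptn.partialSum_eq, Ptn.partialSum_eq, sum_take_eq_sum_getD, sum_take_eq_sum_getD]
  refine Finset.sum_congr rfl fun i _ => ?_
  rcases lt_or_ge i N with hi | hi
  · exact h4 i hi
  · rw [List.getD_eq_default _ _ ((le_max_left _ _).trans hi),
      List.getD_eq_default _ _ ((le_max_right _ _).trans hi)]

end Distinct

section Existence

open MvPolynomial

variable {K : Type*} [Field K]

theorem prod_map_X_eq_monomial {σ : Type*} [DecidableEq σ] (m : Multiset σ) :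
    (m.map (X : σ → MvPolynomial σ K)).prod = monomial (Multiset.toFinsupp m) 1 := by
  induction m using Multiset.induction with
  | empty => simp
  | cons a m ih =>
    rw [Multiset.map_cons, Multiset.prod_cons, ih, X, monomial_mul, one_mul,
      ← Multiset.singleton_add, map_add, Multiset.toFinsupp_singleton]

/-- The basis of the monomials in the power sums. -/
def pBasis (K : Type*) [Field K] : Module.Basis Ptn K (MvPolynomial ℕ K) :=
  (basisMonomials ℕ K).reindex ptnEquiv.symm

theorem pBasis_apply (lam : Ptn) : pBasis K lam = (lam.parts.map fun k => X (k - 1)).prod := by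
  rw [pBasis, Module.Basis.reindex_apply, Equiv.symm_symm, coe_basisMonomials]
  have := prod_map_X_eq_monomial (K := K) (lam.parts.map (· - 1))
  rw [Multiset.map_map] at this
  exact this.symm

/-- The expression of the power sums through the `g_r`, by Newton's recursion
`(k+1) g_{k+1} = ∑_{i ≤ k} e_i p_{i+1} g_{k-i}`. -/
def powerOfG (e : ℕ → K) (k : ℕ) : MvPolynomial ℕ K :=
  C (e k)⁻¹ * (C ((k : K) + 1) * X k - ∑ i : Fin k, C (e i) * powerOfG e i * X (k - 1 - i))

theorem powerOfG_rec (e : ℕ → K) (he : ∀ k, e k ≠ 0) (k : ℕ) :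
    C (e k) * powerOfG e k =
      C ((k : K) + 1) * X k - ∑ i ∈ Finset.range k, C (e i) * powerOfG e i * X (k - 1 - i) := by
  rw [powerOfG, ← mul_assoc, ← C_mul, mul_inv_cancel₀ (he k), C_1, one_mul,
    Finset.sum_range (fun i => C (e i) * powerOfG e i * X (k - 1 - i))]

theorem newton_linSeries_rec [CharZero K] (e : ℕ → K) (n : ℕ) :
    C ((n : K) + 1) * PowerSeries.coeff (n + 1) (newton K (linSeries e)) = C (e n) * X n +
      ∑ i ∈ Finset.range n,
        C (e i) * X i * PowerSeries.coeff (n - 1 - i + 1) (newton K (linSeries e)) := by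
  have h := (isNewton_newton K (linSeries e)).rec_formula n
  rw [Finset.sum_range_succ, Nat.sub_self, PowerSeries.coeff_zero_eq_constantCoeff_apply,
    (isNewton_newton K (linSeries e)).1, mul_one] at h
  have hc : ∀ i, PowerSeries.coeff i (linSeries e) = C (e i) * X i := fun i => by
    rw [linSeries, PowerSeries.coeff_mk]
  have hsum : ∑ i ∈ Finset.range n,
      C (e i) * X i * PowerSeries.coeff (n - 1 - i + 1) (newton K (linSeries e)) =
      ∑ i ∈ Finset.range n,
        PowerSeries.coeff i (linSeries e) * PowerSeries.coeff (n - i) (newton K (linSeries e)) := by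
    refine Finset.sum_congr rfl fun i hi => ?_
    have := Finset.mem_range.1 hi
    rw [show n - 1 - i + 1 = n - i by omega, hc]
  rw [map_add, map_natCast, C_1, h, hsum, hc, add_comm]

theorem aeval_powerOfG {e : ℕ → K} (he : ∀ k, e k ≠ 0) {g : ℕ → MvPolynomial ℕ K}
    (hg : ∀ n : ℕ, C ((n : K) + 1) * g n = C (e n) * X n +
      ∑ i ∈ Finset.range n, C (e i) * X i * g (n - 1 - i)) (k : ℕ) :
    aeval g (powerOfG e k) = (X k : MvPolynomial ℕ K) := by
  induction k using Nat.strong_induction_on with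
  | _ k ih =>
    have h := congrArg (aeval g) (powerOfG_rec e he k)
    have h' : ∑ i ∈ Finset.range k, aeval g (C (e i) * powerOfG e i * X (k - 1 - i)) =
        ∑ i ∈ Finset.range k, C (e i) * X i * g (k - 1 - i) := by
      refine Finset.sum_congr rfl fun i hi => ?_
      rw [map_mul, map_mul, algHom_C, aeval_X, ih i (Finset.mem_range.1 hi), algebraMap_eq]
    rw [map_mul, map_sub, map_mul, map_sum, algHom_C, algHom_C, aeval_X, h', algebraMap_eq,
      hg, add_sub_cancel_right] at h
    exact mul_left_cancel₀ (C_ne_zero.2 (he k)) h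

theorem aeval_powerOfG_apply [CharZero K] {e : ℕ → K} (he : ∀ k, e k ≠ 0)
    {g : ℕ → MvPolynomial ℕ K} (hg : ∀ n : ℕ, C ((n : K) + 1) * g n = C (e n) * X n +
      ∑ i ∈ Finset.range n, C (e i) * X i * g (n - 1 - i)) (k : ℕ) :
    aeval (powerOfG e) (g k) = (X k : MvPolynomial ℕ K) := by
  induction k using Nat.strong_induction_on with
  | _ k ih =>
    have h := congrArg (aeval (powerOfG e)) (hg k)
    have h' : ∑ i ∈ Finset.range k, aeval (powerOfG e) (C (e i) * X i * g (k - 1 - i)) =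
        ∑ i ∈ Finset.range k, C (e i) * powerOfG e i * X (k - 1 - i) := by
      refine Finset.sum_congr rfl fun i hi => ?_
      have := Finset.mem_range.1 hi
      rw [map_mul, map_mul, algHom_C, aeval_X, ih (k - 1 - i) (by omega), algebraMap_eq]
    have hk : ((k : K) + 1) ≠ 0 := by exact_mod_cast Nat.succ_ne_zero k
    rw [map_mul, algHom_C, map_add (aeval (powerOfG e)), map_sum, map_mul, algHom_C, aeval_X, h',
      algebraMap_eq, powerOfG_rec e he k, sub_add_cancel] at h
    exact mul_left_cancel₀ (C_ne_zero.2 hk) h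

/-- The `g_r` are algebraically independent generators. -/
theorem exists_gAlgEquiv [CharZero K] (e : ℕ → K) (he : ∀ k, e k ≠ 0) :
    ∃ φ : MvPolynomial ℕ K ≃ₐ[K] MvPolynomial ℕ K,
      ∀ k, φ (X k) = PowerSeries.coeff (k + 1) (newton K (linSeries e)) := by
  have hg := newton_linSeries_rec e
  generalize hG : (fun k => PowerSeries.coeff (k + 1) (newton K (linSeries e))) = g
  have hG' : ∀ k, PowerSeries.coeff (k + 1) (newton K (linSeries e)) = g k := fun k =>
    congrFun hG k
  simp only [hG'] at hg ⊢
  refine ⟨AlgEquiv.ofAlgHom (aeval g) (aeval (powerOfG e))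
    (MvPolynomial.algHom_ext fun k => ?_) (MvPolynomial.algHom_ext fun k => ?_), fun k => ?_⟩
  · rw [AlgHom.comp_apply, aeval_X, aeval_powerOfG he hg]
    rfl
  · rw [AlgHom.comp_apply, aeval_X, aeval_powerOfG_apply he hg]
    rfl
  · exact aeval_X _ _

/-- `g_λ = g_{λ₁} g_{λ₂} ⋯`. -/
def gPtn (q t s : K) (lam : Ptn) : MvPolynomial ℕ K := (lam.parts.map (gFun q t s)).prod

variable [CharZero K] {q t s : K}

theorem gList_eq_gPtn (l : List ℕ) :
    gList q t s l = gPtn q t s (Ptn.ofMultiset (l : Multiset ℕ)) := by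
  rw [gPtn, Ptn.parts_ofMultiset]
  induction l with
  | nil => simp [gList]
  | cons r l ih =>
    rw [gList_cons, ih, ← Multiset.cons_coe]
    by_cases hr : r = 0
    · subst hr
      simp [gFun_zero]
    · rw [Multiset.filter_cons_of_pos (p := (· ≠ 0)) _ hr, Multiset.map_cons, Multiset.prod_cons]

theorem gList_reverse_descList (lam : Ptn) :
    gList q t s lam.descList.reverse = gPtn q t s lam := by
  rw [gList_eq_gPtn, Multiset.coe_reverse, Ptn.coe_descList, Ptn.ofMultiset_parts]

theorem exists_gBasis (hs : s ≠ 0) (hq : ∀ k, q ^ (k + 1) ≠ 1) (ht : ∀ k, t ^ (k + 1) ≠ 1) :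
    ∃ b : Module.Basis Ptn K (MvPolynomial ℕ K), ∀ lam, b lam = gPtn q t s lam := by
  have he : ∀ k, (1 - t ^ (k + 1)) / (s ^ (k + 1) * (1 - q ^ (k + 1))) ≠ 0 := fun k =>
    div_ne_zero (sub_ne_zero.2 (ht k).symm) (mul_ne_zero (pow_ne_zero _ hs)
      (sub_ne_zero.2 (hq k).symm))
  obtain ⟨φ, hφ⟩ := exists_gAlgEquiv _ he
  refine ⟨(pBasis K).map φ.toLinearEquiv, fun lam => ?_⟩
  rw [Module.Basis.map_apply, pBasis_apply, AlgEquiv.toLinearEquiv_apply, map_multiset_prod,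
    Multiset.map_map, gPtn]
  congr 1
  refine Multiset.map_congr rfl fun k hk => ?_
  have := Ptn.pos_of_mem hk
  rw [Function.comp_apply, hφ, gFun, show k - 1 + 1 = k by omega]

theorem macOp_gPtn_sub_mem (hs : s ≠ 0) (ht0 : t ≠ 0) (hq : ∀ k, q ^ (k + 1) ≠ 1) (lam : Ptn) :
    macOp q t s (gPtn q t s lam) - macEig q t lam • gPtn q t s lam ∈
      Submodule.span K (gPtn q t s '' {nu | nu.Higher lam}) := by
  have h := macOp_gList_sub_mem (t := t) (s := s) hs ht0 hq lam.descList.reverse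
  rw [gList_reverse_descList, List.length_reverse] at h
  refine Submodule.span_mono ?_ h
  rintro _ ⟨nu, ⟨hR, hne⟩, rfl⟩
  exact ⟨_, hR.higher hne, (gList_eq_gPtn nu).symm⟩

/-- The weights of the power sums: `p_{k+1}` has degree `k+1`. -/
abbrev pWeight (k : ℕ) : ℕ := k + 1

theorem isWeightedHomogeneous_gFun (r : ℕ) :
    IsWeightedHomogeneous pWeight (gFun q t s r) r := by
  induction r using Nat.strong_induction_on with
  | _ r ih =>
    cases r with
    | zero =>
      rw [gFun_zero]
      exact isWeightedHomogeneous_one K _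
    | succ n =>
      set e : ℕ → K := fun k => (1 - t ^ (k + 1)) / (s ^ (k + 1) * (1 - q ^ (k + 1))) with he
      have h := (isNewton_newton K (linSeries e)).rec_formula n
      have hn : ((n : K) + 1) ≠ 0 := by exact_mod_cast Nat.succ_ne_zero n
      have h1 : IsWeightedHomogeneous pWeight (((n : K) + 1) • gFun q t s (n + 1)) (n + 1) := by
        rw [MvPolynomial.smul_eq_C_mul, map_add, map_natCast, C_1]
        have h' : ((n : MvPolynomial ℕ K) + 1) * gFun q t s (n + 1) = _ := h
        rw [h']
        refine IsWeightedHomogeneous.sum _ _ _ fun i hi => ?_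
        have hi' := Finset.mem_range.1 hi
        rw [linSeries, PowerSeries.coeff_mk]
        have h2 := ((isWeightedHomogeneous_C pWeight (e i)).mul
          (isWeightedHomogeneous_X K pWeight i)).mul (ih (n - i) (by omega))
        have h3 : 0 + pWeight i + (n - i) = n + 1 := by simp only [pWeight]; omega
        rwa [h3] at h2
      have h4 := Submodule.smul_mem (weightedHomogeneousSubmodule K pWeight (n + 1))
        ((n : K) + 1)⁻¹ h1
      rwa [smul_smul, inv_mul_cancel₀ hn, one_smul] at h4

theorem isWeightedHomogeneous_gPtn (lam : Ptn) :
    IsWeightedHomogeneous pWeight (gPtn q t s lam) lam.size := by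
  rw [gPtn, Ptn.size_eq_sum]
  induction lam.parts using Multiset.induction with
  | empty => simpa using isWeightedHomogeneous_one K pWeight
  | cons a m ih =>
    rw [Multiset.map_cons, Multiset.prod_cons, Multiset.sum_cons]
    exact (isWeightedHomogeneous_gFun a).mul ih

/-- The coefficient of `x₁^{l₁} x₂^{l₂} ⋯` in the expansion of a symmetric function as a
polynomial in `x₁, x₂, …` (one variable for each entry of `l`) with coefficients that are symmetric
functions of the remaining variables. -/
def varCoeff (l : List ℕ) (f : MvPolynomial ℕ K) : MvPolynomial ℕ K :=
  l.foldl (fun f r => (translate (fun _ => 1) f).coeff r) f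

theorem polyForm_gList_mul (hs : s ≠ 0) (hq : ∀ k, q ^ (k + 1) ≠ 1) (ht : ∀ k, t ^ (k + 1) ≠ 1)
    (l : List ℕ) (h f : MvPolynomial ℕ K) :
    polyForm (macNorm q t s) (gList q t s l * h) f = polyForm (macNorm q t s) h (varCoeff l f) := by
  induction l generalizing f with
  | nil => simp [gList, varCoeff]
  | cons r l ih =>
    rw [gList_cons, mul_assoc, polyForm_gFun_mul hs hq ht, ih]
    rfl

theorem macNorm_ne_zero (hs : s ≠ 0) (hq : ∀ k, q ^ (k + 1) ≠ 1) (ht : ∀ k, t ^ (k + 1) ≠ 1)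
    (k : ℕ) : macNorm q t s k ≠ 0 := by
  have hk : ((k : K) + 1) ≠ 0 := by exact_mod_cast Nat.succ_ne_zero k
  exact div_ne_zero (mul_ne_zero (mul_ne_zero hk (pow_ne_zero _ hs))
    (sub_ne_zero.2 (hq k).symm)) (sub_ne_zero.2 (ht k).symm)

/-- Existence of the Macdonald polynomials in one alphabet, as polynomials in the power sums. The
last two properties say that `P_λ` is `m_λ` plus a linear combination of smaller `m_μ`. -/
theorem exists_macdonald (hs : s ≠ 0) (ht0 : t ≠ 0) (hqt : AlgebraicIndependent ℤ ![q, t]) :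
    ∃ f : Ptn → MvPolynomial ℕ K, ⊤ ≤ Submodule.span K (Set.range f) ∧
      (∀ lam mu, lam ≠ mu → polyForm (macNorm q t s) (f lam) (f mu) = 0) ∧
      (∀ lam, IsWeightedHomogeneous pWeight (f lam) lam.size) ∧
      (∀ lam, constantCoeff (varCoeff lam.descList (f lam)) = 1) ∧
      ∀ (lam : Ptn) (l : List ℕ), lam.partialSum l.length < l.sum → varCoeff l (f lam) = 0 := by
  have hq := pow_ne_one_left hqt
  have ht := pow_ne_one_left (AlgebraicIndependent.swap hqt)
  set B := polyForm (macNorm q t s) with hB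
  obtain ⟨b, hb⟩ := exists_gBasis (q := q) (t := t) hs hq ht
  have hbf : (b : Ptn → MvPolynomial ℕ K) = gPtn q t s := funext hb
  obtain ⟨Q, hQ, hQE⟩ := exists_unitri_eigenvectors Ptn.Higher.wf Ptn.Higher.trans (gPtn q t s)
    (macOp q t s) (macEig q t) (fun i j h => (macEig_injective ht0 hqt).ne h.2.2)
    (macOp_gPtn_sub_mem hs ht0 hq)
  have hQb : Unitri K Ptn.Higher b Q := by rw [hbf]; exact hQ
  have hspan : ⊤ ≤ Submodule.span K (Set.range Q) :=
    hQb.top_le_span Ptn.Higher.wf Ptn.Higher.trans b.span_eq.ge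
  have hli := hQb.linearIndependent b Ptn.Higher.irrefl Ptn.Higher.trans
  -- eigenvectors of a self-adjoint operator for distinct eigenvalues are orthogonal
  have horth : ∀ lam mu, lam ≠ mu → B (Q lam) (Q mu) = 0 := by
    intro lam mu hne
    have h := macOp_selfAdjoint (q := q) hs ht (Q lam) (Q mu)
    rw [hQE, hQE, map_smul, map_smul, LinearMap.smul_apply, smul_eq_mul, smul_eq_mul,
      ← sub_eq_zero, ← sub_mul] at h
    exact (mul_eq_zero.1 h).resolve_left
      (sub_ne_zero.2 ((macEig_injective ht0 hqt).ne hne))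
  have hnorm : ∀ lam, B (Q lam) (Q lam) ≠ 0 := by
    intro lam h0
    refine hli.ne_zero lam (polyForm_nondegenerate (macNorm_ne_zero hs hq ht) fun g => ?_)
    have hg : g ∈ Submodule.span K (Set.range Q) := hspan trivial
    induction hg using Submodule.span_induction with
    | mem x hx =>
      obtain ⟨mu, rfl⟩ := hx
      by_cases h : mu = lam
      · rw [h]; exact h0
      · exact horth _ _ h
    | zero => rw [map_zero, LinearMap.zero_apply]
    | add x y _ _ h1 h2 => rw [map_add, LinearMap.add_apply, h1, h2, add_zero]
    | smul a x _ h => rw [map_smul, LinearMap.smul_apply, h, smul_zero]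
  -- pairing with `g_μ`, which is `Q_μ` plus higher terms
  have hgQ : ∀ mu lam, B (gPtn q t s mu - Q mu) (Q lam) ≠ 0 → lam.Higher mu := by
    intro mu lam
    contrapose!
    intro hn
    have hm := hQ.symm Ptn.Higher.wf Ptn.Higher.trans mu
    generalize gPtn q t s mu - Q mu = y at hm
    induction hm using Submodule.span_induction with
    | mem x hx =>
      obtain ⟨nu, hnu, rfl⟩ := hx
      exact horth _ _ (by rintro rfl; exact hn hnu)
    | zero => rw [map_zero, LinearMap.zero_apply]
    | add x y _ _ h1 h2 => rw [map_add, LinearMap.add_apply, h1, h2, add_zero]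
    | smul a x _ h => rw [map_smul, LinearMap.smul_apply, h, smul_zero]
  have hgQ' : ∀ mu lam, B (gPtn q t s mu) (Q lam) ≠ 0 → mu = lam ∨ lam.Higher mu := by
    intro mu lam h
    by_contra! hc
    apply h
    have h1 : B (gPtn q t s mu - Q mu) (Q lam) = 0 := by
      by_contra h2
      exact hc.2 (hgQ mu lam h2)
    rwa [map_sub, LinearMap.sub_apply, horth _ _ hc.1, sub_zero] at h1
  refine ⟨fun lam => (B (Q lam) (Q lam))⁻¹ • Q lam, ?_, ?_, ?_, ?_, ?_⟩
  · refine hspan.trans (Submodule.span_le.2 ?_)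
    rintro _ ⟨lam, rfl⟩
    have h : Q lam = B (Q lam) (Q lam) • ((B (Q lam) (Q lam))⁻¹ • Q lam) := by
      rw [smul_smul, mul_inv_cancel₀ (hnorm lam), one_smul]
    rw [SetLike.mem_coe, h]
    exact Submodule.smul_mem _ _ (Submodule.subset_span ⟨lam, rfl⟩)
  · intro lam mu hne
    rw [map_smul, map_smul, LinearMap.smul_apply, horth _ _ hne, smul_zero, smul_zero]
  · intro lam
    refine Submodule.smul_mem (weightedHomogeneousSubmodule K pWeight lam.size) _ ?_
    have h1 : Q lam - gPtn q t s lam ∈ weightedHomogeneousSubmodule K pWeight lam.size := by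
      refine Submodule.span_le.2 ?_ (hQ lam)
      rintro _ ⟨nu, hnu, rfl⟩
      have := isWeightedHomogeneous_gPtn (q := q) (t := t) (s := s) nu
      rw [hnu.1] at this
      exact this
    have h2 := add_mem h1 (show gPtn q t s lam ∈ weightedHomogeneousSubmodule K pWeight lam.size
      from isWeightedHomogeneous_gPtn lam)
    simpa using h2
  · intro lam
    have h := polyForm_gList_mul hs hq ht lam.descList 1 ((B (Q lam) (Q lam))⁻¹ • Q lam)
    rw [polyForm_one, mul_one] at h
    rw [MvPolynomial.constantCoeff_eq, ← h, gList_eq_gPtn, Ptn.coe_descList, Ptn.ofMultiset_parts,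
      map_smul]
    have h1 : B (gPtn q t s lam - Q lam) (Q lam) = 0 := by
      by_contra h2
      exact (hgQ lam lam h2).irrefl
    rw [map_sub, LinearMap.sub_apply, sub_eq_zero] at h1
    rw [← hB, h1, smul_eq_mul, inv_mul_cancel₀ (hnorm lam)]
  · intro lam l hl
    refine polyForm_nondegenerate (macNorm_ne_zero hs hq ht) fun g => ?_
    rw [← polyForm_gList_mul hs hq ht, map_smul, smul_eq_mul, mul_eq_zero]
    right
    have hg : g ∈ Submodule.span K (Set.range b) := b.mem_span g
    induction hg using Submodule.span_induction with
    | mem x hx =>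
      obtain ⟨mu, rfl⟩ := hx
      rw [hb]
      by_contra h0
      set nu := Ptn.ofMultiset ((l : Multiset ℕ) + mu.parts) with hnu
      have hlg : gList q t s l * gPtn q t s mu = gPtn q t s nu := by
        have hl' : (l : Multiset ℕ) + mu.parts =
            ((l ++ mu.descList.reverse : List ℕ) : Multiset ℕ) := by
          rw [← Multiset.coe_add, Multiset.coe_reverse, Ptn.coe_descList]
        rw [← gList_reverse_descList mu, hnu, hl', ← gList_eq_gPtn, gList, gList, gList,
          List.map_append, List.prod_append]
      rw [hlg] at h0
      have h1 : ((l : Multiset ℕ)).sum ≤ nu.partialSum l.length :=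
        Ptn.sum_le_partialSum_ofMultiset (Multiset.le_add_right _ _) (by simp)
      rw [Multiset.sum_coe] at h1
      rcases hgQ' nu lam h0 with h2 | h2
      · rw [h2] at h1; omega
      · have := h2.2.1 l.length
        omega
    | zero => rw [mul_zero, map_zero, LinearMap.zero_apply]
    | add x y _ _ h1 h2 => rw [mul_add, map_add, LinearMap.add_apply, h1, h2, add_zero]
    | smul a x _ h => rw [mul_smul_comm, map_smul, LinearMap.smul_apply, h, smul_zero]

end Existence

/-! ### Several alphabets: isometries and products -/

section Several

open MvPolynomial

variable {K : Type*} [Field K]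

theorem polyForm_C {σ : Type*} (c : σ → K) (a : K) (f : MvPolynomial σ K) :
    polyForm c (C a) f = a * constantCoeff f := by
  rw [← mul_one (C a), ← MvPolynomial.smul_eq_C_mul, map_smul, LinearMap.smul_apply, polyForm_one,
    smul_eq_mul, constantCoeff_eq]

/-- The form on products of polynomials in disjoint sets of variables factors. -/
theorem polyForm_rename_mul {σ κ : Type*} {ρ : κ → σ} (hρ : Function.Injective ρ) (d : σ → K)
    {F H : MvPolynomial σ K} (hF : ∀ k, pderiv (ρ k) F = 0) (hH : ∀ k, pderiv (ρ k) H = 0)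
    (f h : MvPolynomial κ K) : polyForm d (rename ρ f * F) (rename ρ h * H) =
      polyForm (d ∘ ρ) f h * polyForm d F H := by
  induction f using MvPolynomial.induction_on generalizing h with
  | C a =>
    rw [rename_C, ← MvPolynomial.smul_eq_C_mul, map_smul, LinearMap.smul_apply]
    rw [polyForm_C, smul_eq_mul, mul_assoc]
    congr 1
    induction h using MvPolynomial.induction_on with
    | C b =>
      rw [rename_C, ← MvPolynomial.smul_eq_C_mul, map_smul, constantCoeff_C, smul_eq_mul]
    | add f g h1 h2 => simp only [map_add, add_mul, h1, h2]
    | mul_X f k _ =>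
      rw [map_mul (rename ρ), rename_X, mul_comm _ (X (ρ k)), mul_assoc, polyForm_symm,
        polyForm_X_mul, hF]
      simp
  | add f g hf hg => simp only [map_add, add_mul, LinearMap.add_apply, hf, hg]
  | mul_X f k hf =>
    rw [map_mul (rename ρ), rename_X, mul_comm _ (X (ρ k)), mul_assoc, polyForm_X_mul,
      pderiv_mul, hH, mul_zero, add_zero, pderiv_rename hρ, hf, mul_comm f, polyForm_X_mul]
    rw [Function.comp_apply, mul_assoc]

theorem pderiv_prod_rename {ι : Type*} [DecidableEq ι] (x : ι → MvPolynomial ℕ K) {i : ι}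
    {s : Finset ι} (hi : i ∉ s) (k : ℕ) :
    pderiv (i, k) (∏ j ∈ s, rename (Prod.mk j) (x j)) = 0 := by
  induction s using Finset.induction_on with
  | empty => simp
  | insert j s hj ih =>
    rw [Finset.prod_insert hj, pderiv_mul, ih (fun h => hi (Finset.mem_insert_of_mem h)), mul_zero,
      add_zero, pderiv_eq_zero_of_notMem_vars, zero_mul]
    intro h
    obtain ⟨k', -, hk'⟩ := Finset.mem_image.1 (vars_rename _ _ h)
    rw [Prod.mk.injEq] at hk'
    exact hi (hk'.1 ▸ Finset.mem_insert_self _ _)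

theorem polyForm_prod_rename {ι : Type*} [DecidableEq ι] (d : ι × ℕ → K)
    (x y : ι → MvPolynomial ℕ K) (s : Finset ι) :
    polyForm d (∏ i ∈ s, rename (Prod.mk i) (x i)) (∏ i ∈ s, rename (Prod.mk i) (y i)) =
      ∏ i ∈ s, polyForm (fun k => d (i, k)) (x i) (y i) := by
  induction s using Finset.induction_on with
  | empty => simp [polyForm_one]
  | insert i s hi ih =>
    rw [Finset.prod_insert hi, Finset.prod_insert hi, Finset.prod_insert hi, ← ih]
    exact polyForm_rename_mul (Prod.mk_right_injective i) d (pderiv_prod_rename x hi)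
      (pderiv_prod_rename y hi) _ _

/-- The linear substitution `X (i, k) ↦ ∑_j h k i j X (j, k)`. -/
def linSubst {ι : Type*} [Fintype ι] (h : ℕ → ι → ι → K) :
    MvPolynomial (ι × ℕ) K →ₐ[K] MvPolynomial (ι × ℕ) K :=
  aeval fun x => ∑ j, C (h x.2 x.1 j) * X (j, x.2)

theorem linSubst_X {ι : Type*} [Fintype ι] (h : ℕ → ι → ι → K) (i : ι) (k : ℕ) :
    linSubst h (X (i, k)) = ∑ j, C (h k i j) * X (j, k) := by
  rw [linSubst, aeval_X]

/-- A linear substitution that is isometric on the generators is an isometry. -/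
theorem polyForm_linSubst {ι : Type*} [Fintype ι] [DecidableEq ι] {h : ℕ → ι → ι → K}
    {c d : ι × ℕ → K}
    (hG : ∀ k i l, ∑ j, h k i j * h k l j * d (j, k) = if i = l then c (i, k) else 0)
    (f g : MvPolynomial (ι × ℕ) K) :
    polyForm d (linSubst h f) (linSubst h g) = polyForm c f g := by
  -- the adjoint of the multiplication by the image of a generator, applied to the image of `g`
  have hD : ∀ (i : ι) (k : ℕ) (g : MvPolynomial (ι × ℕ) K),
      ∑ j, C (h k i j * d (j, k)) * pderiv (j, k) (linSubst h g) =
        C (c (i, k)) * linSubst h (pderiv (i, k) g) := by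
    intro i k g
    induction g using MvPolynomial.induction_on with
    | C a => simp [linSubst]
    | add f g hf hg => simp only [map_add, mul_add, Finset.sum_add_distrib, hf, hg]
    | mul_X f x hf =>
      obtain ⟨l, m⟩ := x
      have h1 : ∀ j, pderiv (j, k) (linSubst h (X (l, m))) =
          if k = m then C (h k l j) else 0 := by
        intro j
        rw [linSubst_X, map_sum]
        simp only [pderiv_C_mul, pderiv_X]
        split_ifs with hkm
        · subst hkm
          rw [Finset.sum_eq_single j]
          · simp
          · intro b _ hb
            rw [Pi.single_eq_of_ne (by simpa using hb), mul_zero]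
          · intro h; exact absurd (Finset.mem_univ _) h
        · refine Finset.sum_eq_zero fun b _ => ?_
          rw [Pi.single_eq_of_ne (by rintro h; exact hkm (Prod.ext_iff.1 h).2.symm), mul_zero]
      have h2 : ∑ j, C (h k i j * d (j, k)) * pderiv (j, k) (linSubst h (X (l, m))) =
          C (c (i, k)) * linSubst h (pderiv (i, k) (X (l, m))) := by
        simp only [h1, pderiv_X]
        by_cases hkm : k = m
        · subst hkm
          have := congrArg (C : K → MvPolynomial (ι × ℕ) K) (hG k i l)
          rw [map_sum] at this
          simp only [if_true]
          rw [Finset.sum_congr rfl (fun j _ => show C (h k i j * d (j, k)) * C (h k l j) =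
            (C (h k i j * h k l j * d (j, k)) : MvPolynomial (ι × ℕ) K) by
              rw [← C_mul]; congr 1; ring), this]
          by_cases hil : i = l
          · subst hil; simp
          · rw [if_neg hil, Pi.single_eq_of_ne (by simpa using Ne.symm hil)]
            simp
        · rw [Pi.single_eq_of_ne (by rintro h; exact hkm (Prod.ext_iff.1 h).2.symm)]
          simp [hkm]
      have h3 : ∀ j, C (h k i j * d (j, k)) * pderiv (j, k) (linSubst h (f * X (l, m))) =
          (C (h k i j * d (j, k)) * pderiv (j, k) (linSubst h f)) * linSubst h (X (l, m)) +
          linSubst h f * (C (h k i j * d (j, k)) * pderiv (j, k) (linSubst h (X (l, m)))) := by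
        intro j
        rw [map_mul (linSubst h), pderiv_mul]
        ring
      simp only [h3]
      rw [Finset.sum_add_distrib, ← Finset.sum_mul, ← Finset.mul_sum, hf, h2, pderiv_mul, map_add,
        map_mul, map_mul]
      ring
  have hcc : ∀ g, constantCoeff (linSubst h g) = constantCoeff g := by
    intro g
    induction g using MvPolynomial.induction_on with
    | C a => simp [linSubst]
    | add f g hf hg => simp only [map_add, hf, hg]
    | mul_X f x hf =>
      obtain ⟨l, m⟩ := x
      rw [map_mul, map_mul, linSubst_X]
      simp
  induction f using MvPolynomial.induction_on generalizing g with
  | C a =>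
    have h0 : linSubst h (C a) = C a := algHom_C _ _
    rw [h0, polyForm_C, polyForm_C, hcc]
  | add f g hf hg => simp only [map_add, LinearMap.add_apply, hf, hg]
  | mul_X f x hf =>
    obtain ⟨i, k⟩ := x
    rw [mul_comm f, polyForm_X_mul, ← hf, map_mul, linSubst_X, Finset.sum_mul, map_sum,
      LinearMap.sum_apply]
    have h4 : ∀ j, polyForm d (C (h k i j) * X (j, k) * linSubst h f) (linSubst h g) =
        polyForm d (linSubst h f) (C (h k i j * d (j, k)) * pderiv (j, k) (linSubst h g)) := by
      intro j
      rw [mul_assoc, ← MvPolynomial.smul_eq_C_mul, map_smul, LinearMap.smul_apply, polyForm_X_mul,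
        ← MvPolynomial.smul_eq_C_mul, map_smul, smul_eq_mul, smul_eq_mul, mul_assoc]
    simp only [h4]
    rw [← map_sum, hD, ← MvPolynomial.smul_eq_C_mul, map_smul, smul_eq_mul]

/-- Multi-partitions as exponent vectors. -/
def multiPtnEquiv (n : ℕ) : MultiPtn n ≃ (Fin n × ℕ →₀ ℕ) :=
  (Equiv.piCongrRight fun _ => ptnEquiv).trans
    (Finsupp.equivFunOnFinite.symm.trans Finsupp.curryEquiv.symm)

theorem multiPtnEquiv_apply {n : ℕ} (lam : MultiPtn n) (i : Fin n) (k : ℕ) :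
    multiPtnEquiv n lam (i, k) = ptnEquiv (lam i) k := by
  simp [multiPtnEquiv]

theorem pBasis_eq_monomial (lam : Ptn) : pBasis K lam = monomial (ptnEquiv lam) 1 := by
  rw [pBasis, Module.Basis.reindex_apply, Equiv.symm_symm, coe_basisMonomials]

theorem prod_rename_pBasis {n : ℕ} (lam : MultiPtn n) :
    ∏ i, rename (Prod.mk i) (pBasis K (lam i)) = monomial (multiPtnEquiv n lam) 1 := by
  simp only [pBasis_eq_monomial, rename_monomial]
  have h : ∀ s : Finset (Fin n), ∏ i ∈ s, monomial ((ptnEquiv (lam i)).mapDomain (Prod.mk i))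
      (1 : K) = monomial (∑ i ∈ s, (ptnEquiv (lam i)).mapDomain (Prod.mk i)) 1 := by
    intro s
    induction s using Finset.induction_on with
    | empty => simp
    | insert i s hi ih =>
      rw [Finset.prod_insert hi, Finset.sum_insert hi, ih, monomial_mul, one_mul]
  rw [h]
  refine congrArg (fun α => monomial α 1) ?_
  ext ⟨j, k⟩
  rw [multiPtnEquiv_apply, Finsupp.finsetSum_apply, Finset.sum_eq_single j]
  · exact Finsupp.mapDomain_apply (Prod.mk_right_injective j) _ _
  · intro i _ hij
    refine Finsupp.mapDomain_of_notMem_range _ _ ?_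
    rintro ⟨x, hx⟩
    exact hij (Prod.ext_iff.1 hx).1
  · intro h; exact absurd (Finset.mem_univ _) h

/-- Products of spanning families in the single alphabets span, since the products of the power
sums do. -/
theorem span_prod_rename {n : ℕ} {f : Fin n → Ptn → MvPolynomial ℕ K}
    (hf : ∀ i, ⊤ ≤ Submodule.span K (Set.range (f i))) :
    ⊤ ≤ Submodule.span K
      (Set.range fun lam : MultiPtn n => ∏ i, rename (Prod.mk i) (f i (lam i))) := by
  -- replace the power sums by the `f i` in one alphabet after the other
  have key : ∀ s : Finset (Fin n), ∀ lam : MultiPtn n,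
      (∏ i, rename (Prod.mk i) (if i ∈ s then pBasis K (lam i) else f i (lam i))) ∈
      Submodule.span K
        (Set.range fun lam : MultiPtn n => ∏ i, rename (Prod.mk i) (f i (lam i))) := by
    intro s
    induction s using Finset.induction_on with
    | empty => exact fun lam => Submodule.subset_span ⟨lam, by simp⟩
    | insert j s hj ih =>
      intro lam
      have hsplit : ∀ y : MvPolynomial ℕ K, ∀ mu : Ptn,
          (∏ i, rename (Prod.mk i) (if i = j then y else
            if i ∈ s then pBasis K (lam i) else f i (lam i))) =
          rename (Prod.mk j) y * ∏ i ∈ Finset.univ.erase j, rename (Prod.mk i)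
            (if i ∈ s then pBasis K (lam i) else f i (lam i)) := by
        intro y mu
        rw [← Finset.mul_prod_erase _ _ (Finset.mem_univ j), if_pos rfl]
        congr 1
        refine Finset.prod_congr rfl fun i hi => ?_
        rw [if_neg (Finset.ne_of_mem_erase hi)]
      have hall : ∀ y : MvPolynomial ℕ K, rename (Prod.mk j) y *
          (∏ i ∈ Finset.univ.erase j, rename (Prod.mk i)
            (if i ∈ s then pBasis K (lam i) else f i (lam i))) ∈ Submodule.span K
          (Set.range fun lam : MultiPtn n => ∏ i, rename (Prod.mk i) (f i (lam i))) := by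
        intro y
        have hy : y ∈ Submodule.span K (Set.range (f j)) := hf j trivial
        induction hy using Submodule.span_induction with
        | mem y hy =>
          obtain ⟨mu, rfl⟩ := hy
          have h1 := ih (Function.update lam j mu)
          rw [← Finset.mul_prod_erase _ _ (Finset.mem_univ j), if_neg hj,
            Function.update_self] at h1
          rw [Finset.prod_congr rfl] at h1
          · exact h1
          · intro i hi
            rw [Function.update_of_ne (Finset.ne_of_mem_erase hi)]
        | zero => rw [map_zero, zero_mul]; exact zero_mem _
        | add x y _ _ h1 h2 => rw [map_add, add_mul]; exact add_mem h1 h2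
        | smul a x _ h => rw [map_smul, smul_mul_assoc]; exact Submodule.smul_mem _ _ h
      have h2 := hall (pBasis K (lam j))
      rw [← Finset.mul_prod_erase _ _ (Finset.mem_univ j), if_pos (Finset.mem_insert_self _ _)]
      rw [Finset.prod_congr rfl] at h2
      · exact h2
      · intro i hi
        simp [Finset.ne_of_mem_erase hi]
  intro F _
  induction F using MvPolynomial.induction_on' with
  | add F G hF hG => exact add_mem (hF trivial) (hG trivial)
  | monomial α a =>
    have h := key Finset.univ ((multiPtnEquiv n).symm α)
    simp only [Finset.mem_univ, if_true] at h
    rw [prod_rename_pBasis, Equiv.apply_symm_apply] at h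
    have h2 := Submodule.smul_mem _ a h
    rwa [smul_monomial, smul_eq_mul, mul_one] at h2

/-- The norm of `p_λ` in the form `z_λ ∏_j u_{λ_j}`. -/
theorem monomialWeight_ptnEquiv (c u : ℕ → K) (hc : ∀ k, c k = ((k : K) + 1) * u (k + 1))
    (lam : Ptn) : monomialWeight c (ptnEquiv lam) = (lam.z : K) * (lam.parts.map u).prod := by
  have hm : (lam.parts.map (· - 1)).map (· + 1) = lam.parts := by
    rw [Multiset.map_map]
    conv_rhs => rw [← Multiset.map_id lam.parts]
    refine Multiset.map_congr rfl fun k hk => ?_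
    have := Ptn.pos_of_mem hk
    simp only [Function.comp_apply, id]
    omega
  have he : ptnEquiv lam = Multiset.toFinsupp (lam.parts.map (· - 1)) := rfl
  generalize lam.parts.map (· - 1) = m at hm he
  rw [he, Ptn.z, ← hm]
  rw [monomialWeight, Finsupp.prod, Multiset.toFinsupp_support, Multiset.map_map,
    Finset.prod_multiset_map_count, Multiset.toFinset_map,
    Finset.prod_image (fun a _ b _ h => Nat.succ_injective h), Nat.cast_prod,
    ← Finset.prod_mul_distrib]
  refine Finset.prod_congr rfl fun k _ => ?_
  rw [Multiset.toFinsupp_apply,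
    Multiset.count_map_eq_count' _ _ (fun a b h => Nat.succ_injective h), hc, mul_pow,
    Function.comp_apply]
  push_cast
  ring

end Several

/-! ### The monomial basis of the multi-symmetric functions -/

section Exponents

/-- The nonzero values of a finitely supported function. -/
def values {α : Type*} (f : α →₀ ℕ) : Multiset ℕ := f.support.val.map f

theorem sum_values {α : Type*} (f : α →₀ ℕ) : (values f).sum = f.degree := rfl

theorem exists_lists_of_map_eq {α β : Type*} [DecidableEq α] [DecidableEq β] (f : α → ℕ)
    (g : β → ℕ) (S : Finset α) : ∀ T : Finset β, S.val.map f = T.val.map g →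
    ∃ (l : List α) (l' : List β), l.Nodup ∧ l'.Nodup ∧ l.toFinset = S ∧ l'.toFinset = T ∧
      l.map f = l'.map g := by
  induction S using Finset.induction_on with
  | empty =>
    intro T h
    have hT : T = ∅ := by
      rw [← Finset.val_eq_zero]
      simpa using h.symm
    exact ⟨[], [], by simp [hT]⟩
  | insert a S ha ih =>
    intro T h
    rw [Finset.insert_val_of_notMem ha, Multiset.map_cons] at h
    have h1 : f a ∈ T.val.map g := by rw [← h]; exact Multiset.mem_cons_self _ _
    obtain ⟨b, hb, hab⟩ := Multiset.mem_map.1 h1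
    have h2 : T.val = b ::ₘ (T.erase b).val := by
      rw [Finset.erase_val, Multiset.cons_erase hb]
    rw [h2, Multiset.map_cons, hab, Multiset.cons_inj_right] at h
    obtain ⟨l, l', hl, hl', hS, hT, hm⟩ := ih _ h
    refine ⟨a :: l, b :: l', ?_, ?_, ?_, ?_, ?_⟩
    · rw [List.nodup_cons, ← List.mem_toFinset, hS]
      exact ⟨ha, hl⟩
    · rw [List.nodup_cons, ← List.mem_toFinset, hT]
      exact ⟨Finset.notMem_erase _ _, hl'⟩
    · rw [List.toFinset_cons, hS]
    · rw [List.toFinset_cons, hT, Finset.insert_erase hb]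
    · rw [List.map_cons, List.map_cons, hab, hm]

/-- Two exponent vectors with the same multiset of exponents differ by a permutation. -/
theorem exists_perm_of_values_eq {f g : ℕ →₀ ℕ} (h : values f = values g) :
    ∃ σ : Equiv.Perm ℕ, ∀ r, g (σ r) = f r := by
  obtain ⟨l, l', hl, hl', hS, hT, hm⟩ := exists_lists_of_map_eq f g f.support g.support h
  have hlen : l.length = l'.length := by simpa using congrArg List.length hm
  obtain ⟨σ, hσ⟩ := Equiv.Perm.exists_extending_pair (fun j : Fin l.length => l.get j)
    (fun j : Fin l.length => l'.get (Fin.cast hlen j)) hl.injective_get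
    (hl'.injective_get.comp (Fin.cast_injective hlen))
  have hval : ∀ j : Fin l.length, f (l.get j) = g (l'.get (Fin.cast hlen j)) := by
    intro j
    have h1 := List.getElem_map f (l := l) (i := j) (h := by simp)
    have h2 := List.getElem_map g (l := l') (i := j) (h := by simp [← hlen])
    simp only [List.get_eq_getElem, Fin.val_cast]
    rw [← h1, ← h2]
    simp only [hm]
  refine ⟨σ, fun r => ?_⟩
  by_cases hr : r ∈ f.support
  · rw [← hS, List.mem_toFinset] at hr
    obtain ⟨j, rfl⟩ := List.get_of_mem hr
    rw [hσ j, hval j]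
  · have hf : f r = 0 := by simpa using hr
    rw [hf]
    by_contra hg
    have hg' : σ r ∈ l' := by
      rw [← List.mem_toFinset, hT]
      simpa using hg
    obtain ⟨j, hj⟩ := List.get_of_mem hg'
    have h3 : σ (l.get (Fin.cast hlen.symm j)) = σ r := by
      rw [hσ, ← hj]
      rfl
    have h4 := σ.injective h3
    apply hr
    rw [← hS, List.mem_toFinset, ← h4]
    exact List.get_mem _ _

variable {n : ℕ}

/-- The exponents of the variables of one alphabet. -/
def row (d : Var n →₀ ℕ) (i : Fin n) : ℕ →₀ ℕ :=
  d.comapDomain (Prod.mk i) (Prod.mk_right_injective i).injOn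

theorem row_apply (d : Var n →₀ ℕ) (i : Fin n) (r : ℕ) : row d i r = d (i, r) := rfl

theorem degree_eq_sum_row (d : Var n →₀ ℕ) : d.degree = ∑ i, (row d i).degree := by
  induction d using Finsupp.induction_linear with
  | zero =>
    have : ∀ i, row (0 : Var n →₀ ℕ) i = 0 := fun i => by ext r; rfl
    simp [this]
  | add f g hf hg =>
    have : ∀ i, row (f + g) i = row f i + row g i := fun i => by
      ext r; rfl
    simp only [this, map_add, Finset.sum_add_distrib, hf, hg]
  | single v k =>
    obtain ⟨j, r⟩ := v
    rw [Finset.sum_eq_single j]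
    · have : row (Finsupp.single (j, r) k) j = Finsupp.single r k := by
        ext x
        rw [row_apply]
        by_cases h : r = x
        · subst h; simp
        · rw [Finsupp.single_eq_of_ne (Ne.symm h),
            Finsupp.single_eq_of_ne (by simpa using Ne.symm h)]
      rw [this]
      simp
    · intro i _ hij
      have : row (Finsupp.single (j, r) k) i = 0 := by
        ext x
        rw [row_apply, Finsupp.single_eq_of_ne (by simp [hij])]
        rfl
      rw [this, map_zero]
    · intro h; exact absurd (Finset.mem_univ _) h

/-- The type of an exponent vector: the partitions formed by the exponents in each alphabet. -/
def expType (d : Var n →₀ ℕ) : MultiPtn n := fun i => Ptn.ofMultiset (values (row d i))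

theorem parts_ofMultiset_values {α : Type*} (f : α →₀ ℕ) :
    (Ptn.ofMultiset (values f)).parts = values f := by
  rw [Ptn.parts_ofMultiset, Multiset.filter_eq_self]
  intro a ha
  obtain ⟨x, hx, rfl⟩ := Multiset.mem_map.1 ha
  exact Finsupp.mem_support_iff.1 hx

/-- The exponent vector of type `μ` with decreasing exponents in each alphabet. -/
def canonExp (mu : MultiPtn n) : Var n →₀ ℕ :=
  Finsupp.curryEquiv.symm (Finsupp.equivFunOnFinite.symm fun i => (mu i).descList.toFinsupp)

theorem canonExp_apply (mu : MultiPtn n) (i : Fin n) (r : ℕ) :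
    canonExp mu (i, r) = (mu i).descList.getD r 0 := by
  simp [canonExp]

theorem row_canonExp (mu : MultiPtn n) (i : Fin n) :
    row (canonExp mu) i = (mu i).descList.toFinsupp := by
  ext r
  rw [row_apply, canonExp_apply, List.toFinsupp_apply]

theorem values_toFinsupp {L : List ℕ} (hL : ∀ a ∈ L, a ≠ 0) : values L.toFinsupp = L := by
  have hs : L.toFinsupp.support = Finset.range L.length := by
    ext r
    rw [Finsupp.mem_support_iff, List.toFinsupp_apply, Finset.mem_range]
    constructor
    · intro h
      by_contra hr
      exact h (List.getD_eq_default _ _ (not_lt.1 hr))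
    · intro hr
      rw [List.getD_eq_getElem _ _ hr]
      exact hL _ (List.getElem_mem hr)
  rw [values, hs, Finset.range_val, Multiset.range, Multiset.map_coe]
  congr 1
  refine List.ext_getElem (by simp) fun i h1 h2 => ?_
  simp [List.getElem?_eq_getElem h2]

theorem values_row_canonExp (mu : MultiPtn n) (i : Fin n) :
    values (row (canonExp mu) i) = (mu i).parts := by
  rw [row_canonExp, values_toFinsupp, Ptn.coe_descList]
  intro a ha
  exact (Ptn.pos_of_mem (lam := mu i) (by rw [← Ptn.coe_descList]; simpa using ha)).ne'

theorem expType_canonExp (mu : MultiPtn n) : expType (canonExp mu) = mu := by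
  funext i
  rw [expType, values_row_canonExp, Ptn.ofMultiset_parts]

theorem degree_row_canonExp (mu : MultiPtn n) (i : Fin n) :
    (row (canonExp mu) i).degree = (mu i).size := by
  rw [← sum_values, values_row_canonExp, Ptn.size_eq_sum]

theorem degree_canonExp (mu : MultiPtn n) : (canonExp mu).degree = mu.size := by
  rw [degree_eq_sum_row, MultiPtn.size]
  exact Finset.sum_congr rfl fun i _ => degree_row_canonExp mu i

theorem exists_permVars_of_expType_eq {d e : Var n →₀ ℕ} (h : expType d = expType e) :
    ∃ σ : Fin n → Equiv.Perm ℕ, d.equivMapDomain (permVars σ) = e := by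
  have h1 : ∀ i, values (row d i) = values (row e i) := by
    intro i
    exact (parts_ofMultiset_values _).symm.trans
      ((congrArg Ptn.parts (congrFun h i)).trans (parts_ofMultiset_values _))
  choose σ hσ using fun i => exists_perm_of_values_eq (h1 i)
  refine ⟨σ, ?_⟩
  ext v
  rw [Finsupp.equivMapDomain_apply]
  obtain ⟨⟨i, r⟩, rfl⟩ := (permVars σ).surjective v
  rw [Equiv.symm_apply_apply]
  exact (hσ i r).symm

end Exponents

section MonomialBasis

variable {K : Type*} [Field K] {n : ℕ}

theorem MultiSym.coeff_eq_of_expType_eq {f : MvPowerSeries (Var n) K} (hf : f ∈ MultiSym K n)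
    {d e : Var n →₀ ℕ} (h : expType d = expType e) :
    MvPowerSeries.coeff d f = MvPowerSeries.coeff e f := by
  obtain ⟨σ, rfl⟩ := exists_permVars_of_expType_eq h
  have h1 := MvPowerSeries.coeff_embDomain_rename (R := K) (permVars σ).toEmbedding f d
  rw [Finsupp.embDomain_eq_mapDomain] at h1
  rw [Finsupp.equivMapDomain_eq_mapDomain, ← h1]
  conv_rhs => rw [← hf.1 σ]
  rfl

/-- Coefficients of products of series in disjoint alphabets. -/
theorem coeff_prod_of_disjoint {F : Fin n → MvPowerSeries (Var n) K}
    (hF : ∀ i d, MvPowerSeries.coeff d (F i) ≠ 0 → ∀ v, d v ≠ 0 → v.1 = i) (s : Finset (Fin n))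
    (d : Var n →₀ ℕ) (hd : ∀ v, d v ≠ 0 → v.1 ∈ s) : MvPowerSeries.coeff d (∏ i ∈ s, F i) =
      ∏ i ∈ s, MvPowerSeries.coeff (d.filter fun v => v.1 = i) (F i) := by
  classical
  induction s using Finset.induction_on generalizing d with
  | empty =>
    have : d = 0 := by
      ext v
      by_contra h
      exact absurd (hd v h) (Finset.notMem_empty _)
    simp [this]
  | insert i s hi ih =>
    have hG : ∀ (s : Finset (Fin n)) (b : Var n →₀ ℕ), MvPowerSeries.coeff b (∏ i ∈ s, F i) ≠ 0 →
        ∀ v, b v ≠ 0 → v.1 ∈ s := by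
      intro s
      induction s using Finset.induction_on with
      | empty =>
        intro b hb v hv
        rw [Finset.prod_empty, MvPowerSeries.coeff_one] at hb
        simp only [ne_eq, ite_eq_right_iff, one_ne_zero, imp_false, not_not] at hb
        rw [hb] at hv
        exact absurd rfl hv
      | insert j s hj ihs =>
        intro b hb v hv
        rw [Finset.prod_insert hj, MvPowerSeries.coeff_mul] at hb
        obtain ⟨p, hp, hne⟩ := Finset.exists_ne_zero_of_sum_ne_zero hb
        rw [Finset.HasAntidiagonal.mem_antidiagonal] at hp
        rw [← hp, Finsupp.add_apply] at hv
        by_cases h1 : p.1 v = 0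
        · exact Finset.mem_insert_of_mem
            (ihs _ (right_ne_zero_of_mul hne) v (fun h2 => hv (by rw [h1, h2])))
        · rw [hF j _ (left_ne_zero_of_mul hne) v h1]
          exact Finset.mem_insert_self _ _
    have hadd : (d.filter fun v => v.1 = i) + (d.filter fun v => ¬ v.1 = i) = d :=
      Finsupp.filter_add_filter_not d _
    rw [Finset.prod_insert hi, Finset.prod_insert hi, MvPowerSeries.coeff_mul,
      Finset.sum_eq_single ((d.filter fun v => v.1 = i), (d.filter fun v => ¬ v.1 = i))]
    · dsimp only
      rw [ih]
      · congr 1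
        refine Finset.prod_congr rfl fun j hj => ?_
        have : (d.filter fun v => ¬ v.1 = i).filter (fun v => v.1 = j) =
            d.filter fun v => v.1 = j := by
          ext v
          simp only [Finsupp.filter_apply]
          by_cases h : v.1 = j
          · have : ¬ v.1 = i := by rintro h'; exact hi (h' ▸ h ▸ hj)
            simp [h]
            intro h3
            exact absurd (h.trans h3) this
          · simp [h]
        rw [this]
      · intro v hv
        have h1 : ¬ v.1 = i := fun h => hv (Finsupp.filter_apply_neg _ _ (by simpa using h))
        rw [Finsupp.filter_apply_pos (fun v : Var n => ¬ v.1 = i) d h1] at hv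
        exact (Finset.mem_insert.1 (hd v hv)).resolve_left h1
    · rintro ⟨a, b⟩ hab hne
      rw [Finset.HasAntidiagonal.mem_antidiagonal] at hab
      by_contra h0
      apply hne
      have ha := hF i a (left_ne_zero_of_mul h0)
      have hb := hG s b (right_ne_zero_of_mul h0)
      dsimp only at hab ha hb
      have hv : ∀ v, a v = d.filter (fun v => v.1 = i) v ∧
          b v = d.filter (fun v => ¬ v.1 = i) v := by
        intro v
        rw [Finsupp.filter_apply, Finsupp.filter_apply, ← hab, Finsupp.add_apply]
        by_cases h : v.1 = i
        · have : b v = 0 := by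
            by_contra h2
            exact hi (h ▸ hb v h2)
          simp [h, this]
        · have : a v = 0 := by
            by_contra h2
            exact h (ha v h2)
          simp [h, this]
      exact Prod.ext (Finsupp.ext fun v => (hv v).1) (Finsupp.ext fun v => (hv v).2)
    · intro h
      exact absurd (Finset.HasAntidiagonal.mem_antidiagonal.2 hadd) h

theorem values_filter (d : Var n →₀ ℕ) (i : Fin n) :
    values (d.filter fun v => v.1 = i) = values (row d i) := by
  classical
  have h : (d.filter fun v => v.1 = i).support =
      (row d i).support.map ⟨Prod.mk i, Prod.mk_right_injective i⟩ := by
    ext ⟨j, r⟩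
    simp only [Finsupp.mem_support_iff, Finsupp.filter_apply, Finset.mem_map, row_apply,
      Function.Embedding.coeFn_mk, Prod.mk.injEq]
    constructor
    · intro h
      by_cases hj : j = i
      · subst hj; exact ⟨r, by simpa using h, rfl, rfl⟩
      · simp [hj] at h
    · rintro ⟨r', h1, rfl, rfl⟩
      simpa using h1
  rw [values, h, Finset.map_val, Multiset.map_map, values]
  refine Multiset.map_congr rfl fun r _ => ?_
  simp [row_apply]

/-- `m_λ` is the sum of all monomials of type `λ`. -/
theorem coeff_multiMonomial (lam : MultiPtn n) (d : Var n →₀ ℕ) [Decidable (expType d = lam)] :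
    MvPowerSeries.coeff d (multiMonomial K lam : MvPowerSeries (Var n) K) =
      if expType d = lam then 1 else 0 := by
  classical
  have hcoeff : ∀ i (e : Var n →₀ ℕ),
      MvPowerSeries.coeff e (monomialSeries K (alphabet i) (lam i)) =
        if (e.support : Set (Var n)) ⊆ alphabet i ∧ e.support.val.map e = (lam i).parts then 1
        else 0 := by
    intro i e
    change (if _ then (1 : K) else 0) = _
    congr
  change MvPowerSeries.coeff d (∏ i, monomialSeries K (alphabet i) (lam i)) = _
  rw [coeff_prod_of_disjoint _ Finset.univ d fun v _ => Finset.mem_univ _]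
  · have h1 : ∀ i, MvPowerSeries.coeff (d.filter fun v => v.1 = i)
        (monomialSeries K (alphabet i) (lam i)) = if expType d i = lam i then 1 else 0 := by
      intro i
      rw [hcoeff]
      have hsub : (((d.filter fun v => v.1 = i).support : Finset (Var n)) : Set (Var n)) ⊆
          alphabet i := by
        intro v hv
        have hv' := Finsupp.mem_support_iff.1 (Finset.mem_coe.1 hv)
        by_contra h
        exact hv' (Finsupp.filter_apply_neg _ _ h)
      have hiff : ((d.filter fun v => v.1 = i).support.val.map (d.filter fun v => v.1 = i) =
          (lam i).parts) ↔ expType d i = lam i := by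
        have h2 := values_filter d i
        rw [values] at h2
        rw [h2, ← parts_ofMultiset_values]
        exact ⟨fun h => Ptn.ext_parts h, fun h => congrArg Ptn.parts h⟩
      simp only [hsub, true_and, hiff]
    rw [Finset.prod_congr rfl fun i _ => h1 i]
    by_cases h : expType d = lam
    · rw [if_pos h, Finset.prod_eq_one]
      intro i _
      rw [if_pos (congrFun h i)]
    · rw [if_neg h]
      obtain ⟨i, hi⟩ := Function.ne_iff.1 h
      exact Finset.prod_eq_zero (Finset.mem_univ i) (if_neg hi)
  · intro i e he v hv
    rw [hcoeff] at he
    by_contra h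
    apply he
    rw [if_neg]
    rintro ⟨h1, -⟩
    exact h (h1 (by simpa using hv))

theorem MultiPtn.finite_size_le (N : ℕ) : {lam : MultiPtn n | lam.size ≤ N}.Finite := by
  have h : {lam : MultiPtn n | lam.size ≤ N} ⊆ Set.pi Set.univ fun _ => {lam | lam.size ≤ N} := by
    intro lam hlam i _
    exact (Finset.single_le_sum (f := fun i => (lam i).size) (fun _ _ => Nat.zero_le _)
      (Finset.mem_univ i)).trans hlam
  exact (Set.Finite.pi' fun _ => Ptn.finite_size_le N).subset fun lam hlam i => h hlam i trivial

theorem MultiSym.coeff_sum_smul {ι : Type*} (s : Finset ι) (a : ι → K) (g : ι → MultiSym K n)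
    (d : Var n →₀ ℕ) :
    MvPowerSeries.coeff d ((∑ i ∈ s, a i • g i : MultiSym K n) : MvPowerSeries (Var n) K) =
      ∑ i ∈ s, a i * MvPowerSeries.coeff d (g i : MvPowerSeries (Var n) K) := by
  change ((MvPowerSeries.coeff (R := K) d).comp (MultiSym K n).val.toLinearMap) _ = _
  rw [map_sum]
  exact Finset.sum_congr rfl fun i _ => map_smul _ _ _

/-- A multi-symmetric function is determined by its coefficients at canonical exponent vectors. -/
theorem MultiSym.mem_span_multiMonomial (f : MultiSym K n) :
    f ∈ Submodule.span K (multiMonomial K ''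
      {mu | MvPowerSeries.coeff (canonExp mu) (f : MvPowerSeries (Var n) K) ≠ 0}) := by
  classical
  obtain ⟨N, hN⟩ := f.2.2
  have hfin : {mu : MultiPtn n |
      MvPowerSeries.coeff (canonExp mu) (f : MvPowerSeries (Var n) K) ≠ 0}.Finite := by
    refine (MultiPtn.finite_size_le N).subset fun mu hmu => ?_
    by_contra h
    exact hmu (hN _ (by rw [degree_canonExp]; exact not_le.1 h))
  have h : f = ∑ mu ∈ hfin.toFinset,
      MvPowerSeries.coeff (canonExp mu) (f : MvPowerSeries (Var n) K) • multiMonomial K mu := by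
    apply Subtype.ext
    ext d
    rw [coeff_sum_smul]
    simp only [coeff_multiMonomial, mul_ite, mul_one, mul_zero]
    rw [Finset.sum_ite_eq]
    have h1 := coeff_eq_of_expType_eq f.2 (expType_canonExp (expType d)).symm
    split_ifs with h2
    · exact h1
    · rw [h1]
      simpa using h2
  have hmem : ∑ mu ∈ hfin.toFinset,
      MvPowerSeries.coeff (canonExp mu) (f : MvPowerSeries (Var n) K) • multiMonomial K mu ∈
      Submodule.span K (multiMonomial K ''
      {mu | MvPowerSeries.coeff (canonExp mu) (f : MvPowerSeries (Var n) K) ≠ 0}) :=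
    Submodule.sum_mem _ fun mu hmu => Submodule.smul_mem _ _
      (Submodule.subset_span ⟨mu, hfin.mem_toFinset.1 hmu, rfl⟩)
  rwa [← h] at hmem

theorem exists_multiMonomial_basis (K : Type*) [Field K] (n : ℕ) :
    ∃ b : Module.Basis (MultiPtn n) K (MultiSym K n), ∀ lam, b lam = multiMonomial K lam := by
  classical
  have hli : LinearIndependent K (multiMonomial K : MultiPtn n → MultiSym K n) := by
    rw [linearIndependent_iff]
    intro l hl
    ext mu
    have h := congrArg (fun f : MultiSym K n => MvPowerSeries.coeff (canonExp mu)
      (f : MvPowerSeries (Var n) K)) hl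
    simp only [Finsupp.linearCombination_apply, Finsupp.sum] at h
    rw [MultiSym.coeff_sum_smul] at h
    simp only [coeff_multiMonomial, mul_ite, mul_one, mul_zero, expType_canonExp] at h
    rw [Finset.sum_ite_eq] at h
    by_contra h0
    rw [if_pos (Finsupp.mem_support_iff.2 h0)] at h
    exact h0 (by simpa using h)
  refine ⟨Module.Basis.mk hli fun f _ => ?_, fun lam => by rw [Module.Basis.mk_apply]⟩
  exact Submodule.span_mono (Set.image_subset_range _ _) (MultiSym.mem_span_multiMonomial f)

end MonomialBasis

/-! ### Leading terms of functions of power sums -/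

section Substitution

variable {K : Type*} [Field K] {σ : Type*}

/-- The series in which only monomials in the variables of `A` occur. -/
def seriesOn (K : Type*) [Field K] {σ : Type*} (A : Set σ) : Subalgebra K (MvPowerSeries σ K) where
  carrier := {f | ∀ d, MvPowerSeries.coeff d f ≠ 0 → ∀ v, d v ≠ 0 → v ∈ A}
  mul_mem' := by
    classical
    intro f g hf hg d hd v hv
    rw [MvPowerSeries.coeff_mul] at hd
    obtain ⟨p, hp, hne⟩ := Finset.exists_ne_zero_of_sum_ne_zero hd
    rw [Finset.HasAntidiagonal.mem_antidiagonal] at hp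
    rw [← hp, Finsupp.add_apply] at hv
    by_cases h : p.1 v = 0
    · exact hg _ (right_ne_zero_of_mul hne) v fun h' => hv (by rw [h, h'])
    · exact hf _ (left_ne_zero_of_mul hne) v h
  add_mem' := by
    intro f g hf hg d hd v hv
    by_cases h : MvPowerSeries.coeff d f = 0
    · refine hg d (fun h' => hd ?_) v hv
      rw [map_add, h, h', add_zero]
    · exact hf d h v hv
  algebraMap_mem' := by
    classical
    intro r d hd v hv
    rw [MvPowerSeries.algebraMap_apply, MvPowerSeries.coeff_C] at hd
    split_ifs at hd with h
    · rw [h] at hv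
      exact absurd rfl hv
    · exact absurd rfl hd

theorem X_pow_mem_seriesOn {A : Set σ} {v : σ} (hv : v ∈ A) (k : ℕ) :
    (MvPowerSeries.X v ^ k : MvPowerSeries σ K) ∈ seriesOn K A := by
  classical
  intro d hd w hw
  rw [MvPowerSeries.coeff_X_pow] at hd
  split_ifs at hd with h
  · rw [h, Finsupp.single_apply] at hw
    split_ifs at hw with h'
    · exact h' ▸ hv
    · exact absurd rfl hw
  · exact absurd rfl hd

theorem aeval_mem {R : Subalgebra K (MvPowerSeries σ K)} {τ : Type*} {y : τ → MvPowerSeries σ K}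
    (hy : ∀ k, y k ∈ R) (f : MvPolynomial τ K) : MvPolynomial.aeval y f ∈ R := by
  induction f using MvPolynomial.induction_on with
  | C a => rw [MvPolynomial.algHom_C]; exact R.algebraMap_mem a
  | add f g hf hg => rw [map_add]; exact R.add_mem hf hg
  | mul_X f k hf => rw [map_mul, MvPolynomial.aeval_X]; exact R.mul_mem hf (hy k)

/-- If `f` is free of `v`, then the exponent of `v` in `f v^m` is `m`. -/
theorem coeff_mul_X_pow_of_mem {v : σ} {f : MvPowerSeries σ K} (hf : f ∈ seriesOn K {v}ᶜ) (m : ℕ)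
    (d : σ →₀ ℕ) : MvPowerSeries.coeff d (f * MvPowerSeries.X v ^ m) =
      if m = d v then MvPowerSeries.coeff (d.erase v) f else 0 := by
  classical
  rw [MvPowerSeries.X_pow_eq, MvPowerSeries.coeff_mul_monomial, mul_one]
  by_cases h : m = d v
  · subst h
    rw [if_pos rfl, if_pos]
    · refine congrArg (fun e => MvPowerSeries.coeff e f) (Finsupp.ext fun w => ?_)
      rw [Finsupp.tsub_apply, Finsupp.erase_apply]
      split_ifs with hw
      · rw [hw, Finsupp.single_eq_same, Nat.sub_self]
      · rw [Finsupp.single_eq_of_ne hw, Nat.sub_zero]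
    · rw [Finsupp.single_le_iff]
  · rw [if_neg h]
    split_ifs with h1
    · rw [Finsupp.single_le_iff] at h1
      by_contra h2
      refine hf _ h2 v ?_ rfl
      rw [Finsupp.tsub_apply, Finsupp.single_eq_same]
      omega
    · rfl

theorem aeval_X_pow_add (v : σ) (W : ℕ → MvPowerSeries σ K) (f : MvPolynomial ℕ K) :
    MvPolynomial.aeval (fun k => (MvPowerSeries.X v ^ (k + 1) + W k : MvPowerSeries σ K)) f =
      ∑ m ∈ (translate (fun _ => 1) f).support,
        MvPolynomial.aeval W ((translate (fun _ => 1) f).coeff m) * MvPowerSeries.X v ^ m := by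
  have h : ∀ f : MvPolynomial ℕ K,
      MvPolynomial.aeval (fun k => (MvPowerSeries.X v ^ (k + 1) + W k : MvPowerSeries σ K)) f =
      Polynomial.eval₂ (MvPolynomial.aeval W : MvPolynomial ℕ K →ₐ[K] MvPowerSeries σ K).toRingHom
        (MvPowerSeries.X v) (translate (fun _ => 1) f) := by
    intro f
    induction f using MvPolynomial.induction_on with
    | C a =>
      rw [MvPolynomial.algHom_C, translate_C, Polynomial.eval₂_C]
      exact (MvPolynomial.algHom_C _ a).symm
    | add f g hf hg => rw [map_add, map_add, Polynomial.eval₂_add, hf, hg]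
    | mul_X f k hf =>
      rw [map_mul, map_mul, Polynomial.eval₂_mul, hf, MvPolynomial.aeval_X, translate_X,
        Polynomial.eval₂_add, Polynomial.eval₂_mul, Polynomial.eval₂_C, Polynomial.eval₂_C,
        Polynomial.eval₂_pow, Polynomial.eval₂_X]
      congr 1
      change _ = MvPolynomial.aeval W (MvPolynomial.X k) + MvPolynomial.aeval W 1 * _
      rw [MvPolynomial.aeval_X, map_one, one_mul, add_comm]
  rw [h, Polynomial.eval₂_eq_sum, Polynomial.sum]
  rfl

/-- Splitting off one variable from an alphabet is a translation of the power sums. -/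
theorem coeff_aeval_X_pow_add {v : σ} {W : ℕ → MvPowerSeries σ K} (hW : ∀ k, W k ∈ seriesOn K {v}ᶜ)
    (f : MvPolynomial ℕ K) (d : σ →₀ ℕ) :
    MvPowerSeries.coeff d
      (MvPolynomial.aeval (fun k => (MvPowerSeries.X v ^ (k + 1) + W k : MvPowerSeries σ K)) f) =
    MvPowerSeries.coeff (d.erase v)
      (MvPolynomial.aeval W ((translate (fun _ => 1) f).coeff (d v))) := by
  classical
  rw [aeval_X_pow_add, map_sum,
    Finset.sum_congr rfl fun m _ => coeff_mul_X_pow_of_mem (aeval_mem hW _) m d, Finset.sum_ite_eq']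
  split_ifs with h
  · rfl
  · rw [Polynomial.notMem_support_iff.1 h, map_zero, map_zero]

/-- Iterated splitting of variables: coefficients of monomials in the variables `vs` are computed
by `varCoeff`. -/
theorem coeff_aeval_sum_X_pow_add [DecidableEq σ] {vs : List σ} (hvs : vs.Nodup)
    {W : ℕ → MvPowerSeries σ K} (hW : ∀ k, W k ∈ seriesOn K {v | v ∉ vs})
    (f : MvPolynomial ℕ K) (d : σ →₀ ℕ) :
    MvPowerSeries.coeff d (MvPolynomial.aeval (fun k =>
      ((vs.map fun v => MvPowerSeries.X v ^ (k + 1)).sum + W k : MvPowerSeries σ K)) f) =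
    MvPowerSeries.coeff (d.filter fun v => v ∉ vs)
      (MvPolynomial.aeval W (varCoeff (vs.map d) f)) := by
  induction vs generalizing f d with
  | nil =>
    have : d.filter (fun v => v ∉ ([] : List σ)) = d :=
      Finsupp.filter_eq_self_iff _ _ |>.2 (by simp)
    rw [this]
    simp [varCoeff]
  | cons v vs ih =>
    rw [List.nodup_cons] at hvs
    have hW' : ∀ k, ((vs.map fun v => MvPowerSeries.X v ^ (k + 1)).sum + W k : MvPowerSeries σ K) ∈
        seriesOn K {v}ᶜ := by
      intro k
      refine Subalgebra.add_mem _ (Subalgebra.list_sum_mem _ fun g hg => ?_) ?_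
      · obtain ⟨w, hw, rfl⟩ := List.mem_map.1 hg
        exact X_pow_mem_seriesOn (by rintro rfl; exact hvs.1 hw) _
      · intro e he w hw
        have := hW k e he w hw
        rw [Set.mem_ofPred_eq, List.mem_cons, not_or] at this
        exact this.1
    have h1 : (fun k => (((v :: vs).map fun v => MvPowerSeries.X v ^ (k + 1)).sum + W k :
        MvPowerSeries σ K)) = fun k => MvPowerSeries.X v ^ (k + 1) +
          ((vs.map fun v => MvPowerSeries.X v ^ (k + 1)).sum + W k) := by
      funext k
      rw [List.map_cons, List.sum_cons, add_assoc]
    rw [h1, coeff_aeval_X_pow_add hW', ih hvs.2]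
    · have h2 : (d.erase v).filter (fun w => w ∉ vs) = d.filter fun w => w ∉ v :: vs := by
        ext w
        simp only [Finsupp.filter_apply, Finsupp.erase_apply, List.mem_cons, not_or]
        by_cases h : w = v <;> simp [h]
      have h3 : vs.map (d.erase v) = vs.map d := by
        refine List.map_congr_left fun w hw => Finsupp.erase_ne ?_
        rintro rfl
        exact hvs.1 hw
      rw [h2, h3]
      rfl
    · intro k e he w hw
      have := hW k e he w hw
      rw [Set.mem_ofPred_eq, List.mem_cons, not_or] at this
      exact this.2

theorem isHomogeneous_aeval {y : ℕ → MvPowerSeries σ K}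
    (hy : ∀ k, (y k).IsHomogeneous (k + 1)) {f : MvPolynomial ℕ K} {m : ℕ}
    (hf : MvPolynomial.IsWeightedHomogeneous pWeight f m) :
    (MvPolynomial.aeval y f).IsHomogeneous m := by
  classical
  have hprod : ∀ (s : Finset ℕ) (α : ℕ → ℕ),
      (∏ k ∈ s, y k ^ α k).IsHomogeneous (∑ k ∈ s, α k * (k + 1)) := by
    intro s α
    induction s using Finset.induction_on with
    | empty =>
      intro d hd
      rw [Finset.prod_empty, MvPowerSeries.coeff_one] at hd
      split_ifs at hd with h
      · rw [h]; simp
      · exact absurd rfl hd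
    | insert k s hk ih =>
      rw [Finset.prod_insert hk, Finset.sum_insert hk]
      refine MvPowerSeries.IsHomogeneous.mul ?_ ih
      generalize α k = a
      induction a with
      | zero =>
        intro d hd
        rw [pow_zero, MvPowerSeries.coeff_one] at hd
        split_ifs at hd with h
        · rw [h]; simp
        · exact absurd rfl hd
      | succ a ih =>
        rw [pow_succ, Nat.succ_mul]
        exact ih.mul (hy k)
  intro d hd
  rw [MvPolynomial.aeval_def, MvPolynomial.eval₂_eq, map_sum] at hd
  obtain ⟨α, hα, hne⟩ := Finset.exists_ne_zero_of_sum_ne_zero hd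
  rw [← MvPowerSeries.c_eq_algebraMap, MvPowerSeries.coeff_C_mul] at hne
  have h1 := hprod α.support α (right_ne_zero_of_mul hne)
  have h2 := hf (MvPolynomial.mem_support_iff.1 hα)
  rw [Finsupp.weight_apply, Finsupp.sum] at h2
  rw [h1, ← h2]
  rfl

end Substitution

section Dominance

variable {K : Type*} [Field K] {n : ℕ}

/-- The linear function of exponent vectors whose values at canonical exponent vectors are the
sums compared in the dominance ordering. -/
def domWeight (k : Fin n) (j : ℕ) : (Var n →₀ ℕ) →+ ℕ where
  toFun d := ∑ i ∈ Finset.univ.filter (· < k), (row d i).degree + ∑ r ∈ Finset.range j, d (k, r)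
  map_zero' := by
    have : ∀ i, row (0 : Var n →₀ ℕ) i = 0 := fun i => by ext r; rfl
    simp [this]
  map_add' d e := by
    have : ∀ i, row (d + e) i = row d i + row e i := fun i => by ext r; rfl
    simp only [this, map_add, Finset.sum_add_distrib, Finsupp.add_apply]
    ring

theorem domWeight_apply (k : Fin n) (j : ℕ) (d : Var n →₀ ℕ) : domWeight k j d =
    ∑ i ∈ Finset.univ.filter (· < k), (row d i).degree + ∑ r ∈ Finset.range j, d (k, r) := rfl

theorem sum_range_le_degree (f : ℕ →₀ ℕ) (j : ℕ) : ∑ r ∈ Finset.range j, f r ≤ f.degree := by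
  classical
  rw [Finsupp.degree_apply]
  refine (Finset.sum_le_sum_of_ne_zero fun r _ hr => ?_)
  exact Finsupp.mem_support_iff.2 hr

theorem domWeight_le_degree (k : Fin n) (j : ℕ) (d : Var n →₀ ℕ) : domWeight k j d ≤ d.degree := by
  rw [domWeight_apply, degree_eq_sum_row,
    ← Finset.sum_filter_add_sum_filter_not Finset.univ (· < k)]
  refine Nat.add_le_add_left ((sum_range_le_degree (row d k) j).trans ?_) _
  exact Finset.single_le_sum (f := fun i => (row d i).degree) (fun _ _ => Nat.zero_le _) (by simp)

theorem sum_range_descList (lam : Ptn) (j : ℕ) :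
    ∑ r ∈ Finset.range j, lam.descList.getD r 0 = lam.partialSum j := by
  rw [Ptn.partialSum_eq]
  induction lam.descList generalizing j with
  | nil => simp
  | cons a l ih =>
    cases j with
    | zero => simp
    | succ j => rw [Finset.sum_range_succ', List.take_succ_cons, List.sum_cons, ← ih, add_comm]; rfl

theorem domWeight_canonExp (k : Fin n) (j : ℕ) (mu : MultiPtn n) : domWeight k j (canonExp mu) =
    ∑ i ∈ Finset.univ.filter (· < k), (mu i).size + (mu k).partialSum j := by
  rw [domWeight_apply]
  simp only [degree_row_canonExp, canonExp_apply, sum_range_descList]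

/-- The part of the canonical exponent vector that lies in one alphabet. -/
def canonPart (lam : MultiPtn n) (i : Fin n) : Var n →₀ ℕ :=
  (canonExp lam).filter fun v => v.1 = i

theorem canonPart_apply (lam : MultiPtn n) (i : Fin n) (v : Var n) :
    canonPart lam i v = if v.1 = i then (lam i).descList.getD v.2 0 else 0 := by
  rw [canonPart, Finsupp.filter_apply]
  split_ifs with h
  · obtain ⟨j, r⟩ := v
    obtain rfl : j = i := h
    exact canonExp_apply _ _ _
  · rfl

theorem sum_canonPart (lam : MultiPtn n) : ∑ i, canonPart lam i = canonExp lam := by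
  ext v
  rw [Finsupp.finsetSum_apply]
  simp only [canonPart_apply]
  rw [Finset.sum_ite_eq Finset.univ v.1, if_pos (Finset.mem_univ _)]
  exact (canonExp_apply _ _ _).symm

/-- The conditions on the factors of a product which make its leading monomial symmetric function
that of the multi-partition `λ`. -/
structure HasLeading (F : Fin n → MvPowerSeries (Var n) K) (lam : MultiPtn n) : Prop where
  le_of_coeff : ∀ i d, MvPowerSeries.coeff d (F i) ≠ 0 → ∀ v, d v ≠ 0 → i ≤ v.1
  homogeneous : ∀ i, (F i).IsHomogeneous (lam i).size
  sum_le : ∀ i d, MvPowerSeries.coeff d (F i) ≠ 0 → ∀ j,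
    ∑ r ∈ Finset.range j, d (i, r) ≤ (lam i).partialSum j
  coeff_canonPart : ∀ i, MvPowerSeries.coeff (canonPart lam i) (F i) = 1

variable {F : Fin n → MvPowerSeries (Var n) K} {lam : MultiPtn n}

theorem HasLeading.degree_eq (h : HasLeading F lam) {i : Fin n} {d : Var n →₀ ℕ}
    (hd : MvPowerSeries.coeff d (F i) ≠ 0) : d.degree = (lam i).size := by
  rw [← h.homogeneous i hd, Finsupp.degree_eq_weight_one]
  rfl

/-- The weight of a monomial of the `i`-th factor is bounded by the contribution of `λ^{(i)}` to the
sum compared in the dominance ordering. -/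
theorem HasLeading.domWeight_le (h : HasLeading F lam) {i : Fin n} {d : Var n →₀ ℕ}
    (hd : MvPowerSeries.coeff d (F i) ≠ 0) (k : Fin n) (j : ℕ) : domWeight k j d ≤
      if i < k then (lam i).size else if i = k then (lam k).partialSum j else 0 := by
  have hz : ∀ v : Var n, v.1 < i → d v = 0 := fun v hv => by
    by_contra h0
    exact absurd (h.le_of_coeff i d hd v h0) (not_le.2 hv)
  split_ifs with h1 h2
  · exact (domWeight_le_degree k j d).trans (h.degree_eq hd).le
  all_goals
    have hrow : ∑ i' ∈ Finset.univ.filter (· < k), (row d i').degree = 0 := by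
      refine Finset.sum_eq_zero fun i' hi' => ?_
      have : row d i' = 0 := by
        ext r
        exact hz (i', r) (lt_of_lt_of_le (Finset.mem_filter.1 hi').2 (not_lt.1 h1))
      rw [this, map_zero]
    rw [domWeight_apply, hrow, zero_add]
  · subst h2
    exact h.sum_le _ d hd j
  · refine (Finset.sum_eq_zero fun r _ => hz (k, r) ?_).le
    exact lt_of_le_of_ne (not_lt.1 h1) (Ne.symm h2)

theorem sum_ite_lt (a : Fin n → ℕ) (b : ℕ) (k : Fin n) :
    ∑ i, (if i < k then a i else if i = k then b else 0) =
      ∑ i ∈ Finset.univ.filter (· < k), a i + b := by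
  classical
  have h : ∀ i, (if i < k then a i else if i = k then b else 0) =
      (if i < k then a i else 0) + if i = k then b else 0 := by
    intro i
    split_ifs with h1 h2 h3
    · exact absurd h2 h1.ne
    · rfl
    · exact (zero_add _).symm
    · rfl
  rw [Finset.sum_congr rfl fun i _ => h i, Finset.sum_add_distrib, Finset.sum_filter,
    Finset.sum_ite_eq' Finset.univ k, if_pos (Finset.mem_univ _)]

theorem exists_of_coeff_prod_ne_zero {ι σ : Type*} [Fintype ι] {F : ι → MvPowerSeries σ K}
    {d : σ →₀ ℕ} (hd : MvPowerSeries.coeff d (∏ i, F i) ≠ 0) :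
    ∃ l : ι → σ →₀ ℕ, ∑ i, l i = d ∧ ∀ i, MvPowerSeries.coeff (l i) (F i) ≠ 0 := by
  classical
  rw [MvPowerSeries.coeff_prod] at hd
  obtain ⟨l, hl, hne⟩ := Finset.exists_ne_zero_of_sum_ne_zero hd
  exact ⟨l, (Finset.mem_finsuppAntidiag.1 hl).1, fun i => Finset.prod_ne_zero_iff.1 hne i
    (Finset.mem_univ i)⟩

theorem HasLeading.dominated (h : HasLeading F lam) {mu : MultiPtn n}
    (hmu : MvPowerSeries.coeff (canonExp mu) (∏ i, F i) ≠ 0) : Dominated mu lam := by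
  obtain ⟨l, hl, hne⟩ := exists_of_coeff_prod_ne_zero hmu
  intro k j
  rw [← domWeight_canonExp, ← hl, map_sum, ← sum_ite_lt]
  exact Finset.sum_le_sum fun i _ => h.domWeight_le (hne i) k j

theorem HasLeading.homogeneous_prod (h : HasLeading F lam) :
    (∏ i, F i).IsHomogeneous lam.size := by
  intro d hd
  obtain ⟨l, hl, hne⟩ := exists_of_coeff_prod_ne_zero hd
  rw [← hl, map_sum]
  exact Finset.sum_congr rfl fun i _ => h.homogeneous i (hne i)

/-- The canonical monomial of `λ` arises in the product in only one way. -/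
theorem HasLeading.eq_canonPart (h : HasLeading F lam) {l : Fin n → Var n →₀ ℕ}
    (hl : ∑ i, l i = canonExp lam) (hne : ∀ i, MvPowerSeries.coeff (l i) (F i) ≠ 0) (k : Fin n) :
    l k = canonPart lam k := by
  -- The total weights agree, so all the inequalities between the weights are equalities.
  have hw : ∀ j, ∑ r ∈ Finset.range j, l k (k, r) = (lam k).partialSum j := by
    intro j
    have h1 : ∑ i, domWeight k j (l i) =
        ∑ i, if i < k then (lam i).size else if i = k then (lam k).partialSum j else 0 := by
      rw [sum_ite_lt, ← map_sum, hl, domWeight_canonExp]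
    have h2 := (Finset.sum_eq_sum_iff_of_le fun i _ => h.domWeight_le (hne i) k j).1 h1 k
      (Finset.mem_univ k)
    rw [if_neg (lt_irrefl k), if_pos rfl, domWeight_apply] at h2
    have hrow : ∑ i' ∈ Finset.univ.filter (· < k), (row (l k) i').degree = 0 := by
      refine Finset.sum_eq_zero fun i' hi' => ?_
      have : row (l k) i' = 0 := by
        ext r
        by_contra h0
        exact absurd (h.le_of_coeff k _ (hne k) (i', r) h0) (not_le.2 (Finset.mem_filter.1 hi').2)
      rw [this, map_zero]
    rw [← h2, hrow, zero_add]
  have hval : ∀ r, l k (k, r) = (lam k).descList.getD r 0 := by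
    intro r
    have h1 := hw (r + 1)
    rw [Finset.sum_range_succ, hw r, ← sum_range_descList, ← sum_range_descList,
      Finset.sum_range_succ] at h1
    exact Nat.add_left_cancel h1
  ext ⟨i, r⟩
  rw [canonPart_apply]
  split_ifs with hi
  · obtain rfl : i = k := hi
    exact hval r
  · have h1 := h.degree_eq (hne k)
    rw [degree_eq_sum_row, ← Finset.add_sum_erase _ _ (Finset.mem_univ k)] at h1
    have h2 : row (l k) k = (lam k).descList.toFinsupp := by
      ext r
      rw [row_apply, hval, List.toFinsupp_apply]
    rw [h2, ← row_canonExp, degree_row_canonExp, Nat.add_eq_left, Finset.sum_eq_zero_iff] at h1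
    have h3 := h1 i (Finset.mem_erase.2 ⟨hi, Finset.mem_univ _⟩)
    rw [Finsupp.degree_eq_zero_iff] at h3
    exact DFunLike.congr_fun h3 r

theorem HasLeading.coeff_canonExp (h : HasLeading F lam) :
    MvPowerSeries.coeff (canonExp lam) (∏ i, F i) = 1 := by
  classical
  rw [MvPowerSeries.coeff_prod, Finset.sum_eq_single
    (Finsupp.equivFunOnFinite.symm (canonPart lam))]
  · exact Finset.prod_eq_one fun i _ => h.coeff_canonPart i
  · intro l hl hne
    by_contra h0
    apply hne
    ext1 i
    exact h.eq_canonPart (Finset.mem_finsuppAntidiag.1 hl).1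
      (fun i => Finset.prod_ne_zero_iff.1 h0 i (Finset.mem_univ i)) i
  · intro hn
    refine absurd (Finset.mem_finsuppAntidiag.2 ⟨?_, Finset.subset_univ _⟩) hn
    exact sum_canonPart lam

theorem HasLeading.sub_mem (h : HasLeading F lam) {f : MultiSym K n}
    (hf : (f : MvPowerSeries (Var n) K) = ∏ i, F i) : f - multiMonomial K lam ∈
      Submodule.span K (multiMonomial K '' {mu | Dominated mu lam ∧ mu ≠ lam}) := by
  classical
  refine Submodule.span_mono (Set.image_mono fun mu hmu => ?_)
    (MultiSym.mem_span_multiMonomial (f - multiMonomial K lam))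
  rw [Set.mem_ofPred_eq, Subalgebra.coe_sub, map_sub, coeff_multiMonomial, expType_canonExp, hf]
    at hmu
  have hne : mu ≠ lam := by
    rintro rfl
    apply hmu
    rw [h.coeff_canonExp, if_pos rfl, sub_self]
  rw [if_neg hne, sub_zero] at hmu
  exact ⟨h.dominated hmu, hne⟩

end Dominance

/-! ### Power sums in alphabets -/

section PowerSums

variable {K : Type*} [Field K] {n : ℕ}

theorem coeff_powerSumSeries (A : Set (Var n)) (k : ℕ) (d : Var n →₀ ℕ)
    [Decidable (∃ v ∈ A, d = Finsupp.single v k)] :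
    MvPowerSeries.coeff d (powerSumSeries K A k) =
      if ∃ v ∈ A, d = Finsupp.single v k then 1 else 0 := by
  by_cases h : ∃ v ∈ A, d = Finsupp.single v k
  · rw [if_pos h]
    exact if_pos h
  · rw [if_neg h]
    exact if_neg h

theorem powerSumSeries_mem_seriesOn (A : Set (Var n)) (k : ℕ) :
    powerSumSeries K A k ∈ seriesOn K A := by
  classical
  intro d hd w hw
  rw [coeff_powerSumSeries] at hd
  split_ifs at hd with h
  · obtain ⟨v, hv, rfl⟩ := h
    rw [Finsupp.single_apply] at hw
    split_ifs at hw with h'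
    · exact h' ▸ hv
    · exact absurd rfl hw
  · exact absurd rfl hd

theorem isHomogeneous_powerSumSeries (A : Set (Var n)) (k : ℕ) :
    (powerSumSeries K A k).IsHomogeneous k := by
  classical
  intro d hd
  rw [coeff_powerSumSeries] at hd
  split_ifs at hd with h
  · obtain ⟨v, hv, rfl⟩ := h
    rw [Finsupp.weight_single, Pi.one_apply, smul_eq_mul, mul_one]
  · exact absurd rfl hd

theorem powerSumSeries_union {A B : Set (Var n)} (h : Disjoint A B) (k : ℕ) :
    powerSumSeries K (A ∪ B) (k + 1) =
      powerSumSeries K A (k + 1) + powerSumSeries K B (k + 1) := by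
  classical
  ext d
  rw [map_add]
  simp only [coeff_powerSumSeries]
  by_cases hd : ∃ v, d = Finsupp.single v (k + 1)
  · obtain ⟨v, rfl⟩ := hd
    have h1 : ∀ C : Set (Var n),
        (∃ w ∈ C, Finsupp.single v (k + 1) = Finsupp.single w (k + 1)) ↔ v ∈ C := by
      intro C
      constructor
      · rintro ⟨w, hw, h2⟩
        rw [Finsupp.single_left_inj (Nat.succ_ne_zero k)] at h2
        exact h2 ▸ hw
      · exact fun hv => ⟨v, hv, rfl⟩
    simp only [h1]
    simp only [Set.mem_union]
    by_cases hA : v ∈ A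
    · simp [hA, Set.disjoint_left.1 h hA]
    · simp [hA]
  · have h1 : ∀ C : Set (Var n), ¬ ∃ w ∈ C, d = Finsupp.single w (k + 1) :=
      fun C ⟨w, _, hw⟩ => hd ⟨w, hw⟩
    simp only [h1, if_false, add_zero]

theorem sum_X_pow_eq_powerSumSeries {vs : List (Var n)} (hvs : vs.Nodup) (k : ℕ) :
    (vs.map fun v => (MvPowerSeries.X v ^ (k + 1) : MvPowerSeries (Var n) K)).sum =
      powerSumSeries K {v | v ∈ vs} (k + 1) := by
  classical
  induction vs with
  | nil =>
    ext d
    simp [coeff_powerSumSeries]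
  | cons v vs ih =>
    rw [List.nodup_cons] at hvs
    have h1 : {w | w ∈ v :: vs} = {v} ∪ {w | w ∈ vs} := by
      ext w
      simp
    have h2 : (MvPowerSeries.X v ^ (k + 1) : MvPowerSeries (Var n) K) =
        powerSumSeries K {v} (k + 1) := by
      ext d
      rw [MvPowerSeries.coeff_X_pow, coeff_powerSumSeries]
      simp
    rw [List.map_cons, List.sum_cons, ih hvs.2, h1, powerSumSeries_union, h2]
    exact Set.disjoint_singleton_left.2 hvs.1

/-- The power sum `p_{k+1}` of one alphabet as a multi-symmetric function. -/
def alphabetSum (K : Type*) [Field K] (i : Fin n) (k : ℕ) : MultiSym K n :=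
  ⟨powerSumSeries K (alphabet i) (k + 1), powerSumSeries_mem (stable_alphabet i) _⟩

/-- The linear combinations `∑_j e_{ij} p_{k+1}(x^{(j)})` of power sums of the alphabets, with
coefficients that may depend on `k`. -/
def flagSum (e : ℕ → Fin n → Fin n → K) (i : Fin n) (k : ℕ) : MultiSym K n :=
  ∑ j, e k i j • alphabetSum K j k

/-- The homomorphism that sends the variable `(i, k)` to `flagSum e i k`. -/
def flagHom (e : ℕ → Fin n → Fin n → K) : MvPolynomial (Fin n × ℕ) K →ₐ[K] MultiSym K n :=
  MvPolynomial.aeval fun v => flagSum e v.1 v.2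

theorem coe_flagHom_rename (e : ℕ → Fin n → Fin n → K) (i : Fin n) (f : MvPolynomial ℕ K) :
    (flagHom e (MvPolynomial.rename (Prod.mk i) f) : MvPowerSeries (Var n) K) =
      MvPolynomial.aeval (fun k => (flagSum e i k : MvPowerSeries (Var n) K)) f := by
  rw [flagHom, MvPolynomial.aeval_rename]
  exact MvPolynomial.comp_aeval_apply (φ := (MultiSym K n).val) (f := fun k => flagSum e i k) f

theorem coe_flagSum (e : ℕ → Fin n → Fin n → K) (i : Fin n) (k : ℕ) :
    (flagSum e i k : MvPowerSeries (Var n) K) =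
      ∑ j, e k i j • powerSumSeries K (alphabet j) (k + 1) := by
  change (MultiSym K n).val (flagSum e i k) = _
  rw [flagSum, map_sum]
  rfl

variable {e : ℕ → Fin n → Fin n → K}

theorem flagSum_mem_seriesOn (he0 : ∀ k i j, j < i → e k i j = 0) (i : Fin n) (k : ℕ) :
    (flagSum e i k : MvPowerSeries (Var n) K) ∈ seriesOn K {v | i ≤ v.1} := by
  rw [coe_flagSum]
  refine Subalgebra.sum_mem _ fun j _ => ?_
  rcases lt_or_ge j i with h | h
  · rw [he0 k i j h, zero_smul]
    exact Subalgebra.zero_mem _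
  · refine Subalgebra.smul_mem _ (fun d hd v hv => ?_) _
    have : v.1 = j := powerSumSeries_mem_seriesOn (alphabet j) (k + 1) d hd v hv
    exact h.trans_eq this.symm

theorem isHomogeneous_flagSum (i : Fin n) (k : ℕ) :
    MvPowerSeries.IsHomogeneous (flagSum e i k : MvPowerSeries (Var n) K) (k + 1) := by
  rw [coe_flagSum]
  intro d hd
  rw [map_sum] at hd
  obtain ⟨j, -, hj⟩ := Finset.exists_ne_zero_of_sum_ne_zero hd
  refine isHomogeneous_powerSumSeries (K := K) (alphabet j) (k + 1) fun h => hj ?_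
  rw [map_smul, h, smul_zero]

/-- Separating the first `m` variables of the alphabet `x^{(i)}`. -/
theorem exists_flagSum_eq_sum_X_pow_add (he1 : ∀ k i, e k i i = 1)
    (i : Fin n) (m : ℕ) :
    ∃ W : ℕ → MvPowerSeries (Var n) K,
      (∀ k, W k ∈ seriesOn K {v | v ∉ (List.range m).map (Prod.mk i)}) ∧
      (∀ k, MvPowerSeries.constantCoeff (W k) = 0) ∧
      ∀ k, (flagSum e i k : MvPowerSeries (Var n) K) =
        (((List.range m).map (Prod.mk i)).map fun v => MvPowerSeries.X v ^ (k + 1)).sum + W k := by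
  classical
  set vs : List (Var n) := (List.range m).map (Prod.mk i) with hvs
  have hnd : vs.Nodup := List.nodup_range.map (Prod.mk_right_injective i)
  have hfst : ∀ v ∈ vs, v.1 = i := by
    intro v hv
    obtain ⟨r, -, rfl⟩ := List.mem_map.1 hv
    rfl
  have hsplit : ∀ k, powerSumSeries K (alphabet i) (k + 1) =
      powerSumSeries K {v | v ∈ vs} (k + 1) +
        powerSumSeries K (alphabet i \ {v | v ∈ vs}) (k + 1) := by
    intro k
    rw [← powerSumSeries_union Set.disjoint_sdiff_right, Set.union_sdiff_cancel]
    exact fun v hv => hfst v hv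
  refine ⟨fun k => powerSumSeries K (alphabet i \ {v | v ∈ vs}) (k + 1) +
    ∑ j ∈ Finset.univ.erase i, e k i j • powerSumSeries K (alphabet j) (k + 1), fun k => ?_,
    fun k => ?_, fun k => ?_⟩
  · refine Subalgebra.add_mem _ (fun d hd v hv => ?_) (Subalgebra.sum_mem _ fun j hj => ?_)
    · exact (powerSumSeries_mem_seriesOn _ _ d hd v hv).2
    · refine Subalgebra.smul_mem _ (fun d hd v hv hmem => ?_) _
      have h1 : v.1 = j := powerSumSeries_mem_seriesOn (alphabet j) (k + 1) d hd v hv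
      exact (Finset.mem_erase.1 hj).1 (h1.symm.trans (hfst v hmem))
  · have h0 : ∀ A : Set (Var n), MvPowerSeries.coeff 0 (powerSumSeries K A (k + 1)) = 0 := by
      intro A
      by_contra h
      simpa using isHomogeneous_powerSumSeries A (k + 1) h
    rw [← MvPowerSeries.coeff_zero_eq_constantCoeff_apply, map_add, h0, zero_add, map_sum]
    refine Finset.sum_eq_zero fun j _ => ?_
    rw [map_smul, h0, smul_zero]
  · rw [coe_flagSum, ← Finset.add_sum_erase _ _ (Finset.mem_univ i), he1, one_smul, hsplit,
      sum_X_pow_eq_powerSumSeries hnd, add_assoc]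

theorem constantCoeff_aeval {σ : Type*} {W : ℕ → MvPowerSeries σ K}
    (hW : ∀ k, MvPowerSeries.constantCoeff (W k) = 0) (f : MvPolynomial ℕ K) :
    MvPowerSeries.constantCoeff (MvPolynomial.aeval W f) = MvPolynomial.constantCoeff f := by
  induction f using MvPolynomial.induction_on with
  | C a =>
    rw [MvPolynomial.algHom_C, ← MvPowerSeries.c_eq_algebraMap, MvPowerSeries.constantCoeff_C,
      MvPolynomial.constantCoeff_C]
  | add f g hf hg => rw [map_add, map_add, map_add, hf, hg]
  | mul_X f k hf =>
    rw [map_mul, map_mul, MvPolynomial.aeval_X, hW, mul_zero, map_mul,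
      MvPolynomial.constantCoeff_X, mul_zero]

/-- Triangularity is transferred from symmetric functions in single alphabets to their images under
a triangular substitution of power sums. -/
theorem hasLeading_flagHom (he1 : ∀ k i, e k i i = 1) (he0 : ∀ k i j, j < i → e k i j = 0)
    {f : Fin n → MvPolynomial ℕ K} {lam : MultiPtn n}
    (hhom : ∀ i, MvPolynomial.IsWeightedHomogeneous pWeight (f i) (lam i).size)
    (hlead : ∀ i, MvPolynomial.constantCoeff (varCoeff (lam i).descList (f i)) = 1)
    (hdom : ∀ i (l : List ℕ), (lam i).partialSum l.length < l.sum → varCoeff l (f i) = 0) :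
    HasLeading (fun i => (flagHom e (MvPolynomial.rename (Prod.mk i) (f i)) :
      MvPowerSeries (Var n) K)) lam := by
  classical
  simp only [coe_flagHom_rename]
  have key : ∀ (i : Fin n) (m : ℕ), ∃ W : ℕ → MvPowerSeries (Var n) K,
      (∀ k, MvPowerSeries.constantCoeff (W k) = 0) ∧ ∀ d : Var n →₀ ℕ, MvPowerSeries.coeff d
        (MvPolynomial.aeval (fun k => (flagSum e i k : MvPowerSeries (Var n) K)) (f i)) =
      MvPowerSeries.coeff (d.filter fun v => v ∉ (List.range m).map (Prod.mk i))
        (MvPolynomial.aeval W (varCoeff (((List.range m).map (Prod.mk i)).map d) (f i))) := by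
    intro i m
    obtain ⟨W, hW, hW0, hY⟩ := exists_flagSum_eq_sum_X_pow_add he1 i m
    refine ⟨W, hW0, fun d => ?_⟩
    simp only [hY]
    convert coeff_aeval_sum_X_pow_add (List.nodup_range.map (Prod.mk_right_injective i)) hW (f i) d
  refine ⟨fun i d hd => ?_, fun i => ?_, fun i d hd j => ?_, fun i => ?_⟩
  · exact aeval_mem (R := seriesOn K {v | i ≤ v.1}) (flagSum_mem_seriesOn he0 i) (f i) d hd
  · exact isHomogeneous_aeval (isHomogeneous_flagSum i) (hhom i)
  · by_contra! hlt
    obtain ⟨W, -, hW⟩ := key i j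
    rw [hW, hdom, map_zero, map_zero] at hd
    · exact hd rfl
    · rw [List.length_map, List.length_map, List.length_range, List.map_map]
      refine lt_of_lt_of_eq hlt ?_
      rw [Finset.sum_range]
      rw [← List.sum_ofFn, List.ofFn_eq_map, ← List.map_coe_finRange_eq_range, List.map_map]
      rfl
  · obtain ⟨W, hW0, hW⟩ := key i (lam i).descList.length
    rw [hW]
    have h1 : (canonPart lam i).filter
        (fun v => v ∉ (List.range (lam i).descList.length).map (Prod.mk i)) = 0 := by
      rw [Finsupp.filter_eq_zero_iff]
      rintro ⟨j, r⟩ hv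
      rw [canonPart_apply]
      split_ifs with hj
      · obtain rfl : j = i := hj
        refine List.getD_eq_default _ _ (not_lt.1 fun hr => hv ?_)
        exact List.mem_map_of_mem (List.mem_range.2 hr)
      · rfl
    have h2 : ((List.range (lam i).descList.length).map (Prod.mk i)).map (canonPart lam i) =
        (lam i).descList := by
      refine List.ext_getElem (by simp) fun r h3 h4 => ?_
      rw [List.getElem_map, List.getElem_map, List.getElem_range, canonPart_apply, if_pos rfl]
      exact List.getD_eq_getElem _ _ h4
    rw [h1, h2, MvPowerSeries.coeff_zero_eq_constantCoeff_apply, constantCoeff_aeval hW0, hlead]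

end PowerSums

/-! ### The dominance ordering of multi-partitions -/

section Order

variable {n : ℕ}

theorem Dominated.trans {a b c : MultiPtn n} (h1 : Dominated a b) (h2 : Dominated b c) :
    Dominated a c := fun k j => (h1 k j).trans (h2 k j)

theorem Dominated.antisymm {a b : MultiPtn n} (h1 : Dominated a b) (h2 : Dominated b a) :
    a = b := by
  funext k
  refine Ptn.eq_of_partialSum_eq fun j => ?_
  have h3 := le_antisymm (h1 k 0) (h2 k 0)
  rw [Ptn.partialSum_zero, Ptn.partialSum_zero, add_zero, add_zero] at h3
  have h4 := le_antisymm (h1 k j) (h2 k j)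
  rw [h3] at h4
  exact Nat.add_left_cancel h4

theorem Dominated.size_le {a b : MultiPtn n} (h : Dominated a b) : a.size ≤ b.size := by
  cases n with
  | zero => simp [MultiPtn.size]
  | succ n =>
    have hs : ∀ c : MultiPtn (n + 1), c.size =
        ∑ i ∈ Finset.univ.filter (· < Fin.last n), (c i).size + (c (Fin.last n)).size := by
      intro c
      rw [MultiPtn.size, ← Finset.sum_filter_add_sum_filter_not Finset.univ (· < Fin.last n)]
      congr 1
      have : Finset.univ.filter (fun i => ¬ i < Fin.last n) = {Fin.last n} := by
        ext i
        simp [Fin.last_le_iff]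
      rw [this, Finset.sum_singleton]
    have h1 := h (Fin.last n) (a (Fin.last n)).descList.length
    rw [Ptn.partialSum_of_length_le _ le_rfl] at h1
    rw [hs, hs]
    exact h1.trans (Nat.add_le_add_left (Ptn.partialSum_le_size _ _) _)

theorem strictDominated_irrefl (a : MultiPtn n) : ¬ (Dominated a a ∧ a ≠ a) := fun h => h.2 rfl

theorem strictDominated_trans (a b c : MultiPtn n) (h1 : Dominated a b ∧ a ≠ b)
    (h2 : Dominated b c ∧ b ≠ c) : Dominated a c ∧ a ≠ c := by
  refine ⟨h1.1.trans h2.1, ?_⟩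
  rintro rfl
  exact h1.2 (h1.1.antisymm h2.1)

theorem strictDominated_wf : WellFounded fun a b : MultiPtn n => Dominated a b ∧ a ≠ b :=
  wellFounded_of_finite strictDominated_irrefl strictDominated_trans fun b =>
    (MultiPtn.finite_size_le b.size).subset fun _ h => h.1.size_le

end Order

/-! ### From nested power sums to an orthogonal decomposition -/

section Flags

variable {K M : Type*} [Field K] [AddCommGroup M] [Module K M]

/-- The coefficients of the nested power sums `x_0 + ⋯ + x_i` with respect to the family `Y` given
by `Y_i = x_i + β_i Y_{i+1}`. -/
def nestedCoeff (β : ℕ → K) (i j : ℕ) : K :=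
  if j ≤ i then (if j = 0 then 1 else 1 - β (j - 1)) else if j = i + 1 then -β i else 0

theorem nestedCoeff_of_le (β : ℕ → K) {i j : ℕ} (h : j ≤ i) :
    nestedCoeff β i j = if j = 0 then 1 else 1 - β (j - 1) := if_pos h

theorem nestedCoeff_succ (β : ℕ → K) (i : ℕ) : nestedCoeff β i (i + 1) = -β i := by
  rw [nestedCoeff, if_neg (by omega), if_pos rfl]

theorem sum_nestedCoeff_smul {β : ℕ → K} {n : ℕ} (hβ : ∀ i, i + 1 = n → β i = 0) {i : ℕ}
    (hi : i < n) (z : ℕ → M) : ∑ j ∈ Finset.range n, nestedCoeff β i j • z j =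
      ∑ j ∈ Finset.range (i + 1), nestedCoeff β i j • z j - β i • z (i + 1) := by
  rcases Nat.lt_or_ge (i + 1) n with h | h
  · have h1 : Finset.range (i + 2) ⊆ Finset.range n := Finset.range_subset_range.2 h
    rw [← Finset.sum_subset h1, Finset.sum_range_succ, nestedCoeff_succ, neg_smul, sub_eq_add_neg]
    intro j _ hj
    rw [Finset.mem_range] at hj
    rw [nestedCoeff, if_neg (by omega), if_neg (by omega), zero_smul]
  · have h1 : i + 1 = n := by omega
    rw [hβ i h1, zero_smul, sub_zero, h1]

theorem sum_nestedCoeff_smul_eq {β : ℕ → K} {n : ℕ} (hβ : ∀ i, i + 1 = n → β i = 0) {i : ℕ}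
    (hi : i < n) {x Y : ℕ → M} (hY : ∀ i, Y i = x i + β i • Y (i + 1)) :
    ∑ j ∈ Finset.range n, nestedCoeff β i j • Y j = ∑ j ∈ Finset.range (i + 1), x j := by
  rw [sum_nestedCoeff_smul hβ hi]
  clear hi
  have h1 : ∀ i, ∑ j ∈ Finset.range (i + 1), nestedCoeff β i j • Y j =
      ∑ j ∈ Finset.range (i + 1), (if j = 0 then (1 : K) else 1 - β (j - 1)) • Y j := fun i =>
    Finset.sum_congr rfl fun j hj => by
      rw [nestedCoeff_of_le β (Nat.lt_succ_iff.1 (Finset.mem_range.1 hj))]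
  rw [h1]
  induction i with
  | zero => simp [hY 0]
  | succ i ih =>
    rw [Finset.sum_range_succ, Finset.sum_range_succ x (i + 1), ← ih, if_neg (Nat.succ_ne_zero i),
      Nat.add_sub_cancel, sub_smul, one_smul]
    have h2 := hY (i + 1)
    rw [← sub_eq_iff_eq_add] at h2
    rw [← h2]
    abel

/-- If the `Y_j` are orthogonal with norms `d_j`, then the nested power sums are orthogonal with
norms `c_i`. -/
theorem sum_nestedCoeff_mul_nestedCoeff {β c d : ℕ → K} {n : ℕ} (hβ : ∀ i, i + 1 = n → β i = 0)
    (h0 : d 0 = c 0 * (1 - β 0)) (h1 : ∀ i, i + 1 < n → β i * d (i + 1) = c i)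
    (h2 : ∀ i, i + 1 < n → d (i + 1) = c i + c (i + 1) * (1 - β (i + 1))) {i l : ℕ} (hi : i < n)
    (hl : l < n) : ∑ j ∈ Finset.range n, nestedCoeff β i j * nestedCoeff β l j * d j =
      if i = l then c i else 0 := by
  have hS : ∀ i, i < n → ∑ j ∈ Finset.range (i + 1),
      (if j = 0 then (1 : K) else 1 - β (j - 1)) *
        (if j = 0 then (1 : K) else 1 - β (j - 1)) * d j = c i * (1 - β i) := by
    intro i hi
    induction i with
    | zero => simp [h0]
    | succ i ih =>
      rw [Finset.sum_range_succ, ih (by omega), if_neg (Nat.succ_ne_zero i), Nat.add_sub_cancel]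
      linear_combination (1 - β i) * (- h1 i hi) + h2 i hi - h1 i hi
  have key : ∀ i l, i ≤ l → i < n → l < n →
      ∑ j ∈ Finset.range n, nestedCoeff β i j * nestedCoeff β l j * d j =
        if i = l then c i else 0 := by
    intro i l hil hi hl
    have h3 := sum_nestedCoeff_smul hβ hi fun j => nestedCoeff β l j * d j
    simp only [smul_eq_mul, ← mul_assoc] at h3
    have h4 : ∑ j ∈ Finset.range (i + 1), nestedCoeff β i j * nestedCoeff β l j * d j =
        c i * (1 - β i) := by
      rw [← hS i hi]
      refine Finset.sum_congr rfl fun j hj => ?_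
      have hj' := Nat.lt_succ_iff.1 (Finset.mem_range.1 hj)
      rw [nestedCoeff_of_le β hj', nestedCoeff_of_le β (hj'.trans hil)]
    rw [h3, h4]
    rcases Nat.lt_or_ge (i + 1) n with h | h
    · by_cases hE : i = l
      · rw [if_pos hE, ← hE, nestedCoeff_succ]
        linear_combination β i * h1 i h
      · rw [if_neg hE, nestedCoeff_of_le β (by omega), if_neg (Nat.succ_ne_zero i),
          Nat.add_sub_cancel]
        linear_combination (-(1 - β i)) * h1 i h
    · have hE : i = l := by omega
      rw [if_pos hE, hβ i (by omega)]
      ring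
  rcases le_total i l with h | h
  · exact key i l h hi hl
  · rw [Finset.sum_congr rfl fun j _ => by rw [mul_comm (nestedCoeff β i j)], key l i h hl hi]
    by_cases hE : i = l
    · rw [if_pos hE, if_pos hE.symm, hE]
    · rw [if_neg hE, if_neg (Ne.symm hE)]

/-- The coefficients of `Y_i` with respect to the `x_j` if `Y_i = x_i + β_i Y_{i+1}`. -/
def flagCoeff (β : ℕ → K) (i j : ℕ) : K := if i ≤ j then ∏ l ∈ Finset.Ico i j, β l else 0

theorem flagCoeff_self (β : ℕ → K) (i : ℕ) : flagCoeff β i i = 1 := by simp [flagCoeff]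

theorem flagCoeff_of_lt (β : ℕ → K) {i j : ℕ} (h : j < i) : flagCoeff β i j = 0 :=
  if_neg (not_le.2 h)

theorem flagCoeff_eq (β : ℕ → K) (i j : ℕ) :
    flagCoeff β i j = (if j = i then 1 else 0) + β i * flagCoeff β (i + 1) j := by
  rcases lt_trichotomy i j with h | h | h
  · rw [flagCoeff, if_pos h.le, if_neg h.ne', zero_add, flagCoeff, if_pos (Nat.succ_le_of_lt h),
      Finset.prod_eq_prod_Ico_succ_bot h]
  · subst h
    rw [if_pos rfl, flagCoeff_of_lt β (Nat.lt_succ_self i), mul_zero, add_zero, flagCoeff_self]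
  · rw [if_neg h.ne, flagCoeff_of_lt β h, flagCoeff_of_lt β (Nat.lt_succ_of_lt h), mul_zero,
      add_zero]

end Flags

section Nested

variable {K : Type*} [Field K] {n : ℕ}

theorem powerSumSeries_biUnion (s : Finset (Fin n)) (k : ℕ) :
    powerSumSeries K (⋃ j ∈ s, alphabet j) (k + 1) =
      ∑ j ∈ s, powerSumSeries K (alphabet j) (k + 1) := by
  classical
  induction s using Finset.induction_on with
  | empty =>
    ext d
    simp [coeff_powerSumSeries]
  | insert i s hi ih =>
    rw [Finset.set_biUnion_insert, powerSumSeries_union, ih, Finset.sum_insert hi]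
    rw [Set.disjoint_left]
    intro v hv hv'
    obtain ⟨j, hj, hvj⟩ := Set.mem_iUnion₂.1 hv'
    have h1 : v.1 = i := hv
    have h2 : v.1 = j := hvj
    exact hi (h1 ▸ h2 ▸ hj)

/-- The power sum `p_{k+1}(x^{(1)}, …, x^{(i)})` in nested alphabets. -/
def nestedSum (K : Type*) [Field K] (i : Fin n) (k : ℕ) : MultiSym K n :=
  ∑ j ∈ Finset.Iic i, alphabetSum K j k

theorem coe_nestedSum (i : Fin n) (k : ℕ) : (nestedSum K i k : MvPowerSeries (Var n) K) =
    powerSumSeries K (nestedAlphabet i) (k + 1) := by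
  have h : nestedAlphabet i = ⋃ j ∈ Finset.Iic i, alphabet j := by
    simp [nestedAlphabet]
  rw [h, powerSumSeries_biUnion]
  change (MultiSym K n).val (nestedSum K i k) = _
  rw [nestedSum, map_sum]
  rfl

/-- The homomorphism that sends the variable `(i, k)` to `p_{k+1}(x^{(1)}, …, x^{(i)})`. -/
def nestedHom (K : Type*) [Field K] (n : ℕ) : MvPolynomial (Fin n × ℕ) K →ₐ[K] MultiSym K n :=
  MvPolynomial.aeval fun v => nestedSum K v.1 v.2

theorem nestedHom_monomial (lam : MultiPtn n) :
    nestedHom K n (MvPolynomial.monomial (multiPtnEquiv n lam) 1) = multiPowerSum K lam := by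
  rw [← prod_rename_pBasis, map_prod]
  apply Subtype.ext
  change (MultiSym K n).val _ = ∏ i, powerSumProd K (nestedAlphabet i) (lam i)
  rw [map_prod]
  refine Finset.prod_congr rfl fun i _ => ?_
  rw [pBasis_apply, map_multiset_prod, map_multiset_prod, map_multiset_prod, powerSumProd,
    Multiset.map_map, Multiset.map_map, Multiset.map_map]
  refine congrArg _ (Multiset.map_congr rfl fun k hk => ?_)
  simp only [Function.comp_apply]
  rw [MvPolynomial.rename_X, nestedHom, MvPolynomial.aeval_X]
  refine (coe_nestedSum i (k - 1)).trans ?_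
  rw [Nat.sub_add_cancel (Ptn.pos_of_mem hk)]

theorem alphabetSum_mem_range_nestedHom (i : Fin n) (k : ℕ) :
    alphabetSum K i k ∈ (nestedHom K n).range := by
  have h1 : ∀ i, nestedSum K i k ∈ (nestedHom K n).range := fun i =>
    ⟨MvPolynomial.X (i, k), by
      change nestedHom K n _ = _
      rw [nestedHom, MvPolynomial.aeval_X]⟩
  induction i using WellFoundedLT.induction with
  | _ i ih =>
    have h2 : nestedSum K i k = alphabetSum K i k + ∑ j ∈ Finset.Iio i, alphabetSum K j k := by
      rw [nestedSum, ← Finset.Iio_insert, Finset.sum_insert (by simp)]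
    rw [eq_sub_of_add_eq h2.symm]
    exact Subalgebra.sub_mem _ (h1 i) (Subalgebra.sum_mem _ fun j hj => ih j (Finset.mem_Iio.1 hj))

/-- The power sums of the single alphabets are differences of nested ones. -/
theorem range_flagHom_le (e : ℕ → Fin n → Fin n → K) :
    (flagHom e).range ≤ (nestedHom K n).range := by
  rintro _ ⟨f, rfl⟩
  change flagHom e f ∈ _
  induction f using MvPolynomial.induction_on with
  | C a => rw [MvPolynomial.algHom_C]; exact Subalgebra.algebraMap_mem _ a
  | add f g hf hg => rw [map_add]; exact Subalgebra.add_mem _ hf hg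
  | mul_X f v hf =>
    rw [map_mul, flagHom, MvPolynomial.aeval_X]
    exact Subalgebra.mul_mem _ hf (Subalgebra.sum_mem _ fun j _ =>
      Subalgebra.smul_mem _ (alphabetSum_mem_range_nestedHom j v.2) _)

/-- The linear substitution expressing the nested power sums by the `Y_i`. -/
theorem flagHom_linSubst {β : ℕ → ℕ → K} (hβ : ∀ k i, i + 1 = n → β k i = 0)
    (f : MvPolynomial (Fin n × ℕ) K) :
    flagHom (fun k (i j : Fin n) => flagCoeff (β k) i j)
      (linSubst (fun k (i j : Fin n) => nestedCoeff (β k) i j) f) = nestedHom K n f := by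
  induction f using MvPolynomial.induction_on with
  | C a => rw [MvPolynomial.algHom_C, AlgHom.commutes, MvPolynomial.algHom_C]
  | add f g hf hg => rw [map_add, map_add, map_add, hf, hg]
  | mul_X f v hf =>
    obtain ⟨i, k⟩ := v
    rw [map_mul, map_mul, map_mul, hf, linSubst_X, map_sum]
    congr 1
    simp only [map_mul, MvPolynomial.algHom_C, flagHom, nestedHom, MvPolynomial.aeval_X,
      ← Algebra.smul_def]
    set x : ℕ → MultiSym K n := fun j => if h : j < n then alphabetSum K ⟨j, h⟩ k else 0 with hx
    set Y : ℕ → MultiSym K n := fun i => ∑ j : Fin n, flagCoeff (β k) i j • alphabetSum K j k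
      with hYdef
    have hY : ∀ i, Y i = x i + β k i • Y (i + 1) := by
      intro i
      simp only [hYdef]
      rw [Finset.sum_congr rfl fun j _ => by rw [flagCoeff_eq], Finset.smul_sum]
      simp only [add_smul, Finset.sum_add_distrib, mul_smul, ite_smul, one_smul, zero_smul]
      congr 1
      by_cases h : i < n
      · simp only [hx, h, dif_pos]
        rw [Finset.sum_eq_single ⟨i, h⟩]
        · rw [if_pos rfl]
        · exact fun j _ hj => if_neg fun h' => hj (Fin.ext h')
        · exact fun h' => absurd (Finset.mem_univ _) h'
      · simp only [hx, h, dif_neg, not_false_iff]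
        exact Finset.sum_eq_zero fun j _ => if_neg fun h' : (j : ℕ) = i => h (h' ▸ j.2)
    have h1 := sum_nestedCoeff_smul_eq (hβ k) i.2 hY
    rw [Finset.sum_range] at h1
    refine h1.trans ?_
    rw [nestedSum]
    refine Finset.sum_bij' (fun j hj => ⟨j, ?_⟩) (fun j _ => j) ?_ ?_ ?_ ?_ ?_
    · exact (Nat.lt_succ_iff.1 (Finset.mem_range.1 hj)).trans_lt i.2
    · exact fun j hj => Finset.mem_Iic.2 (Nat.lt_succ_iff.1 (Finset.mem_range.1 hj))
    · exact fun j hj => Finset.mem_range.2 (Nat.lt_succ_iff.2 (Fin.le_def.1 (Finset.mem_Iic.1 hj)))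
    · exact fun j hj => rfl
    · exact fun j hj => rfl
    · intro j hj
      have : j < n := (Nat.lt_succ_iff.1 (Finset.mem_range.1 hj)).trans_lt i.2
      simp only [hx, this, dif_pos]

end Nested

/-! ### Generic parameters -/

section Generic

open MvPolynomial

/-- Monomials with linearly independent exponent vectors are algebraically independent. -/
theorem algebraicIndependent_monomial {ι σ F : Type*} [Field F] [CharZero F] (M : ι → σ →₀ ℕ)
    (hM : Function.Injective fun d : ι →₀ ℕ => d.sum fun i a => a • M i) :
    AlgebraicIndependent ℤ fun i => (monomial (M i) 1 : MvPolynomial σ F) := by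
  classical
  rw [algebraicIndependent_iff]
  intro p hp
  ext d
  rw [aeval_def, eval₂_eq] at hp
  have h1 : ∀ e : ι →₀ ℕ, ∏ i ∈ e.support,
      (monomial (M i) 1 : MvPolynomial σ F) ^ e i =
        monomial (e.sum fun i a => a • M i) 1 := by
    intro e
    simp only [monomial_pow, one_pow]
    rw [Finsupp.sum]
    induction e.support using Finset.induction_on with
    | empty => rfl
    | insert i s hi ih =>
      rw [Finset.prod_insert hi, Finset.sum_insert hi, ih, monomial_mul, one_mul]
  have h2 := congrArg (coeff (d.sum fun i a => a • M i)) hp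
  rw [coeff_sum, coeff_zero] at h2
  have h3 : ∀ e ∈ p.support, coeff (d.sum fun i a => a • M i)
      (algebraMap ℤ (MvPolynomial σ F) (coeff e p) * ∏ i ∈ e.support,
        (monomial (M i) 1 : MvPolynomial σ F) ^ e i) =
      if e = d then ((coeff e p : ℤ) : F) else 0 := by
    intro e _
    have h4 : algebraMap ℤ (MvPolynomial σ F) (coeff e p) =
        C ((coeff e p : ℤ) : F) := by simp
    rw [h1, h4, coeff_C_mul, coeff_monomial, mul_ite, mul_one, mul_zero]
    exact if_congr hM.eq_iff rfl rfl
  rw [Finset.sum_congr rfl h3, Finset.sum_ite_eq'] at h2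
  split_ifs at h2 with h5
  · exact_mod_cast h2
  · simpa using h5

variable {F : Type*} [Field F] {φ : MvPolynomial (Fin 2) ℚ →+* F}

theorem algebraicIndependent_map_X (hφ : Function.Injective φ) (a b : Fin 2 → ℕ)
    (hab : ∀ x y x' y' : ℕ, x * a 0 + y * a 1 = x' * a 0 + y' * a 1 →
      x * b 0 + y * b 1 = x' * b 0 + y' * b 1 →
      x = x' ∧ y = y') :
    AlgebraicIndependent ℤ
      ![φ (X 0) ^ a 0 * φ (X 1) ^ b 0, φ (X 0) ^ a 1 * φ (X 1) ^ b 1] := by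
  have h := algebraicIndependent_monomial (F := ℚ)
    (fun i => Finsupp.single (0 : Fin 2) (a i) + Finsupp.single 1 (b i)) (by
      intro d e hde
      simp only at hde
      rw [Finsupp.sum_fintype _ _ (by simp), Finsupp.sum_fintype _ _ (by simp), Fin.sum_univ_two,
        Fin.sum_univ_two] at hde
      have h0 := DFunLike.congr_fun hde 0
      have h1 := DFunLike.congr_fun hde 1
      simp only [Finsupp.add_apply, Finsupp.smul_apply, Finsupp.single_apply, smul_eq_mul] at h0 h1
      obtain ⟨h2, h3⟩ := hab _ _ _ _ (by simpa using h0) (by simpa using h1)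
      ext i
      fin_cases i
      · exact h2
      · exact h3)
  have h1 := h.map' (f := φ.toIntAlgHom) hφ
  convert h1 using 1
  funext i
  have h2 : ∀ x y : ℕ, φ (X 0) ^ x * φ (X 1) ^ y = φ
      (monomial (Finsupp.single 0 x + Finsupp.single 1 y) 1) := by
    intro x y
    rw [← map_pow, ← map_pow, ← map_mul, X_pow_eq_monomial,
      X_pow_eq_monomial, monomial_mul, one_mul]
  fin_cases i
  · exact h2 _ _
  · exact h2 _ _

theorem algebraicIndependent_pow_succ_mul (hφ : Function.Injective φ) (a : ℕ) :
    AlgebraicIndependent ℤ ![φ (X 0) ^ (a + 1) * φ (X 1), φ (X 0) ^ a * φ (X 1)] := by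
  have h := algebraicIndependent_map_X hφ ![a + 1, a] ![1, 1] (by
    intro x y x' y' h1 h2
    simp only [Matrix.cons_val_zero, Matrix.cons_val_one, mul_one] at h1 h2
    have h3 : (x + y) * a = (x' + y') * a := by rw [h2]
    have h4 : x = x' := by linarith
    omega)
  simpa using h

theorem algebraicIndependent_mul (hφ : Function.Injective φ) (a : ℕ) :
    AlgebraicIndependent ℤ ![φ (X 0), φ (X 0) ^ a * φ (X 1)] := by
  have h := algebraicIndependent_map_X hφ ![1, a] ![0, 1] (by
    intro x y x' y' h1 h2
    simp only [Matrix.cons_val_zero, Matrix.cons_val_one, mul_one, mul_zero, zero_add] at h1 h2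
    subst h2
    omega)
  simpa using h

end Generic

/-! ### The parameters of the factors -/

section Parameters

variable {K : Type*} [Field K]

/-- The coefficients `β_i` of the flag of alphabets `Y_i = x_i + β_i Y_{i+1}`, for the power sums of
degree `k + 1`. -/
def flagBeta (q t : K) (n k i : ℕ) : K :=
  if i + 1 = n then 0 else
    q ^ (k + 1) * (1 - (q ^ (n - 2 - i) * t) ^ (k + 1)) / (1 - (q ^ (n - 1 - i) * t) ^ (k + 1))

/-- The first Macdonald parameter of the `i`-th factor. -/
def paramQ (q t : K) (n i : ℕ) : K := if i = 0 then q else q ^ (n - i) * t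

/-- The second Macdonald parameter of the `i`-th factor. -/
def paramT (q t : K) (n i : ℕ) : K := q ^ (n - 1 - i) * t

/-- The norms of the power sums of nested alphabets. -/
def nestedNorm (q t : K) (n i k : ℕ) : K :=
  ((k : K) + 1) * ((q ^ (k + 1)) ^ (n - 1 - i) *
    if i + 1 = n then (1 - q ^ (k + 1)) / (1 - t ^ (k + 1)) else 1)

/-- The norms of the power sums of the flag of alphabets `Y_i`. -/
def flagNorm (q t : K) (n i k : ℕ) : K :=
  macNorm (paramQ q t n i) (paramT q t n i) (q ^ (n - 1 - i)) k

variable {q t : K}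

theorem pow_mul_pow_succ (q t : K) (a m : ℕ) : (q ^ a * t) ^ m = (q ^ m) ^ a * t ^ m := by
  rw [mul_pow, ← pow_mul, ← pow_mul, mul_comm a m]

theorem flagBeta_last {n k i : ℕ} (h : i + 1 = n) : flagBeta q t n k i = 0 := if_pos h

theorem one_sub_pow_ne_zero (hT : ∀ a k : ℕ, (q ^ a * t) ^ (k + 1) ≠ 1) (a k : ℕ) :
    1 - (q ^ (k + 1)) ^ a * t ^ (k + 1) ≠ 0 := by
  rw [← pow_mul_pow_succ, sub_ne_zero]
  exact (hT a k).symm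

theorem flagNorm_zero (hT : ∀ a k : ℕ, (q ^ a * t) ^ (k + 1) ≠ 1) {n : ℕ} (hn : 1 ≤ n) (k : ℕ) :
    flagNorm q t n 0 k = nestedNorm q t n 0 k * (1 - flagBeta q t n k 0) := by
  rcases n with _ | _ | a
  · omega
  · simp [flagNorm, nestedNorm, macNorm, flagBeta, paramQ, paramT, mul_div_assoc]
  · have h1 := one_sub_pow_ne_zero hT (a + 1) k
    rw [flagNorm, nestedNorm, macNorm, flagBeta, paramQ, paramT, if_pos rfl, if_neg (by omega),
      if_neg (by omega)]
    have e1 : a + 1 + 1 - 1 - 0 = a + 1 := rfl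
    have e2 : a + 1 + 1 - 2 - 0 = a := rfl
    rw [e1, e2, pow_mul_pow_succ, pow_mul_pow_succ, pow_right_comm q (a + 1)]
    generalize q ^ (k + 1) = u at *
    generalize t ^ (k + 1) = v at *
    field_simp
    ring

theorem flagBeta_mul_flagNorm (hT : ∀ a k : ℕ, (q ^ a * t) ^ (k + 1) ≠ 1) {n i : ℕ}
    (hi : i + 1 < n) (k : ℕ) :
    flagBeta q t n k i * flagNorm q t n (i + 1) k = nestedNorm q t n i k := by
  obtain ⟨a, rfl⟩ := Nat.exists_eq_add_of_lt hi
  have h1 := one_sub_pow_ne_zero hT (a + 1) k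
  have h2 := one_sub_pow_ne_zero hT a k
  rw [flagNorm, nestedNorm, macNorm, flagBeta, paramQ, paramT, if_neg (by omega), if_neg (by omega),
    if_neg (by omega)]
  have e1 : i + 1 + a + 1 - 1 - i = a + 1 := by omega
  have e2 : i + 1 + a + 1 - 2 - i = a := by omega
  have e3 : i + 1 + a + 1 - 1 - (i + 1) = a := by omega
  have e4 : i + 1 + a + 1 - (i + 1) = a + 1 := by omega
  rw [e1, e2, e3, e4, pow_mul_pow_succ, pow_mul_pow_succ, pow_right_comm q a]
  generalize q ^ (k + 1) = u at *
  generalize t ^ (k + 1) = v at *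
  generalize 1 - u ^ (a + 1) * v = x at *
  generalize 1 - u ^ a * v = y at *
  field_simp
  ring

theorem flagNorm_succ (hT : ∀ a k : ℕ, (q ^ a * t) ^ (k + 1) ≠ 1) {n i : ℕ} (hi : i + 1 < n)
    (k : ℕ) : flagNorm q t n (i + 1) k = nestedNorm q t n i k +
      nestedNorm q t n (i + 1) k * (1 - flagBeta q t n k (i + 1)) := by
  obtain ⟨a, rfl⟩ := Nat.exists_eq_add_of_lt hi
  have h1 := one_sub_pow_ne_zero hT a k
  rw [flagNorm, nestedNorm, nestedNorm, macNorm, flagBeta, paramQ, paramT, if_neg (by omega),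
    if_neg (by omega)]
  have e1 : i + 1 + a + 1 - 1 - i = a + 1 := by omega
  have e2 : i + 1 + a + 1 - 2 - (i + 1) = a - 1 := by omega
  have e3 : i + 1 + a + 1 - 1 - (i + 1) = a := by omega
  have e4 : i + 1 + a + 1 - (i + 1) = a + 1 := by omega
  rw [e1, e2, e3, e4, pow_mul_pow_succ, pow_mul_pow_succ, pow_mul_pow_succ,
    pow_right_comm q a]
  generalize q ^ (k + 1) = u at *
  generalize t ^ (k + 1) = v at *
  rcases a with _ | a
  · rw [if_pos (by omega), if_pos (by omega)]
    rw [pow_zero, one_mul] at h1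
    simp only [pow_zero, one_mul, zero_add, pow_one]
    field_simp
    ring
  · rw [if_neg (by omega), if_neg (by omega)]
    rw [Nat.add_sub_cancel]
    field_simp
    ring

/-- The nested power sums have the prescribed norms. -/
theorem polyForm_linSubst_nestedCoeff (hT : ∀ a k : ℕ, (q ^ a * t) ^ (k + 1) ≠ 1) {n : ℕ}
    (hn : 1 ≤ n) (f g : MvPolynomial (Fin n × ℕ) K) :
    polyForm (fun v => flagNorm q t n v.1 v.2)
      (linSubst (fun k (i j : Fin n) => nestedCoeff (flagBeta q t n k) i j) f)
      (linSubst (fun k (i j : Fin n) => nestedCoeff (flagBeta q t n k) i j) g) =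
    polyForm (fun v => nestedNorm q t n v.1 v.2) f g := by
  refine polyForm_linSubst (fun k i l => ?_) f g
  have h := sum_nestedCoeff_mul_nestedCoeff (β := flagBeta q t n k)
    (c := fun i => nestedNorm q t n i k)
    (d := fun i => flagNorm q t n i k) (fun i hi => flagBeta_last hi) (flagNorm_zero hT hn k)
    (fun i hi => flagBeta_mul_flagNorm hT hi k) (fun i hi => flagNorm_succ hT hi k) i.2 l.2
  rw [Finset.sum_range] at h
  simp only [h, Fin.ext_iff]

end Parameters

section Norms

variable {K : Type*} [Field K]

theorem zpow_finset_sum {F : Type*} [Field F] {q : F} (hq : q ≠ 0) {ι : Type*}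
    (s : Finset ι) (a : ι → ℤ) :
    q ^ ∑ i ∈ s, a i = ∏ i ∈ s, q ^ a i := by
  classical
  induction s using Finset.induction_on with
  | empty => simp
  | insert i s hi ih => rw [Finset.sum_insert hi, Finset.prod_insert hi, zpow_add₀ hq, ih]

/-- The norms of the monomials in the nested power sums. -/
theorem polyForm_nestedNorm_monomial {q t : K} (hq : q ≠ 0) {n : ℕ} (lam mu : MultiPtn n)
    [Decidable (lam = mu)] :
    polyForm (fun v : Fin n × ℕ => nestedNorm q t n v.1 v.2)
      (MvPolynomial.monomial (multiPtnEquiv n lam) 1)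
      (MvPolynomial.monomial (multiPtnEquiv n mu) 1) =
      if lam = mu then zWeight q t lam else 0 := by
  classical
  rw [← prod_rename_pBasis, ← prod_rename_pBasis, polyForm_prod_rename]
  have h1 : ∀ i : Fin n, polyForm (fun k => nestedNorm q t n i k) (pBasis K (lam i))
      (pBasis K (mu i)) = if lam i = mu i then
        ((lam i).z : K) * ((q ^ (n - 1 - (i : ℕ))) ^ (lam i).size *
        if (i : ℕ) + 1 = n then ((lam i).parts.map fun k => (1 - q ^ k) / (1 - t ^ k)).prod else 1)
        else 0 := by
    intro i
    rw [pBasis_eq_monomial, pBasis_eq_monomial, polyForm_monomial, one_mul,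
      MvPolynomial.coeff_monomial]
    by_cases h : lam i = mu i
    · rw [if_pos h, if_pos (by rw [h]), mul_one,
        monomialWeight_ptnEquiv (fun k => nestedNorm q t n i k)
          (fun m => (q ^ m) ^ (n - 1 - (i : ℕ)) *
          if (i : ℕ) + 1 = n then (1 - q ^ m) / (1 - t ^ m) else 1) fun k => rfl,
        Multiset.prod_map_mul]
      congr 2
      · rw [Ptn.size_eq_sum]
        induction (lam i).parts using Multiset.induction with
        | empty => simp
        | cons a s ih =>
          rw [Multiset.map_cons, Multiset.prod_cons, Multiset.sum_cons, pow_add, ih,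
            pow_right_comm q a]
      · split_ifs with hi
        · rfl
        · simp
    · rw [if_neg h, if_neg fun h' => h (ptnEquiv.injective h').symm, mul_zero]
  rw [Finset.prod_congr rfl fun i _ => h1 i]
  by_cases h : lam = mu
  · subst h
    simp only [if_true]
    rw [Finset.prod_mul_distrib, Finset.prod_mul_distrib, zWeight, ← mul_assoc,
      mul_comm (∏ i, ((lam i).z : K))]
    congr 2
    rw [MultiPtn.size, Nat.cast_sum, Finset.mul_sum, ← Finset.sum_sub_distrib,
      zpow_finset_sum hq]
    refine Finset.prod_congr rfl fun i _ => ?_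
    rw [← pow_mul, ← zpow_natCast, Nat.cast_mul, ← sub_mul]
    congr 2
    have := i.2
    omega
  · rw [if_neg h]
    obtain ⟨i, hi⟩ := Function.ne_iff.1 h
    exact Finset.prod_eq_zero (Finset.mem_univ i) (if_neg hi)

end Norms

/-! ### Existence and uniqueness of the multi-Macdonald functions -/

section Main

variable {K : Type*} [Field K] {q t : K} {n : ℕ}

/-- An orthogonal family of polynomials in the power sums of the alphabets `Y_i`, mapped to a
unitriangular basis of the multi-symmetric functions. -/
theorem exists_orthogonal_basis [CharZero K] (hq : q ≠ 0) (ht : t ≠ 0)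
    (hqt : ∀ a, AlgebraicIndependent ℤ ![q, q ^ a * t])
    (hqt' : ∀ a, AlgebraicIndependent ℤ ![q ^ (a + 1) * t, q ^ a * t]) :
    ∃ (b : Module.Basis (MultiPtn n) K (MvPolynomial (Fin n × ℕ) K))
      (P : Module.Basis (MultiPtn n) K (MultiSym K n)),
      (∀ lam, P lam = flagHom (fun k (i j : Fin n) => flagCoeff (flagBeta q t n k) i j) (b lam)) ∧
      (∀ lam mu, lam ≠ mu →
        polyForm (fun v => flagNorm q t n v.1 v.2) (b lam) (b mu) = 0) ∧
      IsUnitriangular P ∧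
      ∀ lam, MvPowerSeries.IsHomogeneous (P lam : MvPowerSeries (Var n) K) lam.size := by
  set e : ℕ → Fin n → Fin n → K := fun k i j => flagCoeff (flagBeta q t n k) i j with he
  have hgen : ∀ i : Fin n, AlgebraicIndependent ℤ ![paramQ q t n i, paramT q t n i] := by
    intro i
    rw [paramQ, paramT]
    split_ifs with hi
    · exact hqt _
    · have : n - (i : ℕ) = n - 1 - i + 1 := by have := i.2; omega
      rw [this]
      exact hqt' _
  choose f hspan horth hhom hlead hdom using fun i : Fin n =>
    exists_macdonald (pow_ne_zero (n - 1 - (i : ℕ)) hq)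
      (mul_ne_zero (pow_ne_zero _ hq) ht : paramT q t n i ≠ 0) (hgen i)
  set g : MultiPtn n → MvPolynomial (Fin n × ℕ) K :=
    fun lam => ∏ i, MvPolynomial.rename (Prod.mk i) (f i (lam i)) with hg
  have hL : ∀ lam : MultiPtn n, HasLeading (fun i => (flagHom e (MvPolynomial.rename (Prod.mk i)
      (f i (lam i))) : MvPowerSeries (Var n) K)) lam := fun lam =>
    hasLeading_flagHom (fun k i => flagCoeff_self _ _) (fun k i j h => flagCoeff_of_lt _ h)
      (fun i => hhom i _) (fun i => hlead i _) (fun i l => hdom i _ l)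
  have hcoe : ∀ lam, (flagHom e (g lam) : MvPowerSeries (Var n) K) =
      ∏ i, (flagHom e (MvPolynomial.rename (Prod.mk i) (f i (lam i))) :
        MvPowerSeries (Var n) K) := by
    intro lam
    change (MultiSym K n).val _ = _
    simp only [hg, map_prod]
    rfl
  have htri : IsUnitriangular fun lam => flagHom e (g lam) := fun lam =>
    (hL lam).sub_mem (hcoe lam)
  obtain ⟨m, hm⟩ := exists_multiMonomial_basis K n
  have htri' : Unitri K (fun a b : MultiPtn n => Dominated a b ∧ a ≠ b) m
      fun lam => flagHom e (g lam) := by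
    intro lam
    simpa only [funext hm] using htri lam
  have hli := htri'.linearIndependent m strictDominated_irrefl strictDominated_trans
  have hsp := htri'.top_le_span strictDominated_wf strictDominated_trans m.span_eq.ge
  have hgli : LinearIndependent K g := LinearIndependent.of_comp (flagHom e).toLinearMap hli
  refine ⟨Module.Basis.mk hgli (span_prod_rename hspan), Module.Basis.mk hli hsp, fun lam => ?_,
    fun lam mu h => ?_, fun lam => ?_, fun lam => ?_⟩
  · rw [Module.Basis.mk_apply, Module.Basis.mk_apply]
  · rw [Module.Basis.mk_apply, Module.Basis.mk_apply]
    simp only [hg]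
    rw [polyForm_prod_rename]
    obtain ⟨i, hi⟩ := Function.ne_iff.1 h
    exact Finset.prod_eq_zero (Finset.mem_univ i) (horth i _ _ hi)
  · rw [Module.Basis.mk_apply]
    exact htri lam
  · rw [Module.Basis.mk_apply, hcoe]
    exact (hL lam).homogeneous_prod

/-- The nested power sums generate the same algebra as the `Y_i`. -/
theorem span_multiPowerSum (P : Module.Basis (MultiPtn n) K (MultiSym K n))
    {e : ℕ → Fin n → Fin n → K} (hP : ∀ lam, P lam ∈ (flagHom e).range) :
    ⊤ ≤ Submodule.span K (Set.range (multiPowerSum K : MultiPtn n → MultiSym K n)) := by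
  have h1 : (multiPowerSum K : MultiPtn n → MultiSym K n) =
      (nestedHom K n).toLinearMap ∘ (MvPolynomial.basisMonomials (Fin n × ℕ) K) ∘
        multiPtnEquiv n := by
    funext lam
    rw [← nestedHom_monomial]
    simp
  rw [h1, Set.range_comp, Submodule.span_image, (multiPtnEquiv n).surjective.range_comp,
    Module.Basis.span_eq, Submodule.map_top, ← P.span_eq, Submodule.span_le]
  rintro _ ⟨lam, rfl⟩
  exact range_flagHom_le e (hP lam)

/-- Existence and uniqueness for generic parameters in a field of characteristic zero; the form is
transported from the polynomial ring along the isomorphism given by the bases. -/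
theorem exists_scalarProduct_and_basis [CharZero K] (hn : 1 ≤ n) (hq : q ≠ 0) (ht : t ≠ 0)
    (hqt : ∀ a, AlgebraicIndependent ℤ ![q, q ^ a * t])
    (hqt' : ∀ a, AlgebraicIndependent ℤ ![q ^ (a + 1) * t, q ^ a * t]) :
    (∃! B : LinearMap.BilinForm K (MultiSym K n), IsScalarProduct q t B) ∧
    ∀ B : LinearMap.BilinForm K (MultiSym K n), IsScalarProduct q t B →
      ∃ P : Module.Basis (MultiPtn n) K (MultiSym K n),
        (IsUnitriangular P ∧ IsOrthogonal B P) ∧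
        (∀ lam : MultiPtn n,
          MvPowerSeries.IsHomogeneous (P lam : MvPowerSeries (Var n) K) (MultiPtn.size lam)) ∧
        ∀ P' : Module.Basis (MultiPtn n) K (MultiSym K n),
          IsUnitriangular P' → IsOrthogonal B P' → P' = P := by
  classical
  obtain ⟨b, P, hPb, horth, htri, hhom⟩ := exists_orthogonal_basis (n := n) hq ht hqt hqt'
  set Ψ := flagHom fun k (i j : Fin n) => flagCoeff (flagBeta q t n k) i j with hΨ
  have hT : ∀ a k : ℕ, (q ^ a * t) ^ (k + 1) ≠ 1 := fun a k =>
    pow_ne_one_left (AlgebraicIndependent.swap (hqt a)) k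
  have hQ : ∀ i k : ℕ, paramQ q t n i ^ (k + 1) ≠ 1 := by
    intro i k
    rw [paramQ]
    split_ifs
    · exact pow_ne_one_left (hqt 0) k
    · exact hT _ k
  set D := polyForm fun v : Fin n × ℕ => flagNorm q t n v.1 v.2 with hD
  -- `Ψ` is bijective since it maps a basis to a basis.
  have hequiv : ∀ f, b.equiv P (Equiv.refl _) f = Ψ f := by
    have : (b.equiv P (Equiv.refl _)).toLinearMap = Ψ.toLinearMap := b.ext fun lam => by
      simp [hPb]
    exact fun f => LinearMap.congr_fun this f
  have hsymm : ∀ f, (b.equiv P (Equiv.refl _)).symm (Ψ f) = f := fun f => by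
    rw [← hequiv, LinearEquiv.symm_apply_apply]
  set B₀ : LinearMap.BilinForm K (MultiSym K n) :=
    D.compl₁₂ (b.equiv P (Equiv.refl _)).symm.toLinearMap
      (b.equiv P (Equiv.refl _)).symm.toLinearMap
    with hB₀
  have hB₀Ψ : ∀ f g, B₀ (Ψ f) (Ψ g) = D f g := fun f g => by
    simp only [hB₀, LinearMap.compl₁₂_apply, LinearEquiv.coe_coe, hsymm]
  have hB₀s : IsScalarProduct q t B₀ := by
    intro lam mu
    rw [← nestedHom_monomial, ← nestedHom_monomial,
      ← flagHom_linSubst (β := flagBeta q t n) (fun k i hi => flagBeta_last hi),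
      ← flagHom_linSubst (β := flagBeta q t n) (fun k i hi => flagBeta_last hi), hB₀Ψ, hD,
      polyForm_linSubst_nestedCoeff hT hn, polyForm_nestedNorm_monomial hq]
  have hspan := span_multiPowerSum P (e := fun k (i j : Fin n) => flagCoeff (flagBeta q t n k) i j)
    fun lam => ⟨b lam, (hPb lam).symm⟩
  have huniq : ∀ B : LinearMap.BilinForm K (MultiSym K n), IsScalarProduct q t B → B = B₀ := by
    intro B hB
    refine LinearMap.ext_on_range (top_le_iff.1 hspan) fun lam => ?_
    refine LinearMap.ext_on_range (top_le_iff.1 hspan) fun mu => ?_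
    rw [hB, hB₀s]
  refine ⟨⟨B₀, hB₀s, huniq⟩, fun B hB => ?_⟩
  obtain rfl := huniq B hB
  have hPorth : IsOrthogonal B₀ P := fun lam mu h => by
    rw [hPb, hPb, hB₀Ψ, horth lam mu h]
  refine ⟨P, ⟨htri, hPorth⟩, hhom, fun P' htri' horth' => ?_⟩
  apply Module.Basis.eq_of_apply_eq
  intro lam
  refine congrFun (Unitri.eq_of_orthogonal (b := multiMonomial K) strictDominated_wf
    strictDominated_trans strictDominated_irrefl B₀ htri htri' hPorth horth' fun lam h0 => ?_) lam
  -- A vector of norm zero in an orthogonal basis lies in the radical.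
  rw [hPb, hB₀Ψ] at h0
  have hzero : D (b lam) = 0 := b.ext fun mu => by
    by_cases h : lam = mu
    · rw [← h, h0, LinearMap.zero_apply]
    · rw [horth lam mu h, LinearMap.zero_apply]
  refine b.ne_zero lam (polyForm_nondegenerate
    (c := fun v : Fin n × ℕ => flagNorm q t n v.1 v.2) (fun v => ?_) fun g => ?_)
  · exact macNorm_ne_zero (pow_ne_zero _ hq) (hQ _) (fun k => hT _ k) _
  · rw [polyForm_symm]
    exact LinearMap.congr_fun hzero g

end Main

end MultiMac

end

open MultiMac in
theorem theorem1 (n : ℕ) (hn : 1 ≤ n) :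
    (∃! B : LinearMap.BilinForm Qqt (MultiSym Qqt n), IsScalarProduct qVar tVar B) ∧
    ∀ B : LinearMap.BilinForm Qqt (MultiSym Qqt n), IsScalarProduct qVar tVar B →
      ∃ P : Module.Basis (MultiPtn n) Qqt (MultiSym Qqt n),
        (IsUnitriangular P ∧ IsOrthogonal B P) ∧
        (∀ lam : MultiPtn n,
          MvPowerSeries.IsHomogeneous (P lam : MvPowerSeries (Var n) Qqt) (MultiPtn.size lam)) ∧
        ∀ P' : Module.Basis (MultiPtn n) Qqt (MultiSym Qqt n),
          IsUnitriangular P' → IsOrthogonal B P' → P' = P := by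
  have hφ : Function.Injective (algebraMap (MvPolynomial (Fin 2) ℚ) Qqt) :=
    IsFractionRing.injective _ _
  have : CharZero Qqt := algebraRat.charZero Qqt
  have hne : ∀ i, algebraMap (MvPolynomial (Fin 2) ℚ) Qqt (MvPolynomial.X i) ≠ 0 := fun i =>
    (map_ne_zero_iff _ hφ).2 (MvPolynomial.X_ne_zero i)
  exact exists_scalarProduct_and_basis hn (hne 0) (hne 1) (algebraicIndependent_mul hφ)
    (algebraicIndependent_pow_succ_mul hφ)
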